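/- Let $\mathcal L^*$ be the two-sorted first-order language with set variables $x,y,z,\dots$, class variables $X,Y,Z,\dots$ (every set is a class), a constant $\bar V$, a binary function symbol $P$, and atomic formulas $s\in t$, $s=t$ for arbitrary terms. An $\mathcal L^*$-formula is *stratified* if its class variables can be assigned natural numbers (types), one to each variable, and each occurrence of a term a type, such that a term has the type of every class variable occurring in it, both sides of each $s=t$ have the same type, and for each $s\in t$ the type of $t$ is one more than that of $s$. Write $\varnothing$ for the unique set without sets as elements, and $\mathcal S(X)$ for "$X=\varnothing$ or $X$ has an element". Let $S^*$ be the $\mathcal L^*$-theory axiomatized by the universal closures of: 1. $\exists Y\forall X(X\in Y\leftrightarrow\phi(X,\vec Z))$ for stratified $\phi$; 2. $\mathcal S(X)\wedge\mathcal S(Y)\to(X=Y\leftrightarrow\forall Z(Z\in X\leftrightarrow Z\in Y))$; 3. $P(X_1,X_2)=P(Y_1,Y_2)\to X_1=Y_1\wedge X_2=Y_2$; 4. $\forall x\exists X(x=X)$; $X\in\bar V\leftrightarrow\exists x(x=X)$; $X\in x\to X\in\bar V$; 5. $\exists! z\forall y(y\notin z)$; 6. $\{x,y\}\in\bar V$;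 $\bigcup x\in\bar V$; $\mathcal P(x)\in\bar V$, where $\mathcal P(x)=\{Z:\mathcal S(Z)\wedge Z\subseteq x\}$; $P(x,y)=\{\{x\},\{x,y\}\}$; 7. $\exists a(\exists z(z\in a\wedge\forall y(y\notin z))\wedge\forall x(x\in a\to x\cup\{x\}\in a))$; 8. $\forall x\forall y_1\forall y_2(\phi(x,y_1,\vec Z)\wedge\phi(x,y_2,\vec Z)\to y_1=y_2)\to\forall a\exists b\forall y(y\in b\leftrightarrow\exists x(x\in a\wedge\phi(x,y,\vec Z)))$ for all $\mathcal L^*$-formulas $\phi$; 9. $\exists x\,\phi(x,\vec Z)\to\exists x(\phi(x,\vec Z)\wedge\forall y\in x\,\neg\phi(y,\vec Z))$ for all $\mathcal L^*$-formulas $\phi$; 10. $\exists C\big(\forall X\forall Y_1\forall Y_2(P(X,Y_1)\in C\wedge P(X,Y_2)\in C\to Y_1=Y_2)\wedge\forall X(\exists Y(Y\in X)\to\exists Y(Y\in X\wedge P(X,\{Y\})\in C))\big)$. Let $\mathrm{ZC}$ be Zermelo set theory with choice, that is, the theory in the language $\{\in\}$ with the axioms of extensionality, pair, union, power set, infinity,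 foundation and choice and the separation schema. An inaccessible cardinal is an uncountable regular strong limit cardinal. Let $\mathrm{Con}(\mathrm{ZC}+\exists\kappa\text{ "}\kappa\text{ is an inaccessible cardinal"})$ be the $\mathcal L^*$-sentence which says, with formulas and finite proofs coded by hereditarily finite sets in $\bar V$, that there is no first-order proof of falsity from the axioms of $\mathrm{ZC}$ and "there is an inaccessible cardinal". **Theorem.** $S^*\vdash\mathrm{Con}(\mathrm{ZC}+\exists\kappa\text{ "}\kappa\text{ is an inaccessible cardinal"})$. -/

import Mathlib

namespace FefermanS

/-! ## The two-sorted language of `S*` -/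

/-- Terms of the language of `S*`, in de Bruijn style: class variables and set variables have
separate index spaces.  `V` is the constant for the class of all sets and `P` is the binary
function symbol for type-level pairs. -/
inductive LTerm : Type
  | cvar (i : ℕ)
  | svar (i : ℕ)
  | V
  | P (s t : LTerm)

/-- Formulas of the language of `S*`.  Membership and equality may be written between arbitrary
terms; `allC` quantifies over classes and binds class index `0`, `allS` quantifies over sets and
binds set index `0`. -/
inductive LForm : Type
  | mem (s t : LTerm)
  | eq (s t : LTerm)
  | bot
  | imp (φ ψ : LForm)
  | allC (φ : LForm)
  | allS (φ : LForm)

/-- Simultaneous substitution of `σ i` for class variable `i` and `τ i` for set variable `i`. -/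
def LTerm.subst (σ τ : ℕ → LTerm) : LTerm → LTerm
  | .cvar i => σ i
  | .svar i => τ i
  | .V => .V
  | .P s t => .P (s.subst σ τ) (t.subst σ τ)

/-- Shift of all class variables by one. -/
def LTerm.liftC (t : LTerm) : LTerm := t.subst (fun i => .cvar (i + 1)) .svar

/-- Shift of all set variables by one. -/
def LTerm.liftS (t : LTerm) : LTerm := t.subst .cvar (fun i => .svar (i + 1))

/-- The sequence `t, f 0, f 1, …`. -/
def scons {α : Type} (t : α) (f : ℕ → α) : ℕ → α
  | 0 => t
  | i + 1 => f i

/-- Simultaneous capture-avoiding substitution in a formula. -/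
def LForm.subst (σ τ : ℕ → LTerm) : LForm → LForm
  | .mem s t => .mem (s.subst σ τ) (t.subst σ τ)
  | .eq s t => .eq (s.subst σ τ) (t.subst σ τ)
  | .bot => .bot
  | .imp φ ψ => .imp (φ.subst σ τ) (ψ.subst σ τ)
  | .allC φ => .allC (φ.subst (scons (.cvar 0) fun i => (σ i).liftC) fun i => (τ i).liftC)
  | .allS φ => .allS (φ.subst (fun i => (σ i).liftS) (scons (.svar 0) fun i => (τ i).liftS))

/-- Shift of all free class variables by one. -/
def LForm.liftC (φ : LForm) : LForm := φ.subst (fun i => .cvar (i + 1)) .svar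

/-- Shift of all free set variables by one. -/
def LForm.liftS (φ : LForm) : LForm := φ.subst .cvar (fun i => .svar (i + 1))

/-- Instantiation of class variable `0` by the term `t` (the other class variables move down). -/
def LForm.instC (t : LTerm) (φ : LForm) : LForm := φ.subst (scons t .cvar) .svar

/-- Instantiation of set variable `0` by the set variable `k` (the other ones move down). -/
def LForm.instS (k : ℕ) (φ : LForm) : LForm := φ.subst .cvar (scons (.svar k) .svar)

/-! ## Provability -/

/-- `Provable T φ`: the formula `φ` is derivable from the axioms `T` in a Hilbert calculus for
two-sorted classical first-order logic with equality, in which every set is a class.  Class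
quantifiers are instantiated by arbitrary terms, set quantifiers by set variables.  Because of the
two generalization rules an open formula in `T` has the same effect as its universal closure. -/
inductive Provable (T : LForm → Prop) : LForm → Prop
  | ax {φ} : T φ → Provable T φ
  | mp {φ ψ} : Provable T (.imp φ ψ) → Provable T φ → Provable T ψ
  | genC {φ} : Provable T φ → Provable T (.allC φ)
  | genS {φ} : Provable T φ → Provable T (.allS φ)
  | imp_k (φ ψ) : Provable T (.imp φ (.imp ψ φ))
  | imp_s (φ ψ χ) :
      Provable T (.imp (.imp φ (.imp ψ χ)) (.imp (.imp φ ψ) (.imp φ χ)))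
  | dne (φ) : Provable T (.imp (.imp (.imp φ .bot) .bot) φ)
  | allC_inst (φ : LForm) (t : LTerm) : Provable T (.imp (.allC φ) (φ.instC t))
  | allS_inst (φ : LForm) (k : ℕ) : Provable T (.imp (.allS φ) (φ.instS k))
  | allC_imp (φ ψ) : Provable T (.imp (.allC (.imp φ ψ)) (.imp (.allC φ) (.allC ψ)))
  | allS_imp (φ ψ) : Provable T (.imp (.allS (.imp φ ψ)) (.imp (.allS φ) (.allS ψ)))
  | allC_vac (φ : LForm) : Provable T (.imp φ (.allC φ.liftC))
  | allS_vac (φ : LForm) : Provable T (.imp φ (.allS φ.liftS))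
  | eq_refl (t) : Provable T (.eq t t)
  | eq_subst (φ : LForm) (s t : LTerm) : Provable T (.imp (.eq s t) (.imp (φ.instC s) (φ.instC t)))

/-! ## Stratification -/

/-- Every class variable occurring in the term has type `n`. -/
def LTerm.HasType (τ : ℕ → ℕ) (n : ℕ) : LTerm → Prop
  | .cvar i => τ i = n
  | .svar _ => True
  | .V => True
  | .P s t => s.HasType τ n ∧ t.HasType τ n

/-- The formula is stratified by an assignment of types to its class variables that extends `τ`
(the types of the free ones).  Occurrences of set variables and of `V` may be typed freely. -/
def LForm.StratifiedBy : (ℕ → ℕ) → LForm → Prop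
  | τ, .mem s t => ∃ n, s.HasType τ n ∧ t.HasType τ (n + 1)
  | τ, .eq s t => ∃ n, s.HasType τ n ∧ t.HasType τ n
  | _, .bot => True
  | τ, .imp φ ψ => φ.StratifiedBy τ ∧ ψ.StratifiedBy τ
  | τ, .allC φ => ∃ n, φ.StratifiedBy (scons n τ)
  | τ, .allS φ => φ.StratifiedBy τ

/-- Stratified formulas. -/
def LForm.Stratified (φ : LForm) : Prop := ∃ τ, φ.StratifiedBy τ

/-! ## Writing formulas with bound variables as Lean functions

A `Bld` is a formula under construction, as a function of the numbers `c` and `s` of class and set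
quantifiers above it.  In a `Bld`, variables are named by the number of quantifiers of their sort
above their binder (de Bruijn levels), so that `allS fun x => …` passes a name that stays valid
below further quantifiers; `LTerm.toIndex` turns levels into indices. -/

/-- Formulas under construction. -/
abbrev Bld : Type := ℕ → ℕ → LForm

/-- From levels to indices, below `c` class quantifiers and `s` set quantifiers. -/
def LTerm.toIndex (c s : ℕ) : LTerm → LTerm
  | .cvar k => .cvar (c - 1 - k)
  | .svar k => .svar (s - 1 - k)
  | .V => .V
  | .P t u => .P (t.toIndex c s) (u.toIndex c s)

namespace Bld

def mem (t u : LTerm) : Bld := fun c s => .mem (t.toIndex c s) (u.toIndex c s)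
def eq (t u : LTerm) : Bld := fun c s => .eq (t.toIndex c s) (u.toIndex c s)
def bot : Bld := fun _ _ => .bot
def imp (A B : Bld) : Bld := fun c s => .imp (A c s) (B c s)
def allC (A : LTerm → Bld) : Bld := fun c s => .allC (A (.cvar c) (c + 1) s)
def allS (A : LTerm → Bld) : Bld := fun c s => .allS (A (.svar s) c (s + 1))
def neg (A : Bld) : Bld := imp A bot
def and (A B : Bld) : Bld := neg (imp A (neg B))
def or (A B : Bld) : Bld := imp (neg A) B
def iff (A B : Bld) : Bld := and (imp A B) (imp B A)
def exC (A : LTerm → Bld) : Bld := neg (allC fun X => neg (A X))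
def exS (A : LTerm → Bld) : Bld := neg (allS fun x => neg (A x))

/-- The given formula `φ` with its first class variables replaced by `Xs`, its first set variables
replaced by `xs`, and its remaining free variables left free as parameters. -/
def app (φ : LForm) (Xs xs : List LTerm) : Bld := fun c s =>
  φ.subst
    (fun i => match Xs[i]? with
      | some t => t.toIndex c s
      | none => .cvar (i - Xs.length + c))
    (fun i => match xs[i]? with
      | some t => t.toIndex c s
      | none => .svar (i - xs.length + s))

/-- The finished formula. -/
def close (A : Bld) : LForm := A 0 0

end Bld

local infix:50 " ∊ " => Bld.mem
local infix:50 " ≐ " => Bld.eq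
local prefix:max "∼" => Bld.neg
local infixr:35 " ⋏ " => Bld.and
local infixr:30 " ⋎ " => Bld.or
local infixr:25 " ⟹ " => Bld.imp
local infix:20 " ⟺ " => Bld.iff

open LTerm Bld

/-! ## The axioms of `S*` -/

/-- `z` has no sets as elements. -/
def isEmpty (z : LTerm) : Bld := allS fun y => ∼(y ∊ z)

/-- `X` is the designated empty set or has an element (it is not one of the other atoms). -/
def sethood (X : LTerm) : Bld := (exC fun Z => Z ∊ X) ⋎ exS fun z => isEmpty z ⋏ X ≐ z

/-- `W = {X, Y}`. -/
def isPair (W X Y : LTerm) : Bld := allC fun Z => Z ∊ W ⟺ Z ≐ X ⋎ Z ≐ Y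

/-- `W = {X}`. -/
def isSingleton (W X : LTerm) : Bld := allC fun Z => Z ∊ W ⟺ Z ≐ X

/-- `w = x ∪ {x}`, for sets. -/
def isSucc (w x : LTerm) : Bld := allS fun y => y ∊ w ⟺ y ∊ x ⋎ y ≐ x

/-- `a` contains the empty set and is closed under `x ↦ x ∪ {x}`. -/
def isInductive (a : LTerm) : Bld :=
  (exS fun z => z ∊ a ⋏ isEmpty z) ⋏
    allS fun x => x ∊ a ⟹ exS fun w => isSucc w x ⋏ w ∊ a

def comprehension (φ : LForm) : LForm :=
  close <| exC fun Y => allC fun X => X ∊ Y ⟺ app φ [X] []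

def weakExtensionality : LForm :=
  close <| allC fun X => allC fun Y =>
    sethood X ⋏ sethood Y ⟹ (X ≐ Y ⟺ allC fun Z => Z ∊ X ⟺ Z ∊ Y)

def pairing : LForm :=
  close <| allC fun X₁ => allC fun X₂ => allC fun Y₁ => allC fun Y₂ =>
    P X₁ X₂ ≐ P Y₁ Y₂ ⟹ X₁ ≐ Y₁ ⋏ X₂ ≐ Y₂

def setsAreClasses : LForm := close <| allS fun x => exC fun X => x ≐ X

def elementsOfV : LForm := close <| allC fun X => X ∊ V ⟺ exS fun x => x ≐ X

def elementsOfSets : LForm := close <| allC fun X => allS fun x => X ∊ x ⟹ X ∊ V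

def emptySet : LForm :=
  close <| exS fun z => isEmpty z ⋏ allS fun w => isEmpty w ⟹ w ≐ z

def unorderedPair : LForm :=
  close <| allS fun x => allS fun y => exC fun W => isPair W x y ⋏ W ∊ V

def union : LForm :=
  close <| allS fun x =>
    exC fun W => (allC fun Z => Z ∊ W ⟺ exC fun U => U ∊ x ⋏ Z ∊ U) ⋏ W ∊ V

def power : LForm :=
  close <| allS fun x =>
    exC fun W =>
      (allC fun Z => Z ∊ W ⟺ sethood Z ⋏ allC fun U => U ∊ Z ⟹ U ∊ x) ⋏ W ∊ V

/-- `P(x, y) = {{x}, {x, y}}` for sets `x`, `y`. -/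
def kuratowski : LForm :=
  close <| allS fun x => allS fun y => allC fun Z =>
    Z ∊ P x y ⟺ isSingleton Z x ⋎ isPair Z x y

def infinity : LForm := close <| exS isInductive

/-- The replacement axiom for `φ`, whose first two set variables are the argument `x` and the
value `y`. -/
def replacement (φ : LForm) : LForm :=
  close <|
    (allS fun x => allS fun y₁ => allS fun y₂ =>
      app φ [] [x, y₁] ⋏ app φ [] [x, y₂] ⟹ y₁ ≐ y₂) ⟹
    allS fun a => exS fun b => allS fun y => y ∊ b ⟺ exS fun x => x ∊ a ⋏ app φ [] [x, y]

/-- The foundation axiom for `φ`, whose first set variable is `x`. -/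
def foundation (φ : LForm) : LForm :=
  close <|
    (exS fun x => app φ [] [x]) ⟹
    exS fun x => app φ [] [x] ⋏ allS fun y => y ∊ x ⟹ ∼(app φ [] [y])

def universalChoice : LForm :=
  close <| exC fun C =>
    (allC fun X => allC fun Y₁ => allC fun Y₂ => P X Y₁ ∊ C ⋏ P X Y₂ ∊ C ⟹ Y₁ ≐ Y₂) ⋏
    allC fun X => (exC fun Y => Y ∊ X) ⟹
      exC fun Y => Y ∊ X ⋏ exC fun W => isSingleton W Y ⋏ P X W ∊ C

/-- The axioms of `S*`. -/
inductive SStar : LForm → Prop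
  | comprehension (φ : LForm) : φ.Stratified → SStar (comprehension φ)
  | weakExtensionality : SStar weakExtensionality
  | pairing : SStar pairing
  | setsAreClasses : SStar setsAreClasses
  | elementsOfV : SStar elementsOfV
  | elementsOfSets : SStar elementsOfSets
  | emptySet : SStar emptySet
  | unorderedPair : SStar unorderedPair
  | union : SStar union
  | power : SStar power
  | kuratowski : SStar kuratowski
  | infinity : SStar infinity
  | replacement (φ : LForm) : SStar (replacement φ)
  | foundation (φ : LForm) : SStar (foundation φ)
  | universalChoice : SStar universalChoice

/-! ## Formulas of the language of set theory, and schemes of such formulas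

The formulas with primitive symbols `∈`, `=`, `⊥`, `→`, `∀` and variables `v₀, v₁, v₂, …`, as they
are going to be coded inside `S*`. -/

/-- A variable of the coded language: `v_k` for a numeral `k`, or the variable whose index is the
value of a term (a set variable) of the language of `S*`. -/
inductive Ix : Type
  | num (k : ℕ)
  | ref (t : LTerm)

/-- Formula schemes of the coded language: `form t` stands for the formula whose code is the value
of a term (a set variable) of the language of `S*`. -/
inductive Scheme : Type
  | mem (x y : Ix)
  | eq (x y : Ix)
  | bot
  | imp (p q : Scheme)
  | all (x : Ix) (p : Scheme)
  | form (t : LTerm)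

namespace Scheme

def neg (p : Scheme) : Scheme := imp p bot
def and (p q : Scheme) : Scheme := neg (imp p (neg q))
def or (p q : Scheme) : Scheme := imp (neg p) q
def iff (p q : Scheme) : Scheme := and (imp p q) (imp q p)
def ex (x : Ix) (p : Scheme) : Scheme := neg (all x (neg p))

end Scheme

/-! ## The axioms of `ZC` and the inaccessible cardinal

Sentences are written as functions of the number `d` of quantifiers above them; a quantifier below
`d` others binds the variable `v_d`. -/

namespace Sent

/-- Sentences under construction. -/
abbrev SBld : Type := ℕ → Scheme

def mem (x y : Ix) : SBld := fun _ => .mem x y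
def eq (x y : Ix) : SBld := fun _ => .eq x y
def neg (A : SBld) : SBld := fun d => .neg (A d)
def imp (A B : SBld) : SBld := fun d => .imp (A d) (B d)
def and (A B : SBld) : SBld := fun d => .and (A d) (B d)
def or (A B : SBld) : SBld := fun d => .or (A d) (B d)
def iff (A B : SBld) : SBld := fun d => .iff (A d) (B d)
def all (A : Ix → SBld) : SBld := fun d => .all (.num d) (A (.num d) (d + 1))
def ex (A : Ix → SBld) : SBld := fun d => .ex (.num d) (A (.num d) (d + 1))

/-- The finished sentence. -/
def close (A : SBld) : Scheme := A 0

local infix:50 " ∊ₛ " => mem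
local infix:50 " ≐ₛ " => eq
local prefix:max "∼ₛ" => neg
local infixr:35 " ⋏ₛ " => and
local infixr:30 " ⋎ₛ " => or
local infixr:25 " ⟹ₛ " => imp
local infix:20 " ⟺ₛ " => iff

def subset (x y : Ix) : SBld := all fun z => z ∊ₛ x ⟹ₛ z ∊ₛ y

def isEmpty (x : Ix) : SBld := all fun y => ∼ₛ(y ∊ₛ x)

/-- `w = {x, y}`. -/
def isPair (w x y : Ix) : SBld := all fun z => z ∊ₛ w ⟺ₛ z ≐ₛ x ⋎ₛ z ≐ₛ y

/-- `w = x ∪ {x}`. -/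
def isSucc (w x : Ix) : SBld := all fun z => z ∊ₛ w ⟺ₛ z ∊ₛ x ⋎ₛ z ≐ₛ x

/-- `⟨x, y⟩ ∈ f`, with Kuratowski pairs. -/
def pairMem (x y f : Ix) : SBld :=
  ex fun p => p ∊ₛ f ⋏ₛ all fun w => w ∊ₛ p ⟺ₛ isPair w x x ⋎ₛ isPair w x y

def isTransitive (x : Ix) : SBld := all fun y => y ∊ₛ x ⟹ₛ subset y x

/-- `x` is a von Neumann ordinal (under the axiom of foundation): a transitive set that is
linearly ordered by membership. -/
def isOrdinal (x : Ix) : SBld :=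
  isTransitive x ⋏ₛ
    all fun y => all fun z => y ∊ₛ x ⋏ₛ z ∊ₛ x ⟹ₛ y ∊ₛ z ⋎ₛ y ≐ₛ z ⋎ₛ z ∊ₛ y

/-- `x` is an ordinal different from `0` that is not a successor. -/
def isLimit (x : Ix) : SBld :=
  isOrdinal x ⋏ₛ ∼ₛ(isEmpty x) ⋏ₛ
    all fun y => y ∊ₛ x ⟹ₛ ex fun z => isSucc z y ⋏ₛ z ∊ₛ x

/-- The set `f` is single-valued as a set of pairs. -/
def isSingleValued (f : Ix) : SBld :=
  all fun x => all fun y => all fun z => pairMem x y f ⋏ₛ pairMem x z f ⟹ₛ y ≐ₛ z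

/-- For every `l ∈ k`, every function from (a subset of) `l` to `k` is bounded in `k`. -/
def isRegular (k : Ix) : SBld :=
  all fun l => l ∊ₛ k ⟹ₛ all fun f => isSingleValued f ⟹ₛ
    ex fun b => b ∊ₛ k ⋏ₛ
      all fun x => all fun y => x ∊ₛ l ⋏ₛ y ∊ₛ k ⋏ₛ pairMem x y f ⟹ₛ y ∊ₛ b

/-- For every `l ∈ k`, no function maps (a subset of) the power set of `l` onto `k`.  For an
ordinal `k` this contains that `k` is a cardinal. -/
def isStrongLimit (k : Ix) : SBld :=
  all fun l => l ∊ₛ k ⟹ₛ ∼ₛ(ex fun f => isSingleValued f ⋏ₛ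
    all fun y => y ∊ₛ k ⟹ₛ ex fun x => subset x l ⋏ₛ pairMem x y f)

/-- `k` is an inaccessible cardinal: an uncountable regular strong limit cardinal. -/
def isInaccessible (k : Ix) : SBld :=
  isOrdinal k ⋏ₛ (ex fun w => w ∊ₛ k ⋏ₛ isLimit w) ⋏ₛ isRegular k ⋏ₛ isStrongLimit k

def extensionality : Scheme :=
  close <| all fun x => all fun y => (all fun z => z ∊ₛ x ⟺ₛ z ∊ₛ y) ⟹ₛ x ≐ₛ y

def pair : Scheme := close <| all fun x => all fun y => ex fun w => isPair w x y

def union : Scheme :=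
  close <| all fun x => ex fun w => all fun z => z ∊ₛ w ⟺ₛ ex fun y => y ∊ₛ x ⋏ₛ z ∊ₛ y

def power : Scheme := close <| all fun x => ex fun w => all fun z => z ∊ₛ w ⟺ₛ subset z x

def infinity : Scheme :=
  close <| ex fun a => (ex fun z => z ∊ₛ a ⋏ₛ isEmpty z) ⋏ₛ
    all fun x => x ∊ₛ a ⟹ₛ ex fun w => isSucc w x ⋏ₛ w ∊ₛ a

def foundation : Scheme :=
  close <| all fun x => (ex fun y => y ∊ₛ x) ⟹ₛ
    ex fun y => y ∊ₛ x ⋏ₛ ∼ₛ(ex fun z => z ∊ₛ x ⋏ₛ z ∊ₛ y)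

/-- Every set of nonempty pairwise disjoint sets has a transversal. -/
def choice : Scheme :=
  close <| all fun x =>
    (all fun y => y ∊ₛ x ⟹ₛ ex fun z => z ∊ₛ y) ⋏ₛ
    (all fun y => all fun y' => y ∊ₛ x ⋏ₛ y' ∊ₛ x ⋏ₛ (ex fun z => z ∊ₛ y ⋏ₛ z ∊ₛ y') ⟹ₛ
      y ≐ₛ y') ⟹ₛ
    ex fun c => all fun y => y ∊ₛ x ⟹ₛ
      ex fun z => all fun u => u ∊ₛ y ⋏ₛ u ∊ₛ c ⟺ₛ u ≐ₛ z

/-- There is an inaccessible cardinal. -/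
def inaccessible : Scheme := close <| ex fun k => isInaccessible k

/-- `∀ v₀ ∃ v₁ ∀ v₂ (v₂ ∈ v₁ ↔ v₂ ∈ v₀ ∧ φ)` for the formula `φ` with code `p`; the variable `v₁`
must not occur in `φ`. -/
def separation (p : LTerm) : Scheme :=
  .all (.num 0) (.ex (.num 1) (.all (.num 2)
    (.iff (.mem (.num 2) (.num 1)) (.and (.mem (.num 2) (.num 0)) (.form p)))))

end Sent

/-! ## Coding of syntax in `S*`

All quantifiers range over sets.  Natural numbers are the finite von Neumann ordinals, the code of
a formula is a hereditarily finite set, and `P` is the Kuratowski pair. -/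

/-- `n` is a natural number: it belongs to every inductive set. -/
def isNat (n : LTerm) : Bld := allS fun a => isInductive a ⟹ n ∊ a

/-- `u` is the numeral `k`. -/
def isNum : ℕ → LTerm → Bld
  | 0, u => isEmpty u
  | k + 1, u => exS fun w => isNum k w ⋏ isSucc u w

/-- `u` is the triple `(k, p, q)`. -/
def isTriple (k : ℕ) (p q u : LTerm) : Bld := exS fun z => isNum k z ⋏ u ≐ P z (P p q)

/-- `u` is the index of the given variable. -/
def isIndex : Ix → LTerm → Bld
  | .num k, u => isNum k u
  | .ref t, u => u ≐ t

/-- `u` is the code of the given formula: `(0, i, j)` codes `v_i ∈ v_j`, `(1, i, j)` codes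
`v_i = v_j`, `(2, p, q)` codes an implication, `(3, i, p)` codes a quantification over `v_i`, and
`(4, 0, 0)` codes falsity. -/
def isCode : Scheme → LTerm → Bld
  | .mem x y, u => exS fun i => exS fun j => isIndex x i ⋏ isIndex y j ⋏ isTriple 0 i j u
  | .eq x y, u => exS fun i => exS fun j => isIndex x i ⋏ isIndex y j ⋏ isTriple 1 i j u
  | .imp p q, u => exS fun a => exS fun b => isCode p a ⋏ isCode q b ⋏ isTriple 2 a b u
  | .all x p, u => exS fun i => exS fun a => isIndex x i ⋏ isCode p a ⋏ isTriple 3 i a u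
  | .bot, u => exS fun z => isNum 0 z ⋏ isTriple 4 z z u
  | .form t, u => u ≐ t

/-- `f` is a function with domain `d`. -/
def isFunOn (f d : LTerm) : Bld :=
  (allS fun z => z ∊ f ⟹ exS fun i => exS fun a => i ∊ d ⋏ z ≐ P i a) ⋏
    allS fun i => i ∊ d ⟹ exS fun a => allS fun b => P i b ∊ f ⟺ b ≐ a

/-- `u` is an entry of a finite sequence each entry `a` of which is justified by `J earlier a`,
where `earlier b` says that `b` is a previous entry. -/
def inSequence (J : (LTerm → Bld) → LTerm → Bld) (u : LTerm) : Bld :=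
  exS fun n => exS fun f =>
    isNat n ⋏ isFunOn f n ⋏
    (allS fun i => allS fun a => i ∊ n ⋏ P i a ∊ f ⟹
      J (fun b => exS fun j => j ∊ i ⋏ P j b ∊ f) a) ⋏
    exS fun i => i ∊ n ⋏ P i u ∊ f

/-- `u` is the code of a formula all of whose (free or bound) variables have indices that satisfy
`ok`. -/
def isFormWith (ok : LTerm → Bld) : LTerm → Bld :=
  inSequence fun earlier a =>
    (exS fun i => exS fun j => isNat i ⋏ ok i ⋏ isNat j ⋏ ok j ⋏
      (isCode (.mem (.ref i) (.ref j)) a ⋎ isCode (.eq (.ref i) (.ref j)) a)) ⋎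
    isCode .bot a ⋎
    (exS fun b => exS fun c => earlier b ⋏ earlier c ⋏ isCode (.imp (.form b) (.form c)) a) ⋎
    exS fun i => exS fun b => isNat i ⋏ ok i ⋏ earlier b ⋏ isCode (.all (.ref i) (.form b)) a

/-- `u` is the code of a formula. -/
def isForm : LTerm → Bld := isFormWith fun i => i ≐ i

/-- `u` is the code of a formula in which the variable with index `x` does not occur. -/
def isFormWithout (x : LTerm) : LTerm → Bld := isFormWith fun i => ∼(i ≐ x)

/-- `u` codes an axiom of Tarski's substitution-free axiomatization of classical first-order logic
with equality for a language without function symbols (whose rules are modus ponens and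
generalization). -/
def isLogicalAxiom (u : LTerm) : Bld :=
  (exS fun p => exS fun q => isForm p ⋏ isForm q ⋏
    isCode (.imp (.form p) (.imp (.form q) (.form p))) u) ⋎
  (exS fun p => exS fun q => exS fun r => isForm p ⋏ isForm q ⋏ isForm r ⋏
    isCode (.imp (.imp (.form p) (.imp (.form q) (.form r)))
      (.imp (.imp (.form p) (.form q)) (.imp (.form p) (.form r)))) u) ⋎
  (exS fun p => isForm p ⋏ isCode (.imp (.neg (.neg (.form p))) (.form p)) u) ⋎
  (exS fun x => exS fun p => exS fun q => isNat x ⋏ isForm p ⋏ isForm q ⋏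
    isCode (.imp (.all (.ref x) (.imp (.form p) (.form q)))
      (.imp (.all (.ref x) (.form p)) (.all (.ref x) (.form q)))) u) ⋎
  (exS fun x => exS fun p => isNat x ⋏ isFormWithout x p ⋏
    isCode (.imp (.form p) (.all (.ref x) (.form p))) u) ⋎
  (exS fun x => exS fun y => isNat x ⋏ isNat y ⋏
    isCode (.neg (.all (.ref x) (.neg (.eq (.ref x) (.ref y))))) u) ⋎
  (exS fun x => exS fun y => exS fun z => isNat x ⋏ isNat y ⋏ isNat z ⋏
    (isCode (.imp (.eq (.ref x) (.ref y))
      (.imp (.eq (.ref x) (.ref z)) (.eq (.ref y) (.ref z)))) u ⋎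
    isCode (.imp (.eq (.ref x) (.ref y))
      (.imp (.mem (.ref x) (.ref z)) (.mem (.ref y) (.ref z)))) u ⋎
    isCode (.imp (.eq (.ref x) (.ref y))
      (.imp (.mem (.ref z) (.ref x)) (.mem (.ref z) (.ref y)))) u))

/-- `u` codes an axiom of `ZC` (Zermelo set theory with foundation and choice). -/
def isZCAxiom (u : LTerm) : Bld :=
  isCode Sent.extensionality u ⋎ isCode Sent.pair u ⋎ isCode Sent.union u ⋎
  isCode Sent.power u ⋎ isCode Sent.infinity u ⋎ isCode Sent.foundation u ⋎
  isCode Sent.choice u ⋎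
  exS fun p => isFormWith (fun i => ∼(isNum 1 i)) p ⋏ isCode (Sent.separation p) u

/-- `u` codes a theorem of the theory whose axioms are described by `T`: it is an entry of a formal
proof. -/
def isTheorem (T : LTerm → Bld) : LTerm → Bld :=
  inSequence fun earlier a =>
    isLogicalAxiom a ⋎ T a ⋎
    (exS fun b => exS fun c => earlier b ⋏ earlier c ⋏ isCode (.imp (.form b) (.form a)) c) ⋎
    exS fun x => exS fun b => isNat x ⋏ earlier b ⋏ isCode (.all (.ref x) (.form b)) a

/-- The sentence `Con(T)`: falsity is not a theorem of `T`. -/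
def con (T : LTerm → Bld) : LForm := close <| ∼(exS fun u => isCode .bot u ⋏ isTheorem T u)

/-- The sentence `Con(ZC + there is an inaccessible cardinal)`. -/
def conZCInaccessible : LForm := con fun u => isZCAxiom u ⋎ isCode Sent.inaccessible u

end FefermanS

namespace FefermanS

/-! ## Substitution -/

/-! By completeness of the calculus (`Provable.of_models`, a Henkin construction) it suffices that
the consistency statement is true in every model of the axioms. Inside such a model one builds a
structure for set theory together with a class of true judgements about it, checks that the
structure satisfies all axioms of the coded theory, and concludes by soundness of the coded
calculus.

The structure is the power class operation iterated ω times over the class of all sets: stage `0` is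
a copy of `V`, and stage `n + 1` adds to stage `n` codes for all of its subclasses. Stratification
causes two difficulties. First, `a ∈ X` raises the type, whereas a membership relation made of pairs
`(a, code of X)` must treat both components as having one type. The types of set variables are free,
so the singleton map on the copy of `V` is a class; that is, `V` is strongly Cantorian
(`isStage_base`). This permits the next membership relation to be defined
(`IsStage.exists_isExtension`), and the property passes to the next stage
(`IsStage.of_isExtension`). Second, the explicit construction uses the old stage at several types
and cannot be iterated by stratified comprehension. But "is an extension of" is a stratified
relation, so universal choice selects one extension uniformly, and the sequence of stages is a fixed
point of a monotone operator (`exists_stages`). That every natural number has a stage is an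
unstratified statement; it is proved by the foundation scheme for arbitrary formulas
(`exists_stage`).

The union of the stages is a well-founded extensional structure in which each stage has its
subclasses coded and is covered by a next one (`exists_hierarchy`); pairing, union, power set and
choice follow. The ordinals of `V` form a subclass of stage `0`, hence are the members of an element
`k`. A function of the structure induces a class relation between sets, so replacement in `V` makes
`k` regular. Subclasses of a copied set are copies of sets, so power set and replacement in `V` make
`k` a strong limit (`exists_inaccessible`).

Truth is defined by a fixed point of the Tarski clauses for truth and falsity together, which keeps
the operator monotone (`exists_truth`); that falsity is the negation of truth follows by induction
on codes (`false_iff_not_true`). With a truth class at hand, each coded instance of separation is an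
instance of comprehension (`tr_separation`), and induction along a coded proof gives
`tr_of_isTheorem`. -/

@[ext] theorem scons_ext {α : Type} {f g : ℕ → α} (h0 : f 0 = g 0) (h : ∀ i, f (i + 1) = g (i + 1)) :
    f = g := by
  funext i; cases i with
  | zero => exact h0
  | succ i => exact h i

@[simp] theorem scons_zero {α : Type} (a : α) (f : ℕ → α) : scons a f 0 = a := rfl
@[simp] theorem scons_succ {α : Type} (a : α) (f : ℕ → α) (i : ℕ) : scons a f (i + 1) = f i := rfl

theorem LTerm.subst_subst (σ τ σ' τ' : ℕ → LTerm) (t : LTerm) :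
    (t.subst σ τ).subst σ' τ' =
      t.subst (fun i => (σ i).subst σ' τ') (fun i => (τ i).subst σ' τ') := by
  induction t with
  | cvar | svar | V => rfl
  | P s t hs ht => simp [LTerm.subst, hs, ht]

theorem LTerm.subst_id (t : LTerm) : t.subst .cvar .svar = t := by
  induction t with
  | cvar | svar | V => rfl
  | P s t hs ht => simp [LTerm.subst, hs, ht]

/-- The substitution for class variables below a class quantifier. -/
abbrev upC (σ : ℕ → LTerm) : ℕ → LTerm := scons (.cvar 0) fun i => (σ i).liftC

/-- The substitution for set variables below a set quantifier. -/
abbrev upS (τ : ℕ → LTerm) : ℕ → LTerm := scons (.svar 0) fun i => (τ i).liftS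

theorem LForm.subst_subst (φ : LForm) : ∀ σ τ σ' τ' : ℕ → LTerm,
    (φ.subst σ τ).subst σ' τ' =
      φ.subst (fun i => (σ i).subst σ' τ') (fun i => (τ i).subst σ' τ') := by
  induction φ with
  | mem s t | eq s t => intros; simp [LForm.subst, LTerm.subst_subst]
  | bot => intros; rfl
  | imp φ ψ h1 h2 => intros; simp [LForm.subst, h1, h2]
  | allC φ h =>
    intros; simp only [LForm.subst, h]
    congr 2
    · ext i <;> simp [LTerm.liftC, LTerm.subst_subst, LTerm.subst]
    · funext i; simp [LTerm.liftC, LTerm.subst_subst, LTerm.subst]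
  | allS φ h =>
    intros; simp only [LForm.subst, h]
    congr 2
    · funext i; simp [LTerm.liftS, LTerm.subst_subst, LTerm.subst]
    · ext i <;> simp [LTerm.liftS, LTerm.subst_subst, LTerm.subst]

theorem upC_cvar : upC LTerm.cvar = LTerm.cvar := by
  ext i <;> simp [LTerm.liftC, LTerm.subst]

theorem upS_svar : upS LTerm.svar = LTerm.svar := by
  ext i <;> simp [LTerm.liftS, LTerm.subst]

theorem LForm.subst_id (φ : LForm) : φ.subst .cvar .svar = φ := by
  induction φ with
  | mem s t | eq s t => simp [LForm.subst, LTerm.subst_id]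
  | bot => rfl
  | imp φ ψ h1 h2 => simp [LForm.subst, h1, h2]
  | allC φ h => rw [LForm.subst]; conv_rhs => rw [← h]
                congr 2; exact upC_cvar
  | allS φ h => rw [LForm.subst]; conv_rhs => rw [← h]
                congr 2; exact upS_svar

/-- Instantiating after a substitution that was lifted under the quantifier amounts to prepending
one value to it. The quantifier steps of `Provable.subst_list` and of the truth lemma rest on this.
-/
theorem LForm.instC_subst_up (φ : LForm) (σ : ℕ → LTerm) (τ : ℕ → LTerm) (t : LTerm) :
    (φ.subst (upC σ) fun i => (τ i).liftC).instC t = φ.subst (scons t σ) τ := by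
  rw [LForm.instC, LForm.subst_subst]
  congr 1
  · ext i
    · simp [LTerm.subst]
    · simp [LTerm.liftC, LTerm.subst_subst, LTerm.subst, LTerm.subst_id]
  · funext i; simp [LTerm.liftC, LTerm.subst_subst, LTerm.subst, LTerm.subst_id]

theorem LForm.instS_subst_up (φ : LForm) (σ : ℕ → LTerm) (τ : ℕ → LTerm) (k : ℕ) :
    (φ.subst (fun i => (σ i).liftS) (upS τ)).instS k = φ.subst σ (scons (.svar k) τ) := by
  rw [LForm.instS, LForm.subst_subst]
  congr 1
  · funext i; simp [LTerm.liftS, LTerm.subst_subst, LTerm.subst, LTerm.subst_id]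
  · ext i
    · simp [LTerm.subst]
    · simp [LTerm.liftS, LTerm.subst_subst, LTerm.subst, LTerm.subst_id]

/-- A number above the indices of all variables of a term. -/
def LTerm.bd : LTerm → ℕ
  | .cvar i => i + 1
  | .svar i => i + 1
  | .V => 0
  | .P s t => max s.bd t.bd

/-- A number above the indices of all variables of a formula. -/
def LForm.bd : LForm → ℕ
  | .mem s t => max s.bd t.bd
  | .eq s t => max s.bd t.bd
  | .bot => 0
  | .imp φ ψ => max φ.bd ψ.bd
  | .allC φ => φ.bd
  | .allS φ => φ.bd

theorem LTerm.subst_congr {σ τ σ' τ' : ℕ → LTerm} (t : LTerm) (h : ∀ i < t.bd, σ i = σ' i)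
    (h' : ∀ i < t.bd, τ i = τ' i) : t.subst σ τ = t.subst σ' τ' := by
  induction t with
  | cvar i => exact h i (Nat.lt_succ_self i)
  | svar i => exact h' i (Nat.lt_succ_self i)
  | V => rfl
  | P s t hs ht =>
    simp only [LTerm.bd, lt_max_iff] at h h'
    simp only [LTerm.subst]
    rw [hs (fun i hi => h i (.inl hi)) (fun i hi => h' i (.inl hi)),
      ht (fun i hi => h i (.inr hi)) (fun i hi => h' i (.inr hi))]

theorem LForm.subst_congr (φ : LForm) : ∀ {σ τ σ' τ' : ℕ → LTerm}, (∀ i < φ.bd, σ i = σ' i) →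
    (∀ i < φ.bd, τ i = τ' i) → φ.subst σ τ = φ.subst σ' τ' := by
  induction φ with
  | mem s t | eq s t =>
    intro σ τ σ' τ' h h'
    simp only [LForm.bd, lt_max_iff] at h h'
    simp only [LForm.subst]
    rw [s.subst_congr (fun i hi => h i (.inl hi)) (fun i hi => h' i (.inl hi)),
      t.subst_congr (fun i hi => h i (.inr hi)) (fun i hi => h' i (.inr hi))]
  | bot => intros; rfl
  | imp φ ψ h1 h2 =>
    intro σ τ σ' τ' h h'
    simp only [LForm.bd, lt_max_iff] at h h'
    simp only [LForm.subst]
    rw [h1 (fun i hi => h i (.inl hi)) (fun i hi => h' i (.inl hi)),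
      h2 (fun i hi => h i (.inr hi)) (fun i hi => h' i (.inr hi))]
  | allC φ hφ =>
    intro σ τ σ' τ' h h'
    simp only [LForm.subst]
    rw [hφ]
    · rintro (_ | i) hi
      · rfl
      · simp [h i (Nat.lt_of_succ_lt hi)]
    · intro i hi; simp [h' i hi]
  | allS φ hφ =>
    intro σ τ σ' τ' h h'
    simp only [LForm.subst]
    rw [hφ]
    · intro i hi; simp [h i hi]
    · rintro (_ | i) hi
      · rfl
      · simp [h' i (Nat.lt_of_succ_lt hi)]

/-! ## Derived rules -/

section Derivations

variable {T : LForm → Prop}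

/-- Each step generalizes variable `0`, substitutes the rest of the list below the quantifier and
then instantiates. -/
theorem Provable.subst_list (ts : List LTerm) : ∀ {φ : LForm}, Provable T φ →
    Provable T (φ.subst (ts.foldr scons .cvar) .svar) := by
  induction ts with
  | nil => intro φ h; simpa [LForm.subst_id] using h
  | cons t ts ih =>
    intro φ h
    have := (Provable.allC_inst _ t).mp (ih h.genC)
    exact (LForm.instC_subst_up φ (ts.foldr scons .cvar) .svar t) ▸ this

theorem Provable.subst_list_set (ks : List ℕ) : ∀ {φ : LForm}, Provable T φ →
    Provable T (φ.subst .cvar ((ks.map LTerm.svar).foldr scons .svar)) := by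
  induction ks with
  | nil => intro φ h; simpa [LForm.subst_id] using h
  | cons k ks ih =>
    intro φ h
    have := (Provable.allS_inst _ k).mp (ih h.genS)
    exact LForm.instS_subst_up φ .cvar ((ks.map LTerm.svar).foldr scons .svar) k ▸ this

theorem foldr_scons_eq {α : Type} (f g : ℕ → α) (n : ℕ) :
    ∀ i < n, ((List.range n).map f).foldr scons g i = f i := by
  suffices h : ∀ (m k : ℕ), ∀ i < m, ((List.range' k m).map f).foldr scons g i = f (k + i) by
    intro i hi; rw [List.range_eq_range', h n 0 i hi, Nat.zero_add]
  intro m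
  induction m with
  | zero => intro k i hi; omega
  | succ m ih =>
    rintro k (_ | i) hi
    · simp [List.range'_succ]
    · simp only [List.range'_succ, List.map_cons, List.foldr_cons, scons_succ]
      rw [ih (k + 1) i (by omega)]; congr 1; omega

/-- Only finitely many variables matter, so lists suffice. Set variables are renamed first; in the
other order the set variables inside the terms `σ i` would be renamed as well. -/
theorem Provable.subst {φ : LForm} (h : Provable T φ) (σ : ℕ → LTerm) (k : ℕ → ℕ) :
    Provable T (φ.subst σ fun i => .svar (k i)) := by
  have h1 : Provable T (φ.subst .cvar fun i => .svar (k i)) := by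
    have := Provable.subst_list_set ((List.range φ.bd).map k) h
    rwa [List.map_map, LForm.subst_congr φ (fun i _ => rfl) (foldr_scons_eq _ _ _)] at this
  set χ := φ.subst .cvar fun i => .svar (k i) with hχ
  have h2 := Provable.subst_list ((List.range χ.bd).map σ) h1
  rw [LForm.subst_congr χ (foldr_scons_eq _ _ _) (fun i _ => rfl), hχ, LForm.subst_subst] at h2
  simpa [LTerm.subst] using h2

/-- Derivability from provable formulas and hypotheses by modus ponens alone. -/
inductive Prf (T : LForm → Prop) (Γ : Set LForm) : LForm → Prop
  | hyp {φ} : φ ∈ Γ → Prf T Γ φ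
  | thm {φ} : Provable T φ → Prf T Γ φ
  | mp {φ ψ} : Prf T Γ (.imp φ ψ) → Prf T Γ φ → Prf T Γ ψ

namespace Prf

variable {Γ Δ : Set LForm} {φ ψ χ : LForm}

theorem mono (h : Prf T Γ φ) (hΓ : Γ ⊆ Δ) : Prf T Δ φ := by
  induction h with
  | hyp h => exact .hyp (hΓ h)
  | thm h => exact .thm h
  | mp _ _ h1 h2 => exact .mp h1 h2

theorem const (h : Prf T Γ φ) : Prf T Γ (.imp ψ φ) := .mp (.thm (.imp_k _ _)) h

theorem imp_self (φ : LForm) : Prf T Γ (.imp φ φ) :=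
  .mp (.mp (.thm (.imp_s φ (.imp φ φ) φ)) (.thm (.imp_k _ _))) (.thm (.imp_k _ _))

/-- Generalization is confined to `Provable`, so modus ponens is the only rule to treat. -/
theorem deduction (h : Prf T (insert ψ Γ) φ) : Prf T Γ (.imp ψ φ) := by
  induction h with
  | hyp h =>
    rcases h with rfl | h
    · exact imp_self _
    · exact (Prf.hyp h).const
  | thm h => exact (Prf.thm h).const
  | mp _ _ h1 h2 => exact .mp (.mp (.thm (.imp_s _ _ _)) h1) h2

theorem provable (h : Prf T ∅ φ) : Provable T φ := by
  induction h with
  | hyp h => exact h.elim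
  | thm h => exact h
  | mp _ _ h1 h2 => exact h1.mp h2

theorem by_contra (h : Prf T (insert (.imp φ .bot) Γ) .bot) : Prf T Γ φ :=
  .mp (.thm (.dne φ)) h.deduction

theorem exfalso (h : Prf T Γ .bot) : Prf T Γ φ := by_contra (h.mono (Set.subset_insert _ _))

theorem subst (h : Prf T Γ φ) (σ : ℕ → LTerm) (k : ℕ → ℕ) :
    Prf T ((fun ψ => ψ.subst σ fun i => .svar (k i)) '' Γ) (φ.subst σ fun i => .svar (k i)) := by
  induction h with
  | hyp h => exact .hyp ⟨_, h, rfl⟩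
  | thm h => exact .thm (h.subst σ k)
  | mp _ _ h1 h2 => exact .mp h1 h2

theorem genC (h : Prf T (LForm.liftC '' Γ) φ) : Prf T Γ (.allC φ) := by
  induction h with
  | hyp h => obtain ⟨ψ, hψ, rfl⟩ := h; exact .mp (.thm (.allC_vac _)) (.hyp hψ)
  | thm h => exact .thm h.genC
  | mp _ _ h1 h2 => exact .mp (.mp (.thm (.allC_imp _ _)) h1) h2

theorem genS (h : Prf T (LForm.liftS '' Γ) φ) : Prf T Γ (.allS φ) := by
  induction h with
  | hyp h => obtain ⟨ψ, hψ, rfl⟩ := h; exact .mp (.thm (.allS_vac _)) (.hyp hψ)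
  | thm h => exact .thm h.genS
  | mp _ _ h1 h2 => exact .mp (.mp (.thm (.allS_imp _ _)) h1) h2

/-- Renaming the fresh variable `b` to `0` and shifting all other variables up turns the hypotheses
into their lifts and the instance back into `φ`, so that `genC` applies. -/
theorem allC_of_fresh {b : ℕ} (hΓ : ∀ ψ ∈ Γ, ψ.bd ≤ b) (hφ : φ.bd ≤ b)
    (h : Prf T Γ (φ.instC (.cvar b))) : Prf T Γ (.allC φ) := by
  apply genC
  have := h.subst (fun i => if i = b then .cvar 0 else .cvar (i + 1)) id
  simp only [id_eq] at this
  rw [show (φ.instC (.cvar b)).subst (fun i => if i = b then .cvar 0 else .cvar (i + 1))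
    (fun i => .svar i) = φ by
      rw [LForm.instC, LForm.subst_subst]
      conv_rhs => rw [← φ.subst_id]
      apply LForm.subst_congr
      · rintro (_ | i) hi
        · simp [LTerm.subst]
        · have : i ≠ b := by omega
          simp [LTerm.subst, this]
      · intro i _; rfl] at this
  refine this.mono ?_
  rintro _ ⟨ψ, hψ, rfl⟩
  refine ⟨ψ, hψ, LForm.subst_congr _ (fun i hi => ?_) fun i _ => rfl⟩
  have : i ≠ b := by have := hΓ ψ hψ; omega
  simp [this]

theorem allS_of_fresh {b : ℕ} (hΓ : ∀ ψ ∈ Γ, ψ.bd ≤ b) (hφ : φ.bd ≤ b)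
    (h : Prf T Γ (φ.instS b)) : Prf T Γ (.allS φ) := by
  apply genS
  have := h.subst .cvar (fun i => if i = b then 0 else i + 1)
  rw [show (φ.instS b).subst .cvar (fun i => .svar (if i = b then 0 else i + 1)) = φ by
      rw [LForm.instS, LForm.subst_subst]
      conv_rhs => rw [← φ.subst_id]
      apply LForm.subst_congr
      · intro i _; rfl
      · rintro (_ | i) hi
        · simp [LTerm.subst]
        · have : i ≠ b := by omega
          simp [LTerm.subst, this]] at this
  refine this.mono ?_
  rintro _ ⟨ψ, hψ, rfl⟩
  refine ⟨ψ, hψ, LForm.subst_congr _ (fun i _ => rfl) fun i hi => ?_⟩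
  have : i ≠ b := by have := hΓ ψ hψ; omega
  simp [this]

end Prf

end Derivations

/-! ## Enumeration of formulas -/

/-- A numbering of terms. -/
def LTerm.enc : LTerm → ℕ
  | .cvar i => Nat.pair 0 i
  | .svar i => Nat.pair 1 i
  | .V => Nat.pair 2 0
  | .P s t => Nat.pair 3 (Nat.pair s.enc t.enc)

theorem LTerm.enc_injective : ∀ s t : LTerm, s.enc = t.enc → s = t := by
  intro s
  induction s with
  | cvar | svar | V => intro t h; cases t <;> simp_all [LTerm.enc, Nat.pair_eq_pair]
  | P a b ha hb =>
    intro t h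
    cases t <;> simp [LTerm.enc, Nat.pair_eq_pair] at h ⊢
    exact ⟨ha _ h.1, hb _ h.2⟩

/-- A numbering of formulas. -/
def LForm.enc : LForm → ℕ
  | .mem s t => Nat.pair 0 (Nat.pair s.enc t.enc)
  | .eq s t => Nat.pair 1 (Nat.pair s.enc t.enc)
  | .bot => Nat.pair 2 0
  | .imp φ ψ => Nat.pair 3 (Nat.pair φ.enc ψ.enc)
  | .allC φ => Nat.pair 4 φ.enc
  | .allS φ => Nat.pair 5 φ.enc

theorem LForm.enc_injective : ∀ φ ψ : LForm, φ.enc = ψ.enc → φ = ψ := by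
  intro φ
  induction φ with
  | mem | eq | bot =>
    intro ψ h
    cases ψ <;> simp_all [LForm.enc, Nat.pair_eq_pair]
    try exact ⟨LTerm.enc_injective _ _ h.1, LTerm.enc_injective _ _ h.2⟩
  | imp a b ha hb =>
    intro ψ h
    cases ψ <;> simp [LForm.enc, Nat.pair_eq_pair] at h ⊢
    exact ⟨ha _ h.1, hb _ h.2⟩
  | allC a ha | allS a ha =>
    intro ψ h
    cases ψ <;> simp [LForm.enc, Nat.pair_eq_pair] at h ⊢
    exact ha _ h

theorem exists_enumeration : ∃ e : ℕ → LForm, Function.Surjective e := by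
  have : Countable LForm := ⟨LForm.enc, fun φ ψ h => LForm.enc_injective φ ψ h⟩
  have : Nonempty LForm := ⟨.bot⟩
  exact exists_surjective_nat LForm

/-! ## Henkin theories -/

section Henkin

variable (T : LForm → Prop)

/-- Consistent sets of formulas with boundedly many variables. -/
def Extendible (Γ : Set LForm) : Prop := ¬ Prf T Γ .bot ∧ ∃ b, ∀ ψ ∈ Γ, ψ.bd ≤ b

/-- `Γ` decides `φ`, and has a counterexample if it refutes a quantified formula `φ`. -/
def Decides (Γ : Set LForm) (φ : LForm) : Prop :=
  φ ∈ Γ ∨ (.imp φ .bot ∈ Γ ∧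
    (∀ χ, φ = .allC χ → ∃ t, .imp (χ.instC t) .bot ∈ Γ) ∧
    (∀ χ, φ = .allS χ → ∃ k, .imp (χ.instS k) .bot ∈ Γ))

variable {T}

theorem Extendible.insert {Γ : Set LForm} (h : Extendible T Γ) {φ : LForm}
    (hφ : ¬ Prf T (insert φ Γ) .bot) : Extendible T (insert φ Γ) := by
  obtain ⟨b, hb⟩ := h.2
  refine ⟨hφ, max b φ.bd, ?_⟩
  rintro ψ (rfl | hψ)
  · exact le_max_right _ _
  · exact (hb ψ hψ).trans (le_max_left _ _)

/-- The Lindenbaum step: if `φ` cannot be added consistently then its negation can, and a refuted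
quantification receives a fresh variable as counterexample. -/
theorem Extendible.exists_decides {Γ : Set LForm} (h : Extendible T Γ) (φ : LForm) :
    ∃ Δ, Γ ⊆ Δ ∧ Extendible T Δ ∧ Decides Δ φ := by
  by_cases hφ : Prf T (Insert.insert φ Γ) .bot
  swap
  · exact ⟨_, Set.subset_insert _ _, h.insert hφ, .inl (Set.mem_insert _ _)⟩
  have h1 : ¬ Prf T (Insert.insert (.imp φ .bot) Γ) .bot := fun h2 =>
    h.1 (.mp hφ.deduction (Prf.by_contra h2))
  have h2 := h.insert h1
  obtain ⟨b, hb⟩ := h2.2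
  have hbφ : φ.bd ≤ b := by
    have := hb _ (Set.mem_insert _ _)
    simp only [LForm.bd, max_le_iff] at this
    exact this.1
  cases φ with
  | allC χ =>
    -- The bound `b` covers `Γ` and `χ`, so class variable `b` is fresh.
    refine ⟨Insert.insert (.imp (χ.instC (.cvar b)) .bot) (Insert.insert (.imp (.allC χ) .bot) Γ),
      (Set.subset_insert _ _).trans (Set.subset_insert _ _), h2.insert fun h3 => h1 ?_,
      .inr ⟨.inr (.inl rfl), ?_, ?_⟩⟩
    · exact .mp (.hyp (Set.mem_insert _ _))
        (Prf.allC_of_fresh hb hbφ (Prf.by_contra h3))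
    · rintro _ ⟨⟩; exact ⟨_, .inl rfl⟩
    · rintro _ ⟨⟩
  | allS χ =>
    refine ⟨Insert.insert (.imp (χ.instS b) .bot) (Insert.insert (.imp (.allS χ) .bot) Γ),
      (Set.subset_insert _ _).trans (Set.subset_insert _ _), h2.insert fun h3 => h1 ?_,
      .inr ⟨.inr (.inl rfl), ?_, ?_⟩⟩
    · exact .mp (.hyp (Set.mem_insert _ _))
        (Prf.allS_of_fresh hb hbφ (Prf.by_contra h3))
    · rintro _ ⟨⟩
    · rintro _ ⟨⟩; exact ⟨_, .inl rfl⟩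
  | mem | eq | bot | imp =>
    exact ⟨_, Set.subset_insert _ _, h2, .inr ⟨Set.mem_insert _ _, by rintro _ ⟨⟩, by rintro _ ⟨⟩⟩⟩

theorem Decides.mono {Γ Δ : Set LForm} {φ : LForm} (h : Decides Γ φ) (hΓ : Γ ⊆ Δ) :
    Decides Δ φ := by
  rcases h with h | ⟨h, h1, h2⟩
  · exact .inl (hΓ h)
  · exact .inr ⟨hΓ h, fun χ hχ => (h1 χ hχ).imp fun _ h => hΓ h,
      fun χ hχ => (h2 χ hχ).imp fun _ h => hΓ h⟩

theorem Extendible.exists_henkin {Γ : Set LForm} (h : Extendible T Γ) :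
    ∃ Δ, Γ ⊆ Δ ∧ ¬ Prf T Δ .bot ∧ ∀ φ, Decides Δ φ := by
  obtain ⟨e, he⟩ := exists_enumeration
  choose! next hsub hext hdec using fun (Γ : Set LForm) (h : Extendible T Γ) (φ : LForm) =>
    h.exists_decides φ
  let G : ℕ → Set LForm := fun n => Nat.rec Γ (fun n Δ => next Δ (e n)) n
  have hG : ∀ n, Extendible T (G n) := fun n => by
    induction n with
    | zero => exact h
    | succ n ih => exact hext _ ih _
  have hmono : Monotone G := monotone_nat_of_le_succ fun n => hsub _ (hG n) _
  -- Derivations use finitely many hypotheses, so the union of the chain stays consistent.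
  have hfin : ∀ φ, Prf T (⋃ n, G n) φ → ∃ n, Prf T (G n) φ := by
    intro φ hφ
    induction hφ with
    | hyp h => obtain ⟨n, hn⟩ := Set.mem_iUnion.1 h; exact ⟨n, .hyp hn⟩
    | thm h => exact ⟨0, .thm h⟩
    | mp _ _ h1 h2 =>
      obtain ⟨m, hm⟩ := h1
      obtain ⟨n, hn⟩ := h2
      exact ⟨max m n, .mp (hm.mono (hmono (le_max_left _ _))) (hn.mono (hmono (le_max_right _ _)))⟩
  refine ⟨⋃ n, G n, Set.subset_iUnion G 0, fun hbot => ?_, fun φ => ?_⟩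
  · obtain ⟨n, hn⟩ := hfin _ hbot
    exact (hG n).1 hn
  · obtain ⟨n, rfl⟩ := he φ
    exact (hdec _ (hG n) (e n)).mono (Set.subset_iUnion G (n + 1))

end Henkin

/-! ## Structures and completeness -/

/-- Structures for the language of `S*`: `M` is the domain of classes and `S` the domain of sets. -/
class Str (M : Type) (S : outParam Type) where
  mem : M → M → Prop
  V : M
  P : M → M → M
  emb : S → M

/-- The value of a term. -/
def LTerm.val {M S : Type} [Str M S] (ρ : ℕ → M) (υ : ℕ → S) : LTerm → M
  | .cvar i => ρ i
  | .svar i => Str.emb (υ i)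
  | .V => Str.V
  | .P s t => Str.P (s.val ρ υ) (t.val ρ υ)

/-- Truth of a formula. -/
def LForm.Sat {M S : Type} [Str M S] : (ℕ → M) → (ℕ → S) → LForm → Prop
  | ρ, υ, .mem s t => Str.mem (s.val ρ υ) (t.val ρ υ)
  | ρ, υ, .eq s t => s.val ρ υ = t.val ρ υ
  | _, _, .bot => False
  | ρ, υ, .imp φ ψ => φ.Sat ρ υ → ψ.Sat ρ υ
  | ρ, υ, .allC φ => ∀ X : M, φ.Sat (scons X ρ) υ
  | ρ, υ, .allS φ => ∀ x : S, φ.Sat ρ (scons x υ)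

/-! ### The term model of a Henkin theory -/

section TermModel

variable {T : LForm → Prop} {Δ : Set LForm}

theorem mem_of_prf (hc : ¬ Prf T Δ .bot) (hd : ∀ φ, Decides Δ φ) {φ : LForm} (h : Prf T Δ φ) :
    φ ∈ Δ := by
  rcases hd φ with h1 | ⟨h1, -⟩
  · exact h1
  · exact (hc (.mp (.hyp h1) h)).elim

theorem LTerm.liftC_inst (u t : LTerm) : u.liftC.subst (scons t .cvar) .svar = u := by
  simp [LTerm.liftC, LTerm.subst_subst, LTerm.subst, LTerm.subst_id]

theorem Prf.eq_symm {s t : LTerm} (h : Prf T Δ (.eq s t)) : Prf T Δ (.eq t s) := by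
  have := Provable.eq_subst (T := T) (.eq (.cvar 0) s.liftC) s t
  simp only [LForm.instC, LForm.subst, LTerm.liftC_inst, LTerm.subst, scons_zero] at this
  exact .mp (.mp (.thm this) h) (.thm (.eq_refl s))

theorem Prf.eq_trans {s t u : LTerm} (h : Prf T Δ (.eq s t)) (h' : Prf T Δ (.eq t u)) :
    Prf T Δ (.eq s u) := by
  have := Provable.eq_subst (T := T) (.eq s.liftC (.cvar 0)) t u
  simp only [LForm.instC, LForm.subst, LTerm.liftC_inst, LTerm.subst, scons_zero] at this
  exact .mp (.mp (.thm this) h') h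

theorem Prf.mem_congr {s t s' t' : LTerm} (h : Prf T Δ (.eq s s')) (h' : Prf T Δ (.eq t t'))
    (hm : Prf T Δ (.mem s t)) : Prf T Δ (.mem s' t') := by
  have h1 := Provable.eq_subst (T := T) (.mem (.cvar 0) t.liftC) s s'
  have h2 := Provable.eq_subst (T := T) (.mem s'.liftC (.cvar 0)) t t'
  simp only [LForm.instC, LForm.subst, LTerm.liftC_inst, LTerm.subst, scons_zero] at h1 h2
  exact .mp (.mp (.thm h2) h') (.mp (.mp (.thm h1) h) hm)

theorem Prf.P_congr {s t s' t' : LTerm} (h : Prf T Δ (.eq s s')) (h' : Prf T Δ (.eq t t')) :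
    Prf T Δ (.eq (.P s t) (.P s' t')) := by
  have h1 := Provable.eq_subst (T := T) (.eq (.P s.liftC t.liftC) (.P (.cvar 0) t.liftC)) s s'
  have h2 := Provable.eq_subst (T := T) (.eq (.P s'.liftC t.liftC) (.P s'.liftC (.cvar 0))) t t'
  simp only [LForm.instC, LForm.subst, LTerm.liftC_inst, LTerm.subst, scons_zero] at h1 h2
  exact .eq_trans (.mp (.mp (.thm h1) h) (.thm (.eq_refl _)))
    (.mp (.mp (.thm h2) h') (.thm (.eq_refl _)))

variable (T Δ) in
/-- Equality of terms according to a theory. -/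
def termSetoid : Setoid LTerm where
  r s t := Prf T Δ (.eq s t)
  iseqv := ⟨fun _ => .thm (.eq_refl _), Prf.eq_symm, Prf.eq_trans⟩

variable (T Δ) in
/-- The domain of classes of the term model. -/
abbrev TermModel : Type := Quotient (termSetoid T Δ)

variable (T Δ) in
/-- The domain of sets of the term model. -/
abbrev TermModel.Sets : Type :=
  {m : TermModel T Δ // ∃ k, m = Quotient.mk (termSetoid T Δ) (.svar k)}

instance : Str (TermModel T Δ) (TermModel.Sets T Δ) where
  mem := Quotient.lift₂ (fun s t => Prf T Δ (.mem s t)) fun _ _ _ _ h h' =>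
    propext ⟨fun hm => .mem_congr h h' hm, fun hm => .mem_congr h.eq_symm h'.eq_symm hm⟩
  V := Quotient.mk _ .V
  P := Quotient.map₂ .P fun _ _ h _ _ h' => Prf.P_congr h h'
  emb := Subtype.val

theorem TermModel.val_eq (σ : ℕ → LTerm) (k : ℕ → ℕ) (t : LTerm) :
    t.val (M := TermModel T Δ) (fun i => Quotient.mk _ (σ i)) (fun i => ⟨_, k i, rfl⟩) =
      Quotient.mk _ (t.subst σ fun i => .svar (k i)) := by
  induction t with
  | cvar | svar | V => rfl
  | P s t hs ht => rw [LTerm.val, hs, ht]; rfl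

/-- The truth lemma. Under a quantifier, every element of the model is the class of a term (of a set
variable, for sets), and `Decides` supplies a counterexample to any universal formula outside `Δ`.
-/
theorem TermModel.sat_iff (hc : ¬ Prf T Δ .bot) (hd : ∀ φ, Decides Δ φ) (φ : LForm) :
    ∀ (σ : ℕ → LTerm) (k : ℕ → ℕ),
      φ.Sat (M := TermModel T Δ) (fun i => Quotient.mk _ (σ i)) (fun i => ⟨_, k i, rfl⟩) ↔
        φ.subst σ (fun i => .svar (k i)) ∈ Δ := by
  have hm : ∀ φ, Prf T Δ φ ↔ φ ∈ Δ := fun φ => ⟨mem_of_prf hc hd, .hyp⟩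
  induction φ with
  | mem s t => intro σ k; rw [LForm.Sat, val_eq, val_eq]; exact hm _
  | eq s t => intro σ k; rw [LForm.Sat, val_eq, val_eq, Quotient.eq]; exact hm _
  | bot => intro σ k; rw [← hm]; simpa [LForm.Sat, LForm.subst] using hc
  | imp φ ψ h1 h2 =>
    intro σ k
    rw [LForm.Sat, h1, h2, LForm.subst, ← hm, ← hm, ← hm]
    refine ⟨fun h => ?_, fun h => h.mp⟩
    rcases hd (φ.subst σ fun i => .svar (k i)) with h3 | ⟨h3, -⟩
    · exact (h (.hyp h3)).const
    · exact Prf.deduction (.exfalso (.mp (.hyp (.inr h3)) (.hyp (.inl rfl))))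
  | allC φ h =>
    intro σ k
    have key : ∀ t, φ.Sat (M := TermModel T Δ) (scons (Quotient.mk _ t) fun i => Quotient.mk _ (σ i))
        (fun i => ⟨_, k i, rfl⟩) ↔
        (φ.subst (upC σ) fun i => (LTerm.svar (k i)).liftC).instC t ∈ Δ := by
      intro t
      rw [LForm.instC_subst_up, ← h]
      rw [show (fun i => Quotient.mk (termSetoid T Δ) (scons t σ i)) =
        scons (Quotient.mk _ t) fun i => Quotient.mk _ (σ i) by ext i <;> rfl]
    rw [LForm.Sat, LForm.subst]
    constructor
    · intro hX
      rcases hd (.allC (φ.subst (upC σ) fun i => (LTerm.svar (k i)).liftC)) with h3 | ⟨-, h3, -⟩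
      · exact h3
      · obtain ⟨t, ht⟩ := h3 _ rfl
        exact (hc (.mp (.hyp ht) (.hyp ((key t).1 (hX _))))).elim
    · intro hX X
      obtain ⟨t, rfl⟩ := Quotient.exists_rep X
      exact (key t).2 ((hm _).1 (.mp (.thm (.allC_inst _ t)) (.hyp hX)))
  | allS φ h =>
    intro σ k
    have key : ∀ n, φ.Sat (M := TermModel T Δ) (fun i => Quotient.mk _ (σ i))
        (scons ⟨_, n, rfl⟩ fun i => ⟨_, k i, rfl⟩) ↔
        (φ.subst (fun i => (σ i).liftS) (upS fun i => .svar (k i))).instS n ∈ Δ := by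
      intro n
      rw [LForm.instS_subst_up]
      rw [show scons (LTerm.svar n) (fun i => LTerm.svar (k i)) = fun i => LTerm.svar (scons n k i) by
        ext i <;> rfl, ← h]
      rw [show (fun i => (⟨_, scons n k i, rfl⟩ : TermModel.Sets T Δ)) =
        scons ⟨_, n, rfl⟩ fun i => ⟨_, k i, rfl⟩ by ext i <;> rfl]
    rw [LForm.Sat, LForm.subst]
    constructor
    · intro hX
      rcases hd (.allS (φ.subst (fun i => (σ i).liftS) (upS fun i => .svar (k i)))) with
        h3 | ⟨-, -, h3⟩
      · exact h3
      · obtain ⟨t, ht⟩ := h3 _ rfl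
        exact (hc (.mp (.hyp ht) (.hyp ((key t).1 (hX _))))).elim
    · rintro hX ⟨X, n, rfl⟩
      exact (key n).2 ((hm _).1 (.mp (.thm (.allS_inst _ n)) (.hyp hX)))

end TermModel

/-- Completeness of the calculus. -/
theorem Provable.of_models {T : LForm → Prop} {ψ : LForm}
    (h : ∀ (M S : Type) [Str M S], (Str.emb : S → M).Injective →
      (∀ φ, T φ → ∀ (ρ : ℕ → M) (υ : ℕ → S), φ.Sat ρ υ) → ∀ (ρ : ℕ → M) (υ : ℕ → S), ψ.Sat ρ υ) :
    Provable T ψ := by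
  by_contra hψ
  have h0 : Extendible T {.imp ψ .bot} := by
    refine ⟨fun h => hψ (Prf.provable (Prf.by_contra ?_)), _, fun φ hφ => (congrArg LForm.bd hφ).le⟩
    simpa using h
  obtain ⟨Δ, hΔ, hc, hd⟩ := h0.exists_henkin
  have h1 := h (TermModel T Δ) (TermModel.Sets T Δ) Subtype.val_injective ?_
    (fun i => Quotient.mk _ (.cvar i)) (fun i => ⟨_, i, rfl⟩)
  · replace h1 := (TermModel.sat_iff hc hd ψ .cvar fun i => i).1 h1
    rw [LForm.subst_id] at h1
    exact hc (.mp (.hyp (hΔ rfl)) (.hyp h1))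
  · intro φ hφ ρ υ
    choose σ hσ using fun i => Quotient.exists_rep (ρ i)
    choose k hk using fun i => (υ i).2
    have hρ : ρ = fun i => Quotient.mk _ (σ i) := funext fun i => (hσ i).symm
    have hυ : υ = fun i => ⟨_, k i, rfl⟩ := funext fun i => Subtype.ext (hk i)
    rw [hρ, hυ, TermModel.sat_iff hc hd]
    -- A valuation in the term model is a substitution, and theorems are closed under substitution.
    exact mem_of_prf hc hd (.thm ((Provable.ax hφ).subst σ k))

/-! ## Semantics of formulas under construction -/

section BldSat

variable {M S : Type} [Str M S] {ρ : ℕ → M} {υ : ℕ → S} {c s : ℕ}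

@[simp] theorem Bld.sat_mem (t u : LTerm) : (Bld.mem t u c s).Sat ρ υ ↔
    Str.mem ((t.toIndex c s).val ρ υ) ((u.toIndex c s).val ρ υ) := Iff.rfl
@[simp] theorem Bld.sat_eq (t u : LTerm) : (Bld.eq t u c s).Sat ρ υ ↔
    (t.toIndex c s).val ρ υ = (u.toIndex c s).val ρ υ := Iff.rfl
@[simp] theorem Bld.sat_imp (A B : Bld) : (Bld.imp A B c s).Sat ρ υ ↔
    ((A c s).Sat ρ υ → (B c s).Sat ρ υ) := Iff.rfl
@[simp] theorem Bld.sat_neg (A : Bld) : (Bld.neg A c s).Sat ρ υ ↔ ¬ (A c s).Sat ρ υ := Iff.rfl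
@[simp] theorem Bld.sat_allC (A : LTerm → Bld) : (Bld.allC A c s).Sat ρ υ ↔
    ∀ X, (A (.cvar c) (c + 1) s).Sat (scons X ρ) υ := Iff.rfl
@[simp] theorem Bld.sat_allS (A : LTerm → Bld) : (Bld.allS A c s).Sat ρ υ ↔
    ∀ x, (A (.svar s) c (s + 1)).Sat ρ (scons x υ) := Iff.rfl
@[simp] theorem Bld.sat_and (A B : Bld) : (Bld.and A B c s).Sat ρ υ ↔
    (A c s).Sat ρ υ ∧ (B c s).Sat ρ υ := by
  simp [Bld.and]
@[simp] theorem Bld.sat_or (A B : Bld) : (Bld.or A B c s).Sat ρ υ ↔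
    (A c s).Sat ρ υ ∨ (B c s).Sat ρ υ := by
  simp [Bld.or, or_iff_not_imp_left]
@[simp] theorem Bld.sat_iff (A B : Bld) : (Bld.iff A B c s).Sat ρ υ ↔
    ((A c s).Sat ρ υ ↔ (B c s).Sat ρ υ) := by
  simp [Bld.iff, iff_iff_implies_and_implies]
@[simp] theorem Bld.sat_exC (A : LTerm → Bld) : (Bld.exC A c s).Sat ρ υ ↔
    ∃ X, (A (.cvar c) (c + 1) s).Sat (scons X ρ) υ := by
  simp [Bld.exC]
@[simp] theorem Bld.sat_exS (A : LTerm → Bld) : (Bld.exS A c s).Sat ρ υ ↔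
    ∃ x, (A (.svar s) c (s + 1)).Sat ρ (scons x υ) := by
  simp [Bld.exS]

theorem LTerm.val_subst (σ τ : ℕ → LTerm) (υ' : ℕ → S)
    (hτ : ∀ i, (τ i).val ρ υ = Str.emb (υ' i)) (t : LTerm) :
    (t.subst σ τ).val ρ υ = t.val (fun i => (σ i).val ρ υ) υ' := by
  induction t with
  | cvar | V => rfl
  | svar i => exact hτ i
  | P s t hs ht => simp [LTerm.subst, LTerm.val, hs, ht]

theorem LTerm.val_liftC (t : LTerm) (X : M) : t.liftC.val (scons X ρ) υ = t.val ρ υ :=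
  LTerm.val_subst _ _ υ (fun _ => rfl) t

theorem LTerm.val_liftS (t : LTerm) (x : S) : t.liftS.val ρ (scons x υ) = t.val ρ υ :=
  LTerm.val_subst _ _ υ (fun _ => rfl) t

theorem LForm.sat_subst (φ : LForm) : ∀ (ρ : ℕ → M) (υ : ℕ → S) (σ τ : ℕ → LTerm) (υ' : ℕ → S),
    (∀ i, (τ i).val ρ υ = Str.emb (υ' i)) →
    ((φ.subst σ τ).Sat ρ υ ↔ φ.Sat (fun i => (σ i).val ρ υ) υ') := by
  induction φ with
  | mem s t | eq s t =>
    intro ρ υ σ τ υ' h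
    simp only [LForm.subst, LForm.Sat, LTerm.val_subst _ _ υ' h]
  | bot => intros; rfl
  | imp φ ψ h1 h2 => intro ρ υ σ τ υ' h; simp only [LForm.subst, LForm.Sat, h1 _ _ _ _ _ h, h2 _ _ _ _ _ h]
  | allC φ hφ =>
    intro ρ υ σ τ υ' h
    simp only [LForm.subst, LForm.Sat]
    refine forall_congr' fun X => ?_
    rw [hφ _ _ _ _ υ' fun i => (LTerm.val_liftC _ X).trans (h i)]
    rw [show (fun i => (upC σ i).val (scons X ρ) υ) = scons X fun i => (σ i).val ρ υ from
      scons_ext rfl fun i => LTerm.val_liftC _ X]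
  | allS φ hφ =>
    intro ρ υ σ τ υ' h
    simp only [LForm.subst, LForm.Sat]
    refine forall_congr' fun x => ?_
    rw [hφ _ _ _ _ (scons x υ')]
    · simp only [LTerm.val_liftS]
    · rintro (_ | i)
      · rfl
      · exact (LTerm.val_liftS _ x).trans (h i)

theorem LTerm.HasType.subst {τ τ' : ℕ → ℕ} {σ κ : ℕ → LTerm} {n : ℕ} {t : LTerm}
    (h : t.HasType τ n) (hσ : ∀ i, (σ i).HasType τ' (τ i)) (hκ : ∀ i m, (κ i).HasType τ' m) :
    (t.subst σ κ).HasType τ' n := by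
  induction t with
  | cvar i => exact Eq.subst (motive := fun n => (σ i).HasType τ' n) h (hσ i)
  | svar i => exact hκ i n
  | V => trivial
  | P s t hs ht => exact ⟨hs h.1, ht h.2⟩

/-- What replaces a set variable must accept every type, because occurrences of set variables are
typed freely. -/
theorem LForm.StratifiedBy.subst (φ : LForm) : ∀ {τ τ' : ℕ → ℕ} {σ κ : ℕ → LTerm},
    φ.StratifiedBy τ → (∀ i, (σ i).HasType τ' (τ i)) → (∀ i m, (κ i).HasType τ' m) →
    (φ.subst σ κ).StratifiedBy τ' := by
  induction φ with
  | mem s t | eq s t =>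
    rintro τ τ' σ κ ⟨n, h1, h2⟩ hσ hκ
    exact ⟨n, h1.subst hσ hκ, h2.subst hσ hκ⟩
  | bot => intros; trivial
  | imp φ ψ h1 h2 => rintro τ τ' σ κ ⟨h3, h4⟩ hσ hκ; exact ⟨h1 h3 hσ hκ, h2 h4 hσ hκ⟩
  | allC φ hφ =>
    rintro τ τ' σ κ ⟨n, h⟩ hσ hκ
    refine ⟨n, hφ h ?_ ?_⟩
    · rintro (_ | i)
      · rfl
      · exact (hσ i).subst (fun _ => rfl) fun _ _ => trivial
    · exact fun i m => (hκ i m).subst (fun _ => rfl) fun _ _ => trivial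
  | allS φ hφ =>
    rintro τ τ' σ κ h hσ hκ
    refine hφ h ?_ ?_
    · exact fun i => (hσ i).subst (fun _ => rfl) fun _ _ => trivial
    · rintro (_ | i) m
      · trivial
      · exact (hκ i m).subst (fun _ => rfl) fun _ _ => trivial

end BldSat

/-! ## Definable relations

Relations on a structure are presented as functions of a sequence of classes and a sequence of
sets, of which the first members are the quantified variables.  Elements of the structure may occur
as parameters; a class parameter may be used with several types. -/

section Definability

variable {M S : Type} [Str M S]

/-- The value of a variable or parameter. -/
def look {α β : Type} (x : ℕ ⊕ α) (val : α → β) (c : ℕ → β) : β := x.elim c val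

/-- A common sequence of variables and parameters for two formulas. -/
def merge {α : Type} (f g : ℕ → α) (i : ℕ) : α := if i % 2 = 0 then f (i / 2) else g (i / 2)

theorem merge_even {α : Type} (f g : ℕ → α) (i : ℕ) : merge f g (2 * i) = f i := by
  simp [merge]

theorem merge_odd {α : Type} (f g : ℕ → α) (i : ℕ) : merge f g (2 * i + 1) = g i := by
  have h1 : (2 * i + 1) % 2 = 1 := by omega
  have h2 : (2 * i + 1) / 2 = i := by omega
  simp [merge, h1, h2]

/-- The sequence of values of variables and parameters for class variables. -/
def valC (f : ℕ → ℕ ⊕ ℕ × M) (c : ℕ → M) (i : ℕ) : M := look (f i) Prod.snd c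

/-- The sequence of types of variables and parameters for class variables. -/
def typC (f : ℕ → ℕ ⊕ ℕ × M) (τ : ℕ → ℕ) (i : ℕ) : ℕ := look (f i) Prod.fst τ

/-- The sequence of values of variables and parameters for set variables. -/
def valS (g : ℕ → ℕ ⊕ S) (s : ℕ → S) (i : ℕ) : S := look (g i) id s

/-- A relation defined by a formula with parameters, which is stratified if `st` holds. -/
def Dfn (st : Prop) (τ : ℕ → ℕ) (R : (ℕ → M) → (ℕ → S) → Prop) : Prop :=
  ∃ (φ : LForm) (f : ℕ → ℕ ⊕ ℕ × M) (g : ℕ → ℕ ⊕ S), (st → φ.StratifiedBy (typC f τ)) ∧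
    ∀ c s, φ.Sat (valC f c) (valS g s) ↔ R c s

/-- A function given by a term with parameters, which has type `n` if `st` holds. -/
def Trm (st : Prop) (τ : ℕ → ℕ) (n : ℕ) (t : (ℕ → M) → (ℕ → S) → M) : Prop :=
  ∃ (u : LTerm) (f : ℕ → ℕ ⊕ ℕ × M) (g : ℕ → ℕ ⊕ S), (st → u.HasType (typC f τ) n) ∧
    ∀ c s, u.val (valC f c) (valS g s) = t c s

/-- A variable or parameter for sets. -/
def TrmS (x : (ℕ → S) → S) : Prop := ∃ y : ℕ ⊕ S, ∀ s, look y id s = x s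

variable {st : Prop} {τ : ℕ → ℕ}

theorem TrmS.var (i : ℕ) : TrmS (S := S) fun s => s i := ⟨.inl i, fun _ => rfl⟩

theorem TrmS.const (x : S) : TrmS fun _ => x := ⟨.inr x, fun _ => rfl⟩

namespace Trm

theorem var {i n : ℕ} (h : τ i = n) : Trm (M := M) (S := S) st τ n fun c _ => c i :=
  ⟨.cvar 0, fun _ => .inl i, fun _ => .inl 0, fun _ => h, fun _ _ => rfl⟩

theorem var_zero {n : ℕ} : Trm (M := M) (S := S) st (scons n τ) n fun c _ => c 0 := var rfl

theorem var_succ {i m n : ℕ} (h : Trm (M := M) (S := S) st τ n fun c _ => c i) :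
    Trm (M := M) (S := S) st (scons m τ) n fun c _ => c (i + 1) := by
  obtain ⟨u, f, g, h1, h2⟩ := h
  refine ⟨u, fun j => (f j).map Nat.succ id, g, fun h3 => ?_, fun c s => ?_⟩
  · convert h1 h3 using 1
    funext j
    rcases h : f j with k | a <;> simp [typC, look, h]
  · rw [← h2 (fun i => c (i + 1)) s]
    congr 1; funext j
    rcases h : f j with k | a <;> simp [valC, look, h]

theorem var_false {i n : ℕ} : Trm (M := M) (S := S) False τ n fun c _ => c i :=
  ⟨.cvar 0, fun _ => .inl i, fun _ => .inl 0, False.elim, fun _ _ => rfl⟩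

theorem const {n : ℕ} (X : M) : Trm (M := M) (S := S) st τ n fun _ _ => X :=
  ⟨.cvar 0, fun _ => .inr (n, X), fun _ => .inl 0, fun _ => rfl, fun _ _ => rfl⟩

theorem set {n : ℕ} {x : (ℕ → S) → S} (h : TrmS x) :
    Trm (M := M) (S := S) st τ n fun _ s => Str.emb (x s) := by
  obtain ⟨y, hy⟩ := h
  exact ⟨.svar 0, fun _ => .inl 0, fun _ => y, fun _ => trivial, fun _ s => congrArg _ (hy s)⟩

/-- Two terms with parameters over a common sequence of parameters. -/
theorem exists_common {m n : ℕ} {t u : (ℕ → M) → (ℕ → S) → M} (ht : Trm st τ m t)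
    (hu : Trm st τ n u) : ∃ (t' u' : LTerm) (f : ℕ → ℕ ⊕ ℕ × M) (g : ℕ → ℕ ⊕ S),
      (st → t'.HasType (typC f τ) m ∧ u'.HasType (typC f τ) n) ∧
      ∀ c s, t'.val (valC f c) (valS g s) = t c s ∧ u'.val (valC f c) (valS g s) = u c s := by
  obtain ⟨t', f, g, h1, h2⟩ := ht
  obtain ⟨u', f', g', h3, h4⟩ := hu
  refine ⟨t'.subst (fun i => .cvar (2 * i)) fun i => .svar (2 * i),
    u'.subst (fun i => .cvar (2 * i + 1)) fun i => .svar (2 * i + 1), merge f f', merge g g',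
    fun h => ⟨(h1 h).subst ?_ fun _ _ => trivial, (h3 h).subst ?_ fun _ _ => trivial⟩,
    fun c s => ⟨?_, ?_⟩⟩
  · intro i; simp [LTerm.HasType, typC, merge_even]
  · intro i; simp [LTerm.HasType, typC, merge_odd]
  · rw [LTerm.val_subst _ _ (valS g s) (by intro i; simp [LTerm.val, valS, merge_even]), ← h2]
    congr 1; funext i; simp [LTerm.val, valC, merge_even]
  · rw [LTerm.val_subst _ _ (valS g' s) (by intro i; simp [LTerm.val, valS, merge_odd]), ← h4]
    congr 1; funext i; simp [LTerm.val, valC, merge_odd]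

theorem P {n : ℕ} {t u : (ℕ → M) → (ℕ → S) → M} (ht : Trm st τ n t) (hu : Trm st τ n u) :
    Trm st τ n fun c s => Str.P (t c s) (u c s) := by
  obtain ⟨t', u', f, g, h1, h2⟩ := exists_common ht hu
  exact ⟨.P t' u', f, g, h1, fun c s => congrArg₂ _ (h2 c s).1 (h2 c s).2⟩

end Trm

namespace Dfn

theorem mem {n : ℕ} {t u : (ℕ → M) → (ℕ → S) → M} (ht : Trm st τ n t) (hu : Trm st τ (n + 1) u) :
    Dfn st τ fun c s => Str.mem (t c s) (u c s) := by
  obtain ⟨t', u', f, g, h1, h2⟩ := Trm.exists_common ht hu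
  exact ⟨.mem t' u', f, g, fun h => ⟨n, h1 h⟩, fun c s => by
    rw [LForm.Sat, (h2 c s).1, (h2 c s).2]⟩

theorem eq {n : ℕ} {t u : (ℕ → M) → (ℕ → S) → M} (ht : Trm st τ n t) (hu : Trm st τ n u) :
    Dfn st τ fun c s => t c s = u c s := by
  obtain ⟨t', u', f, g, h1, h2⟩ := Trm.exists_common ht hu
  exact ⟨.eq t' u', f, g, fun h => ⟨n, h1 h⟩, fun c s => by
    rw [LForm.Sat, (h2 c s).1, (h2 c s).2]⟩

theorem eqS {x y : (ℕ → S) → S} (he : (Str.emb : S → M).Injective) (hx : TrmS x) (hy : TrmS y) :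
    Dfn (M := M) st τ fun _ s => x s = y s := by
  have := Dfn.eq (M := M) (st := st) (τ := τ) (n := 0) (Trm.set hx) (Trm.set hy)
  simpa only [he.eq_iff] using this

theorem false : Dfn (M := M) (S := S) st τ fun _ _ => False :=
  ⟨.bot, fun _ => .inl 0, fun _ => .inl 0, fun _ => trivial, fun _ _ => Iff.rfl⟩

theorem imp {R Q : (ℕ → M) → (ℕ → S) → Prop} (hR : Dfn st τ R) (hQ : Dfn st τ Q) :
    Dfn st τ fun c s => R c s → Q c s := by
  obtain ⟨φ, f, g, h1, h2⟩ := hR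
  obtain ⟨ψ, f', g', h3, h4⟩ := hQ
  refine ⟨.imp (φ.subst (fun i => .cvar (2 * i)) fun i => .svar (2 * i))
    (ψ.subst (fun i => .cvar (2 * i + 1)) fun i => .svar (2 * i + 1)), merge f f', merge g g',
    fun h => ⟨(h1 h).subst _ ?_ fun _ _ => trivial, (h3 h).subst _ ?_ fun _ _ => trivial⟩,
    fun c s => imp_congr ?_ ?_⟩
  · intro i; simp [LTerm.HasType, typC, merge_even]
  · intro i; simp [LTerm.HasType, typC, merge_odd]
  · rw [LForm.sat_subst _ _ _ _ _ (valS g s) (by intro i; simp [LTerm.val, valS, merge_even]), ← h2]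
    rw [show (fun i => (LTerm.cvar (2 * i)).val (valC (merge f f') c) (valS (merge g g') s)) =
      valC f c by funext i; simp [LTerm.val, valC, merge_even]]
  · rw [LForm.sat_subst _ _ _ _ _ (valS g' s) (by intro i; simp [LTerm.val, valS, merge_odd]), ← h4]
    rw [show (fun i => (LTerm.cvar (2 * i + 1)).val (valC (merge f f') c) (valS (merge g g') s)) =
      valC f' c by funext i; simp [LTerm.val, valC, merge_odd]]

theorem congr {R Q : (ℕ → M) → (ℕ → S) → Prop} (hR : Dfn st τ R) (h : ∀ c s, R c s ↔ Q c s) :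
    Dfn st τ Q := by
  rwa [show Q = R from funext fun c => funext fun s => propext (h c s).symm]

theorem not {R : (ℕ → M) → (ℕ → S) → Prop} (hR : Dfn st τ R) : Dfn st τ fun c s => ¬ R c s :=
  hR.imp false

theorem and {R Q : (ℕ → M) → (ℕ → S) → Prop} (hR : Dfn st τ R) (hQ : Dfn st τ Q) :
    Dfn st τ fun c s => R c s ∧ Q c s :=
  (hR.imp hQ.not).not.congr fun c s => by tauto

theorem or {R Q : (ℕ → M) → (ℕ → S) → Prop} (hR : Dfn st τ R) (hQ : Dfn st τ Q) :
    Dfn st τ fun c s => R c s ∨ Q c s :=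
  (hR.not.imp hQ).congr fun c s => by tauto

theorem iff {R Q : (ℕ → M) → (ℕ → S) → Prop} (hR : Dfn st τ R) (hQ : Dfn st τ Q) :
    Dfn st τ fun c s => R c s ↔ Q c s :=
  ((hR.imp hQ).and (hQ.imp hR)).congr fun c s => by tauto

/-- The variable or parameter for the outside of a quantifier that binds the first variable. -/
def lower {α : Type} : ℕ ⊕ α → ℕ ⊕ α
  | .inl i => .inl (i - 1)
  | .inr a => .inr a

open Classical in
/-- The renaming which identifies all variables that stand for the first one. -/
noncomputable def bindIndex {α : Type} (f : ℕ → ℕ ⊕ α) (i : ℕ) : ℕ := if f i = .inl 0 then 0 else i + 1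

theorem scons_bindIndex {α β : Type} (f : ℕ → ℕ ⊕ α) (v : α → β) (x : β) (c : ℕ → β) (i : ℕ) :
    scons x (fun i => look (lower (f i)) v c) (bindIndex f i) = look (f i) v (scons x c) := by
  unfold bindIndex
  rcases h : f i with (_ | k) | a <;> simp [look, lower, h]

/-- Merging parameter sequences can leave several variables of `φ` standing for the variable to be
bound. They all have type `n`, so they may be identified by `bindIndex` before quantifying without
spoiling stratification. -/
theorem allC (n : ℕ) {R : (ℕ → M) → (ℕ → S) → M → Prop}
    (h : Dfn st (scons n τ) fun c s => R (fun i => c (i + 1)) s (c 0)) :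
    Dfn st τ fun c s => ∀ X, R c s X := by
  obtain ⟨φ, f, g, h1, h2⟩ := h
  refine ⟨.allC (φ.subst (fun i => .cvar (bindIndex f i)) .svar), fun i => lower (f i), g,
    fun h => ⟨n, (h1 h).subst _ (fun i => ?_) fun _ _ => trivial⟩,
    fun c s => forall_congr' fun X => ?_⟩
  · exact scons_bindIndex f _ _ _ i
  · have := h2 (scons X c) s
    simp only [scons_succ, scons_zero] at this
    rw [← this, LForm.sat_subst _ _ _ _ _ (valS g s) (fun _ => rfl)]
    rw [show (fun i => (LTerm.cvar (bindIndex f i)).val (scons X (valC (fun i => lower (f i)) c))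
      (valS g s)) = valC f (scons X c) from funext fun i => scons_bindIndex f _ _ _ i]

theorem allS {R : (ℕ → M) → (ℕ → S) → S → Prop}
    (h : Dfn st τ fun c s => R c (fun i => s (i + 1)) (s 0)) :
    Dfn st τ fun c s => ∀ x, R c s x := by
  obtain ⟨φ, f, g, h1, h2⟩ := h
  refine ⟨.allS (φ.subst .cvar (fun i => .svar (bindIndex g i))), f, fun i => lower (g i),
    fun h => (h1 h).subst _ (fun i => rfl) fun _ _ => trivial,
    fun c s => forall_congr' fun x => ?_⟩
  have := h2 c (scons x s)
  simp only [scons_succ, scons_zero] at this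
  rw [← this, LForm.sat_subst _ _ _ _ _ (valS g (scons x s)) (fun i => ?_)]
  · rfl
  · exact congrArg Str.emb (scons_bindIndex g _ _ _ i)

theorem exC (n : ℕ) {R : (ℕ → M) → (ℕ → S) → M → Prop}
    (h : Dfn st (scons n τ) fun c s => R (fun i => c (i + 1)) s (c 0)) :
    Dfn st τ fun c s => ∃ X, R c s X :=
  (allC (R := fun c s X => ¬ R c s X) n h.not).not.congr fun c s => by simp

theorem exS {R : (ℕ → M) → (ℕ → S) → S → Prop}
    (h : Dfn st τ fun c s => R c (fun i => s (i + 1)) (s 0)) :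
    Dfn st τ fun c s => ∃ x, R c s x :=
  (allS (R := fun c s x => ¬ R c s x) h.not).not.congr fun c s => by simp

/-- A stratified definition also serves where any formula is allowed, as in the foundation scheme.
-/
theorem forget {R : (ℕ → M) → (ℕ → S) → Prop} (h : Dfn True τ R) : Dfn st τ R := by
  obtain ⟨φ, f, g, h1, h2⟩ := h
  exact ⟨φ, f, g, fun _ => h1 trivial, h2⟩

end Dfn

end Definability

/-! ## Models of `S*` -/

/-- Models of `S*`. -/
class SModel (M : Type) (S : outParam Type) extends Str M S where
  nonempty_sets : Nonempty S
  emb_injective : emb.Injective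
  sat_of_sstar : ∀ φ, SStar φ → ∀ (ρ : ℕ → M) (υ : ℕ → S), φ.Sat ρ υ

local infix:50 " ε " => Str.mem
local prefix:max "↟" => Str.emb

namespace SModel

section Facts

variable {M S : Type} [SModel M S]

theorem emb_inj {x y : S} : (↟x : M) = ↟y ↔ x = y := (emb_injective (M := M)).eq_iff

theorem sat_app_one_class (φ : LForm) (ρ : ℕ → M) (υ : ℕ → S) (X Y : M) :
    (Bld.app φ [.cvar 1] [] 2 0).Sat (scons X (scons Y ρ)) υ ↔ φ.Sat (scons X ρ) υ := by
  rw [Bld.app, LForm.sat_subst _ _ _ _ _ υ (by intro i; simp [LTerm.val])]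
  refine iff_of_eq (congrArg (fun r => LForm.Sat r υ φ) (scons_ext ?_ fun i => ?_)) <;>
    simp [LTerm.toIndex, LTerm.val]

/-- The parameters become free variables of the comprehension axiom, and a parameter used at several
types is represented by several variables with the same value. -/
theorem exists_class_of_dfn {n : ℕ} {R : M → Prop}
    (h : Dfn True (scons n fun _ => 0) fun c _ => R (c 0)) : ∃ Y : M, ∀ X, X ε Y ↔ R X := by
  obtain ⟨φ, f, g, h1, h2⟩ := h
  obtain ⟨x⟩ := nonempty_sets M
  have h3 := sat_of_sstar (M := M) _ (SStar.comprehension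
    (φ.subst (fun i => .cvar (Dfn.bindIndex f i)) .svar)
    ⟨scons n fun i => look (Dfn.lower (f i)) Prod.fst fun _ => 0,
      (h1 trivial).subst _ (fun i => Dfn.scons_bindIndex f _ _ _ i) fun _ _ => trivial⟩)
    (fun i => look (Dfn.lower (f i)) Prod.snd fun _ => Str.V) (valS g fun _ => x)
  simp only [comprehension, Bld.close, Bld.sat_exC, Bld.sat_allC, Bld.sat_iff, Bld.sat_mem] at h3
  obtain ⟨Y, hY⟩ := h3
  refine ⟨Y, fun X => (hY X).trans ?_⟩
  rw [sat_app_one_class, LForm.sat_subst _ _ _ _ _ (valS g fun _ => x) (fun _ => rfl)]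
  have := h2 (scons X fun _ => Str.V) (fun _ => x)
  simp only [scons_zero] at this
  rw [← this]
  rw [show valC f (scons X fun _ => Str.V) = fun i => (LTerm.cvar (Dfn.bindIndex f i)).val
    (scons X fun i => look (Dfn.lower (f i)) Prod.snd fun _ => Str.V) (valS g fun _ => x) from
    funext fun i => (Dfn.scons_bindIndex f _ _ _ i).symm]

/-- The class of all `X` with `R X`, for stratified definable `R`. -/
noncomputable def cl (R : M → Prop) : M :=
  open Classical in if h : ∃ Y : M, ∀ X, X ε Y ↔ R X then h.choose else Str.V

/-- The comprehension scheme; the type of the elements is `9`, to leave room for smaller types. -/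
theorem mem_cl {R : M → Prop} {X : M}
    (h : Dfn True (scons 9 fun _ => 0) fun c _ => R (c 0) := by
      try beta_reduce
      repeat' first
        | apply Dfn.and | apply Dfn.or | apply Dfn.iff | apply Dfn.not | apply Dfn.allS
        | apply Dfn.exS | apply Dfn.exC | apply Dfn.allC | apply Dfn.mem | apply Dfn.eq
        | apply Dfn.eqS emb_injective
        | apply Dfn.false | apply Dfn.imp | apply Trm.const | apply Trm.var_zero
        | apply Trm.var_succ | apply Trm.set | apply TrmS.const | apply TrmS.var | apply Trm.P
      -- Types that unification leaves undetermined are arbitrary.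
      all_goals exact 0) : X ε cl R ↔ R X := by
  have h1 := exists_class_of_dfn h
  rw [cl, dif_pos h1]
  exact h1.choose_spec X

/-- With `False` as the stratification condition, any formula with parameters is admitted; the
foundation scheme asks for no stratification. -/
theorem exists_minimal_of_dfn {R : S → Prop} (h : Dfn (M := M) False (fun _ => 0) fun _ s => R (s 0))
    {x : S} (hx : R x) : ∃ x, R x ∧ ∀ y, (↟y : M) ε ↟x → ¬ R y := by
  obtain ⟨φ, f, g, h1, h2⟩ := h
  have key : ∀ y, (φ.subst .cvar (fun i => .svar (Dfn.bindIndex g i))).Sat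
      (valC f fun _ => (Str.V : M)) (scons y fun i => look (Dfn.lower (g i)) id fun _ => x) ↔
      R y := by
    intro y
    have := h2 (fun _ => Str.V) (scons y fun _ => x)
    simp only [scons_zero] at this
    rw [← this, LForm.sat_subst _ _ _ _ _ (valS g (scons y fun _ => x)) (fun i => ?_)]
    · rfl
    · exact congrArg Str.emb (Dfn.scons_bindIndex g _ _ _ i)
  have h3 := sat_of_sstar (M := M) _ (SStar.foundation
    (φ.subst .cvar (fun i => .svar (Dfn.bindIndex g i))))
    (valC f fun _ => Str.V) (fun i => look (Dfn.lower (g i)) id fun _ => x)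
  generalize φ.subst .cvar (fun i => .svar (Dfn.bindIndex g i)) = ψ at key h3
  generalize (fun i => look (Dfn.lower (g i)) id fun _ => x) = υ at key h3
  generalize (valC f fun _ => (Str.V : M)) = ρ at key h3
  have app1 : ∀ y, (Bld.app ψ [] [.svar 0] 0 1).Sat ρ (scons y υ) ↔ R y := by
    intro y
    rw [← key, Bld.app, LForm.sat_subst _ _ _ _ _ (scons y υ)]
    · simp [LTerm.val]
    · rintro (_ | i) <;> simp [LTerm.val, LTerm.toIndex]
  have app2 : ∀ y z, (Bld.app ψ [] [.svar 1] 0 2).Sat ρ (scons z (scons y υ)) ↔ R z := by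
    intro y z
    rw [← key, Bld.app, LForm.sat_subst _ _ _ _ _ (scons z υ)]
    · simp [LTerm.val]
    · rintro (_ | i) <;> simp [LTerm.val, LTerm.toIndex]
  simp [foundation, Bld.close, app1, app2, LTerm.toIndex, LTerm.val] at h3
  obtain ⟨y, hy⟩ := h3 x hx
  exact ⟨y, hy.1, fun z h4 h5 => hy.2 z h4 h5⟩

theorem exists_minimal {R : S → Prop} {x : S} (hx : R x)
    (h : Dfn (M := M) True (fun _ => 0) fun _ s => R (s 0) := by
      try beta_reduce
      repeat' first
        | apply Dfn.and | apply Dfn.or | apply Dfn.iff | apply Dfn.not | apply Dfn.allS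
        | apply Dfn.exS | apply Dfn.exC | apply Dfn.allC | apply Dfn.mem | apply Dfn.eq
        | apply Dfn.eqS emb_injective
        | apply Dfn.false | apply Dfn.imp | apply Trm.const | apply Trm.var_zero
        | apply Trm.var_succ | apply Trm.set | apply TrmS.const | apply TrmS.var | apply Trm.P
      all_goals exact 0) :
    ∃ x, R x ∧ ∀ y, (↟y : M) ε ↟x → ¬ R y :=
  exists_minimal_of_dfn h.forget hx

/-- Replacement is needed only for the formula `P(x, y) ∈ Z` with a class parameter, since every
function in question is first made into a class. -/
theorem exists_image_of_class (Z : M) (hZ : ∀ x y₁ y₂ : S, Str.P ↟x ↟y₁ ε Z → Str.P ↟x ↟y₂ ε Z → y₁ = y₂)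
    (a : S) : ∃ b : S, ∀ y : S, (↟y : M) ε ↟b ↔ ∃ x : S, (↟x : M) ε ↟a ∧ Str.P ↟x ↟y ε Z := by
  have h3 := sat_of_sstar (M := M) _ (SStar.replacement (.mem (.P (.svar 0) (.svar 1)) (.cvar 0)))
    (fun _ => Z) (fun _ => a)
  simp [replacement, Bld.close, LTerm.toIndex, LTerm.val, Bld.app, LForm.subst, LTerm.subst,
    LForm.Sat, emb_inj] at h3
  exact h3 hZ a

theorem P_inj {X₁ X₂ Y₁ Y₂ : M} : Str.P X₁ X₂ = Str.P Y₁ Y₂ ↔ X₁ = Y₁ ∧ X₂ = Y₂ := by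
  refine ⟨fun h => ?_, by rintro ⟨rfl, rfl⟩; rfl⟩
  obtain ⟨x⟩ := nonempty_sets M
  have h3 := sat_of_sstar (M := M) _ SStar.pairing (fun _ => Str.V) (fun _ => x)
  simp [FefermanS.pairing, Bld.close, LTerm.toIndex, LTerm.val] at h3
  exact h3 X₁ X₂ Y₁ Y₂ h

theorem mem_V {X : M} : X ε Str.V ↔ ∃ x, ↟x = X := by
  obtain ⟨x⟩ := nonempty_sets M
  have h3 := sat_of_sstar (M := M) _ SStar.elementsOfV (fun _ => Str.V) (fun _ => x)
  simp [elementsOfV, Bld.close, LTerm.toIndex, LTerm.val] at h3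
  exact h3 X

theorem exists_of_mem {X : M} {x : S} (h : X ε ↟x) : ∃ y, ↟y = X := by
  have h3 := sat_of_sstar (M := M) _ SStar.elementsOfSets (fun _ => Str.V) (fun _ => x)
  simp [elementsOfSets, Bld.close, LTerm.toIndex, LTerm.val] at h3
  exact mem_V.1 (h3 X x h)

variable (M) in
theorem exists_empty : ∃ z : S, ∀ w, (∀ y : S, ¬ (↟y : M) ε ↟w) ↔ w = z := by
  obtain ⟨x⟩ := nonempty_sets M
  have h3 := sat_of_sstar (M := M) _ SStar.emptySet (fun _ => Str.V) (fun _ => x)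
  simp [emptySet, FefermanS.isEmpty, Bld.close, LTerm.toIndex, LTerm.val, emb_inj] at h3
  obtain ⟨z, hz, h⟩ := h3
  exact ⟨z, fun w => ⟨h w, by rintro rfl; exact hz⟩⟩

theorem ext_of_sethood {X Y : M} (hX : (∃ Z, Z ε X) ∨ ∃ z : S, (∀ y : S, ¬ (↟y : M) ε ↟z) ∧ X = ↟z)
    (hY : (∃ Z, Z ε Y) ∨ ∃ z : S, (∀ y : S, ¬ (↟y : M) ε ↟z) ∧ Y = ↟z)
    (h : ∀ Z, Z ε X ↔ Z ε Y) : X = Y := by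
  obtain ⟨x⟩ := nonempty_sets M
  have h3 := sat_of_sstar (M := M) _ SStar.weakExtensionality (fun _ => Str.V) (fun _ => x)
  simp [weakExtensionality, sethood, FefermanS.isEmpty, Bld.close, LTerm.toIndex, LTerm.val] at h3
  exact (h3 X Y hX hY).2 h

theorem ext_of_nonempty {X Y Z : M} (hZ : Z ε X) (h : ∀ Z, Z ε X ↔ Z ε Y) : X = Y :=
  ext_of_sethood (.inl ⟨Z, hZ⟩) (.inl ⟨Z, (h Z).1 hZ⟩) h

/-- A set without members is the designated empty set and never another atom, so extensionality
holds for all sets. -/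
theorem sethood_emb (x : S) :
    (∃ Z : M, Z ε ↟x) ∨ ∃ z : S, (∀ y : S, ¬ (↟y : M) ε ↟z) ∧ (↟x : M) = ↟z := by
  by_cases h : ∃ Z : M, Z ε ↟x
  · exact .inl h
  · exact .inr ⟨x, fun y hy => h ⟨_, hy⟩, rfl⟩

theorem ext_set {x y : S} (h : ∀ z : S, (↟z : M) ε ↟x ↔ (↟z : M) ε ↟y) : x = y := by
  refine emb_inj.1 (ext_of_sethood (sethood_emb (M := M) x) (sethood_emb y) fun Z => ?_)
  exact ⟨fun hZ => by obtain ⟨z, rfl⟩ := exists_of_mem hZ; exact (h z).1 hZ,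
    fun hZ => by obtain ⟨z, rfl⟩ := exists_of_mem hZ; exact (h z).2 hZ⟩

theorem exists_pair (x y : S) : ∃ w : S, ∀ Z : M, Z ε ↟w ↔ Z = ↟x ∨ Z = ↟y := by
  have h3 := sat_of_sstar (M := M) _ SStar.unorderedPair (fun _ => Str.V) (fun _ => x)
  simp [FefermanS.unorderedPair, FefermanS.isPair, Bld.close, LTerm.toIndex, LTerm.val] at h3
  obtain ⟨W, h1, h2⟩ := h3 x y
  obtain ⟨w, rfl⟩ := mem_V.1 h2
  exact ⟨w, h1⟩

theorem exists_union (x : S) : ∃ w : S, ∀ z : S, (↟z : M) ε ↟w ↔ ∃ u : S, (↟u : M) ε ↟x ∧ (↟z : M) ε ↟u := by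
  have h3 := sat_of_sstar (M := M) _ SStar.union (fun _ => Str.V) (fun _ => x)
  simp [FefermanS.union, Bld.close, LTerm.toIndex, LTerm.val] at h3
  obtain ⟨W, h1, h2⟩ := h3 x
  obtain ⟨w, rfl⟩ := mem_V.1 h2
  refine ⟨w, fun z => (h1 _).trans ⟨?_, ?_⟩⟩
  · rintro ⟨U, h4, h5⟩
    obtain ⟨u, rfl⟩ := exists_of_mem h4
    exact ⟨u, h4, h5⟩
  · rintro ⟨u, h⟩; exact ⟨_, h⟩

theorem exists_power (x : S) : ∃ w : S, ∀ z : S, (↟z : M) ε ↟w ↔ ∀ u : S, (↟u : M) ε ↟z → (↟u : M) ε ↟x := by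
  have h3 := sat_of_sstar (M := M) _ SStar.power (fun _ => Str.V) (fun _ => x)
  simp [FefermanS.power, sethood, FefermanS.isEmpty, Bld.close, LTerm.toIndex, LTerm.val] at h3
  obtain ⟨W, h1, h2⟩ := h3 x
  obtain ⟨w, rfl⟩ := mem_V.1 h2
  refine ⟨w, fun z => (h1 _).trans ⟨fun h u => h.2 _, fun h => ⟨sethood_emb z, fun U hU => ?_⟩⟩⟩
  obtain ⟨u, rfl⟩ := exists_of_mem hU
  exact h u hU

theorem mem_P_emb {x y : S} {Z : M} : Z ε Str.P ↟x ↟y ↔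
    (∀ W, W ε Z ↔ W = ↟x) ∨ ∀ W, W ε Z ↔ W = ↟x ∨ W = ↟y := by
  have h3 := sat_of_sstar (M := M) _ SStar.kuratowski (fun _ => Str.V) (fun _ => x)
  simp [FefermanS.kuratowski, FefermanS.isPair, isSingleton, Bld.close, LTerm.toIndex,
    LTerm.val] at h3
  exact h3 x y Z

variable (M) in
theorem exists_inductive : ∃ a : S, (∃ z : S, (↟z : M) ε ↟a ∧ ∀ y : S, ¬ (↟y : M) ε ↟z) ∧
    ∀ x : S, (↟x : M) ε ↟a → ∃ w : S, (∀ y : S, (↟y : M) ε ↟w ↔ (↟y : M) ε ↟x ∨ y = x) ∧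
      (↟w : M) ε ↟a := by
  obtain ⟨x⟩ := nonempty_sets M
  have h3 := sat_of_sstar (M := M) _ SStar.infinity (fun _ => Str.V) (fun _ => x)
  simpa [FefermanS.infinity, isInductive, isSucc, FefermanS.isEmpty, Bld.close, LTerm.toIndex,
    LTerm.val, emb_inj] using h3

variable (M) in
theorem exists_choice : ∃ C : M, (∀ X Y₁ Y₂, Str.P X Y₁ ε C → Str.P X Y₂ ε C → Y₁ = Y₂) ∧
    ∀ X Z : M, Z ε X → ∃ Y, Y ε X ∧ ∃ W, (∀ Z, Z ε W ↔ Z = Y) ∧ Str.P X W ε C := by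
  obtain ⟨x⟩ := nonempty_sets M
  have h3 := sat_of_sstar (M := M) _ SStar.universalChoice (fun _ => Str.V) (fun _ => x)
  simpa [universalChoice, isSingleton, Bld.close, LTerm.toIndex, LTerm.val] using h3

end Facts
end SModel

/-! ## Sets -/

namespace SModel

variable {M S : Type} [SModel M S]

local notation:50 x:51 " ∈ₘ " y:51 => Str.mem (Str.emb x : M) (Str.emb y)

theorem exists_image {R : S → S → Prop} (hR : ∀ x y₁ y₂, R x y₁ → R x y₂ → y₁ = y₂)
    (h : ∃ Z : M, ∀ x y : S, Str.P ↟x ↟y ε Z ↔ R x y) (a : S) :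
    ∃ b : S, ∀ y : S, y ∈ₘ b ↔ ∃ x : S, x ∈ₘ a ∧ R x y := by
  obtain ⟨Z, hZ⟩ := h
  simp only [← hZ] at hR ⊢
  exact exists_image_of_class Z hR a

/-- Replacement along the identity function restricted to `Z`. -/
theorem exists_sep (Z : M) (a : S) : ∃ b : S, ∀ y : S, y ∈ₘ b ↔ y ∈ₘ a ∧ ↟y ε Z := by
  obtain ⟨b, hb⟩ := exists_image (M := M) (R := fun x y => x = y ∧ (↟x : M) ε Z)
    (by rintro x _ _ ⟨rfl, _⟩ ⟨rfl, _⟩; rfl)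
    ⟨cl fun W => ∃ x : S, W = Str.P ↟x ↟x ∧ ↟x ε Z, fun x y => (mem_cl).trans
      ⟨by rintro ⟨z, h, hz⟩; simp only [P_inj, emb_inj] at h; obtain ⟨rfl, rfl⟩ := h; exact ⟨rfl, hz⟩,
        by rintro ⟨rfl, h⟩; exact ⟨x, rfl, h⟩⟩⟩ a
  refine ⟨b, fun y => (hb y).trans ⟨?_, ?_⟩⟩
  · rintro ⟨x, hx, rfl, h⟩; exact ⟨hx, h⟩
  · rintro ⟨h, h'⟩; exact ⟨y, h, rfl, h'⟩

theorem no_three_cycle {x y z : S} (h1 : x ∈ₘ y) (h2 : y ∈ₘ z) (h3 : z ∈ₘ x) : False := by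
  obtain ⟨w, hw, hmin⟩ := exists_minimal (M := M)
    (R := fun w => (↟w : M) = ↟x ∨ (↟w : M) = ↟y ∨ (↟w : M) = ↟z) (x := x) (.inl rfl)
  simp only [emb_inj] at hw hmin
  rcases hw with rfl | rfl | rfl
  · exact hmin z h3 (.inr (.inr rfl))
  · exact hmin x h1 (.inl rfl)
  · exact hmin y h2 (.inr (.inl rfl))

theorem no_two_cycle {x y : S} (h1 : x ∈ₘ y) (h2 : y ∈ₘ x) : False := by
  obtain ⟨w, hw, hmin⟩ := exists_minimal (M := M)
    (R := fun w => (↟w : M) = ↟x ∨ (↟w : M) = ↟y) (x := x) (.inl rfl)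
  simp only [emb_inj] at hw hmin
  rcases hw with rfl | rfl
  · exact hmin y h2 (.inr rfl)
  · exact hmin x h1 (.inl rfl)

theorem not_mem_self (x : S) : ¬ x ∈ₘ x := fun h => no_two_cycle h h

/-! ### Pairs -/

variable (M) in
/-- The unordered pair. -/
noncomputable def upair (x y : S) : S := (exists_pair (M := M) x y).choose

@[simp] theorem mem_upair {x y : S} {Z : M} : Z ε ↟(upair M x y) ↔ Z = ↟x ∨ Z = ↟y :=
  (exists_pair (M := M) x y).choose_spec Z

variable (M) in
/-- The Kuratowski pair. -/
noncomputable def kpair (x y : S) : S := upair M (upair M x x) (upair M x y)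

theorem eq_upair_iff {x y : S} {X : M} : X = ↟(upair M x y) ↔ ∀ W, W ε X ↔ W = ↟x ∨ W = ↟y := by
  constructor
  · rintro rfl; exact fun W => mem_upair
  · exact fun h => (ext_of_nonempty (mem_upair.2 (.inl rfl)) fun Z => by rw [h, mem_upair]).symm

-- On sets the primitive pair is the Kuratowski pair, so a pair of sets is itself a set and can be a
-- member of a set or occur in a code.
variable (M) in
theorem emb_kpair (x y : S) : (↟(kpair M x y) : M) = Str.P ↟x ↟y := by
  refine ext_of_nonempty (mem_upair.2 (.inl rfl)) fun Z => ?_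
  rw [mem_P_emb, kpair, mem_upair, eq_upair_iff, eq_upair_iff]
  simp

theorem kpair_inj {x y x' y' : S} : kpair M x y = kpair M x' y' ↔ x = x' ∧ y = y' := by
  rw [← emb_inj (M := M), emb_kpair, emb_kpair, P_inj, emb_inj, emb_inj]

/-! ### Natural numbers -/

variable (M) in
/-- The empty set. -/
noncomputable def zero : S := (exists_empty M).choose

theorem eq_zero_iff {w : S} : w = zero M ↔ ∀ y, ¬ y ∈ₘ w :=
  ((exists_empty M).choose_spec w).symm

theorem not_mem_zero (y : S) : ¬ y ∈ₘ zero M := eq_zero_iff.1 rfl y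

theorem exists_succ (x : S) : ∃ w : S, ∀ y, y ∈ₘ w ↔ y ∈ₘ x ∨ y = x := by
  obtain ⟨w, hw⟩ := exists_union (M := M) (upair M x (upair M x x))
  refine ⟨w, fun y => (hw y).trans ?_⟩
  simp only [mem_upair, emb_inj]
  constructor
  · rintro ⟨u, rfl | rfl, h⟩
    · exact .inl h
    · rw [mem_upair, emb_inj, or_self] at h; exact .inr h
  · rintro (h | rfl)
    · exact ⟨x, .inl rfl, h⟩
    · exact ⟨_, .inr rfl, by simp⟩

variable (M) in
/-- The successor of a set. -/
noncomputable def succ (x : S) : S := (exists_succ (M := M) x).choose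

theorem mem_succ {x y : S} : y ∈ₘ succ M x ↔ y ∈ₘ x ∨ y = x := (exists_succ x).choose_spec y

theorem eq_succ_iff {w x : S} : w = succ M x ↔ ∀ y, y ∈ₘ w ↔ y ∈ₘ x ∨ y = x :=
  ⟨by rintro rfl; exact fun y => mem_succ, fun h => ext_set (M := M) fun y => by rw [h, ← mem_succ]⟩

theorem succ_inj {x y : S} : succ M x = succ M y ↔ x = y := by
  refine ⟨fun h => ?_, by rintro rfl; rfl⟩
  have h1 : x ∈ₘ succ M y := h ▸ mem_succ.2 (.inr rfl)
  have h2 : y ∈ₘ succ M x := h ▸ mem_succ.2 (.inr rfl)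
  rcases mem_succ.1 h1 with h1 | h1
  · rcases mem_succ.1 h2 with h2 | h2
    · exact (no_two_cycle h1 h2).elim
    · exact h2.symm
  · exact h1

theorem succ_ne_zero (x : S) : succ M x ≠ zero M := fun h =>
  eq_zero_iff.1 h x (mem_succ.2 (.inr rfl))

variable (M) in
/-- The numerals. -/
noncomputable def num : ℕ → S
  | 0 => zero M
  | k + 1 => succ M (num k)

theorem num_injective : Function.Injective (num M) := by
  intro k
  induction k with
  | zero =>
    rintro (_ | l) h
    · rfl
    · exact (succ_ne_zero _ h.symm).elim
  | succ k ih =>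
    rintro (_ | l) h
    · exact (succ_ne_zero _ h).elim
    · exact congrArg _ (ih (succ_inj.1 h))

@[simp] theorem num_inj {k l : ℕ} : num M k = num M l ↔ k = l := num_injective.eq_iff

variable (M) in
/-- The class of all pairs `(x, x ∪ {x})`. -/
noncomputable def SUC : M := cl fun W => ∃ x y : S, W = Str.P ↟x ↟y ∧ ∀ z : S, z ∈ₘ y ↔ z ∈ₘ x ∨ z = x

/-- The operation `succ` is not a term of the language; inside comprehension it is expressed through
the class parameter `SUC M`. -/
theorem mem_SUC {x y : S} : Str.P ↟x ↟y ε SUC M ↔ y = succ M x := by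
  refine (mem_cl).trans ?_
  simp [P_inj, emb_inj, eq_succ_iff]

variable (M) in
/-- Inductive sets. -/
def Inductive (a : S) : Prop := zero M ∈ₘ a ∧ ∀ x, x ∈ₘ a → succ M x ∈ₘ a

variable (M) in
/-- The class of natural numbers. -/
noncomputable def NAT : M :=
  cl fun X => X ε Str.V ∧ ∀ a : S, zero M ∈ₘ a → (∀ x y : S, x ∈ₘ a → Str.P ↟x ↟y ε SUC M → y ∈ₘ a) →
    X ε ↟a

theorem mem_NAT {n : S} : ↟n ε NAT M ↔ ∀ a, Inductive M a → n ∈ₘ a := by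
  refine (mem_cl).trans ?_
  simp [mem_SUC, Inductive, mem_V, emb_inj]

variable (M) in
theorem exists_omega : ∃ w : S, ∀ n, n ∈ₘ w ↔ ↟n ε NAT M := by
  obtain ⟨a, ⟨z, hz, hz'⟩, ha⟩ := exists_inductive M
  have ha' : Inductive M a := by
    refine ⟨eq_zero_iff.2 hz' ▸ hz, fun x hx => ?_⟩
    obtain ⟨w, hw, hw'⟩ := ha x hx
    rwa [eq_succ_iff.2 hw] at hw'
  obtain ⟨w, hw⟩ := exists_sep (NAT M) a
  exact ⟨w, fun n => (hw n).trans ⟨And.right, fun h => ⟨mem_NAT.1 h a ha', h⟩⟩⟩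

theorem zero_mem_NAT : ↟(zero M) ε NAT M := mem_NAT.2 fun _ h => h.1

theorem succ_mem_NAT {n : S} (h : ↟n ε NAT M) : ↟(succ M n) ε NAT M :=
  mem_NAT.2 fun a ha => ha.2 _ (mem_NAT.1 h a ha)

/-- The natural numbers in `Z` form a set by separation, and this set is inductive. -/
theorem nat_induction_of_class {Z : M} (h0 : ↟(zero M) ε Z)
    (h : ∀ n, ↟n ε NAT M → ↟n ε Z → ↟(succ M n) ε Z) {n : S} (hn : ↟n ε NAT M) : ↟n ε Z := by
  obtain ⟨w, hw⟩ := exists_omega M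
  obtain ⟨b, hb⟩ := exists_sep Z w
  refine ((hb n).1 (mem_NAT.1 hn b ⟨(hb _).2 ⟨(hw _).2 zero_mem_NAT, h0⟩, fun x hx => ?_⟩)).2
  obtain ⟨h1, h2⟩ := (hb x).1 hx
  rw [hw] at h1
  exact (hb _).2 ⟨(hw _).2 (succ_mem_NAT h1), h x h1 h2⟩

theorem nat_cases {n : S} (hn : ↟n ε NAT M) : n = zero M ∨ ∃ m, ↟m ε NAT M ∧ n = succ M m := by
  have := nat_induction_of_class
    (Z := cl fun X => X = ↟(zero M) ∨ ∃ m y : S, ↟m ε NAT M ∧ Str.P ↟m ↟y ε SUC M ∧ X = ↟y)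
    ((mem_cl).2 (.inl rfl)) (fun m hm _ => (mem_cl).2 (.inr ⟨m, _, hm, mem_SUC.2 rfl, rfl⟩)) hn
  replace this := (mem_cl).1 this
  simpa [mem_SUC, emb_inj] using this

/-! ### Ordinals -/

variable (M) in
/-- Von Neumann ordinals. -/
def Ord (x : S) : Prop :=
  (∀ y, y ∈ₘ x → ∀ z, z ∈ₘ y → z ∈ₘ x) ∧ ∀ y z, y ∈ₘ x → z ∈ₘ x → y ∈ₘ z ∨ y = z ∨ z ∈ₘ y

variable (M) in
/-- The class of ordinals. -/
noncomputable def ORD : M := cl fun X => ∃ x : S, X = ↟x ∧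
  (∀ y, y ∈ₘ x → ∀ z, z ∈ₘ y → z ∈ₘ x) ∧ ∀ y z, y ∈ₘ x → z ∈ₘ x → y ∈ₘ z ∨ y = z ∨ z ∈ₘ y

theorem mem_ORD {x : S} : ↟x ε ORD M ↔ Ord M x := by
  refine (mem_cl).trans ?_
  simp [Ord, emb_inj]

theorem Ord.mem {x y : S} (hx : Ord M x) (hy : y ∈ₘ x) : Ord M y := by
  refine ⟨fun w hw z hz => ?_, fun w z hw hz => hx.2 w z (hx.1 y hy w hw) (hx.1 y hy z hz)⟩
  have hw' := hx.1 y hy w hw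
  rcases hx.2 z y (hx.1 w hw' z hz) hy with h | h | h
  · exact h
  · subst h; exact (no_two_cycle hz hw).elim
  · exact (no_three_cycle hz hw h).elim

/-- A membership-minimal element of `x` outside `y` has exactly the members of `y`. -/
theorem Ord.mem_of_subset {x y : S} (hx : Ord M x) (hy : ∀ w, w ∈ₘ y → ∀ z, z ∈ₘ w → z ∈ₘ y)
    (h : ∀ z, z ∈ₘ y → z ∈ₘ x) (hne : y ≠ x) : y ∈ₘ x := by
  have : ∃ z, z ∈ₘ x ∧ ¬ z ∈ₘ y := by
    by_contra! h'
    exact hne (ext_set (M := M) fun z => ⟨h z, h' z⟩)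
  obtain ⟨z, hz⟩ := this
  obtain ⟨d, ⟨hd, hdy⟩, hmin⟩ := exists_minimal (M := M) (R := fun z => z ∈ₘ x ∧ ¬ z ∈ₘ y) hz
  have : y = d := ext_set (M := M) fun w => by
    constructor
    · intro hw
      rcases hx.2 w d (h w hw) hd with h1 | h1 | h1
      · exact h1
      · exact (hdy (h1 ▸ hw)).elim
      · exact (hdy (hy w hw d h1)).elim
    · intro hw
      by_contra hwy
      exact hmin w hw ⟨hx.1 d hd w hw, hwy⟩
  exact this ▸ hd

/-- The intersection of `x` and `y` is transitive. If it differed from both, it would be a member of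
both by `Ord.mem_of_subset`, hence a member of itself. -/
theorem Ord.trichotomy {x y : S} (hx : Ord M x) (hy : Ord M y) : x ∈ₘ y ∨ x = y ∨ y ∈ₘ x := by
  obtain ⟨w, hw⟩ := exists_sep (M := M) ↟y x
  have hwt : ∀ z, z ∈ₘ w → ∀ u, u ∈ₘ z → u ∈ₘ w := fun z hz u hu => by
    rw [hw] at hz ⊢
    exact ⟨hx.1 z hz.1 u hu, hy.1 z hz.2 u hu⟩
  by_cases h1 : w = x
  · by_cases h2 : w = y
    · exact .inr (.inl (h1.symm.trans h2))
    · exact .inl (h1 ▸ hy.mem_of_subset hwt (fun z hz => ((hw z).1 hz).2) h2)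
  · have h3 := hx.mem_of_subset hwt (fun z hz => ((hw z).1 hz).1) h1
    by_cases h2 : w = y
    · exact .inr (.inr (h2 ▸ h3))
    · have h4 := hy.mem_of_subset hwt (fun z hz => ((hw z).1 hz).2) h2
      exact (not_mem_self _ ((hw w).2 ⟨h3, h4⟩)).elim

theorem Ord.of_forall_mem {x : S} (ht : ∀ y, y ∈ₘ x → ∀ z, z ∈ₘ y → z ∈ₘ x)
    (h : ∀ y, y ∈ₘ x → Ord M y) : Ord M x :=
  ⟨ht, fun y z hy hz => (h y hy).trichotomy (h z hz)⟩

theorem Ord.succ {x : S} (hx : Ord M x) : Ord M (succ M x) := by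
  refine .of_forall_mem (fun y hy z hz => ?_) fun y hy => ?_
  · rw [mem_succ] at hy ⊢
    rcases hy with hy | rfl
    · exact .inl (hx.1 y hy z hz)
    · exact .inl hz
  · rcases mem_succ.1 hy with hy | rfl
    · exact hx.mem hy
    · exact hx

/-- No set contains all ordinals. -/
theorem exists_ord_not_mem (a : S) : ∃ x, Ord M x ∧ ¬ x ∈ₘ a := by
  by_contra! h
  obtain ⟨b, hb⟩ := exists_sep (ORD M) a
  simp only [mem_ORD] at hb
  -- Burali-Forti: the ordinals in `a` would form an ordinal that belongs to itself.
  have : Ord M b := .of_forall_mem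
    (fun y hy z hz => (hb z).2 (by
      have := ((hb y).1 hy).2.mem hz
      exact ⟨h z this, this⟩)) fun y hy => ((hb y).1 hy).2
  exact not_mem_self b ((hb b).2 ⟨h b this, this⟩)

/-- Every set of ordinals is bounded. -/
theorem exists_ord_bound (a : S) : ∃ b, Ord M b ∧ ∀ x, x ∈ₘ a → Ord M x → x ∈ₘ b := by
  obtain ⟨a', ha'⟩ := exists_sep (ORD M) a
  obtain ⟨u, hu⟩ := exists_union (M := M) a'
  simp only [mem_ORD] at ha'
  have hu' : Ord M u := .of_forall_mem (fun y hy z hz => by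
      obtain ⟨x, hx, hy⟩ := (hu y).1 hy
      exact (hu z).2 ⟨x, hx, ((ha' x).1 hx).2.1 y hy z hz⟩) fun y hy => by
      obtain ⟨x, hx, hy⟩ := (hu y).1 hy
      exact ((ha' x).1 hx).2.mem hy
  refine ⟨_, hu'.succ, fun x hx hx' => ?_⟩
  rcases hx'.trichotomy hu' with h | h | h
  · exact mem_succ.2 (.inl h)
  · exact mem_succ.2 (.inr h)
  · exact (not_mem_self u ((hu u).2 ⟨x, (ha' x).2 ⟨hx, hx'⟩, h⟩)).elim

theorem nat_ord {n : S} (hn : ↟n ε NAT M) : Ord M n ∧ ∀ y : S, y ∈ₘ n → ↟y ε NAT M := by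
  have h0 : ↟(zero M) ε cl fun X : M => X ε ORD M ∧ ∀ y : S, ↟y ε X → ↟y ε NAT M :=
    (mem_cl).2 ⟨mem_ORD.2 (.of_forall_mem (fun y hy => (not_mem_zero y hy).elim)
      fun y hy => (not_mem_zero y hy).elim), fun y hy => (not_mem_zero y hy).elim⟩
  have h1 := nat_induction_of_class h0 (fun n hn h => ?_) hn
  · exact ((mem_cl).1 h1).imp mem_ORD.1 id
  · replace h := (mem_cl).1 h
    refine (mem_cl).2 ⟨mem_ORD.2 (mem_ORD.1 h.1).succ, fun y hy => ?_⟩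
    rcases mem_succ.1 hy with hy | rfl
    · exact h.2 y hy
    · exact hn

variable (M) in
/-- There is a limit ordinal. -/
theorem exists_limit : ∃ w : S, Ord M w ∧ (∃ x, x ∈ₘ w) ∧ ∀ x, x ∈ₘ w → succ M x ∈ₘ w := by
  obtain ⟨w, hw⟩ := exists_omega M
  refine ⟨w, .of_forall_mem (fun y hy z hz => ?_) fun y hy => ?_, ⟨_, (hw _).2 zero_mem_NAT⟩,
    fun x hx => (hw _).2 (succ_mem_NAT ((hw x).1 hx))⟩
  · exact (hw z).2 ((nat_ord ((hw y).1 hy)).2 z hz)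
  · exact (nat_ord ((hw y).1 hy)).1

end SModel

namespace SModel

variable {M S : Type} [SModel M S]

local notation:50 x:51 " ∈ₘ " y:51 => Str.mem (Str.emb x : M) (Str.emb y)

/-! ## A cumulative hierarchy of classes over the class of all sets -/

/-- Monotone definable operators on classes have fixed points. -/
theorem exists_fixpoint {Φ : M → M → Prop}
    (mono : ∀ Z Z', (∀ Y, Y ε Z → Y ε Z') → ∀ Y, Φ Z Y → Φ Z' Y)
    (h1 : ∀ Z, ∃ Z', ∀ Y, Y ε Z' ↔ Φ Z Y)
    (h2 : ∃ I, ∀ X, X ε I ↔ ∀ Z, (∀ Y, Φ Z Y → Y ε Z) → X ε Z) : ∃ I, ∀ X, X ε I ↔ Φ I X := by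
  obtain ⟨I, hI⟩ := h2
  have h3 : ∀ X, Φ I X → X ε I := fun X hX => (hI X).2 fun Z hZ =>
    hZ X (mono I Z (fun Y hY => (hI Y).1 hY Z hZ) X hX)
  refine ⟨I, fun X => ⟨fun hX => ?_, h3 X⟩⟩
  -- The image of `I` under the operator is closed under the operator by monotonicity, so the least
  -- closed class `I` lies inside it.
  obtain ⟨I', hI'⟩ := h1 I
  exact (hI' X).1 ((hI X).1 hX I' fun Y hY => (hI' Y).2
    (mono I' I (fun W hW => h3 W ((hI' W).1 hW)) Y hY))

variable (M) in
/-- The copy of a set in the hierarchy. -/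
noncomputable def base (x : S) : M := Str.P ↟(zero M) ↟x

theorem base_inj {x y : S} : base M x = base M y ↔ x = y := by simp [base, P_inj, emb_inj]

variable (M) in
/-- The lowest level. -/
noncomputable def baseD : M := cl fun X => ∃ x : S, X = Str.P ↟(zero M) ↟x

variable (M) in
/-- The membership relation on the lowest level. -/
noncomputable def baseE : M := cl fun W => ∃ x y : S, x ∈ₘ y ∧
  W = Str.P (Str.P ↟(zero M) ↟x) (Str.P ↟(zero M) ↟y)

theorem mem_baseD {X : M} : X ε baseD M ↔ ∃ x, X = base M x := mem_cl

theorem mem_baseE {a b : M} :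
    Str.P a b ε baseE M ↔ ∃ x y : S, x ∈ₘ y ∧ a = base M x ∧ b = base M y := by
  refine (mem_cl).trans ?_
  simp only [P_inj, base]

/-- `D'` with the relation `E'` adds to `D` with the relation `E` all subclasses of `D`; the new
elements are marked by `m`. -/
structure IsExtension (m : S) (D E D' E' : M) : Prop where
  subset : ∀ a, a ε D → a ε D'
  agree : ∀ a b, b ε D → (Str.P a b ε E' ↔ Str.P a b ε E)
  mem : ∀ a b, Str.P a b ε E' → a ε D ∧ b ε D'
  full : ∀ X, (∀ a, a ε X → a ε D) → ∃ b, b ε D' ∧ ∀ a, a ε X ↔ Str.P a b ε E'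
  ext : ∀ b b', b ε D' → b' ε D' → (∀ a, Str.P a b ε E' ↔ Str.P a b' ε E') → b = b'
  mark : ∀ b, b ε D' → b ε D ∨ ∃ Y, b = Str.P ↟m Y

variable (M) in
/-- The class of all extensions. -/
noncomputable def EXT : M := cl fun W => ∃ m : S, ∃ D E D' E',
  W = Str.P ↟m (Str.P (Str.P D E) (Str.P D' E')) ∧
  (∀ a, a ε D → a ε D') ∧
  (∀ a b, b ε D → (Str.P a b ε E' ↔ Str.P a b ε E)) ∧
  (∀ a b, Str.P a b ε E' → a ε D ∧ b ε D') ∧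
  (∀ X, (∀ a, a ε X → a ε D) → ∃ b, b ε D' ∧ ∀ a, a ε X ↔ Str.P a b ε E') ∧
  (∀ b b', b ε D' → b' ε D' → (∀ a, Str.P a b ε E' ↔ Str.P a b' ε E') → b = b') ∧
  (∀ b, b ε D' → b ε D ∨ ∃ Y, b = Str.P ↟m Y)

theorem mem_EXT {m : S} {Q Q' : M} : Str.P ↟m (Str.P Q Q') ε EXT M ↔
    ∃ D E D' E', Q = Str.P D E ∧ Q' = Str.P D' E' ∧ IsExtension m D E D' E' := by
  refine (mem_cl).trans ?_
  simp only [P_inj, emb_inj]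
  constructor
  · rintro ⟨m, D, E, D', E', ⟨rfl, rfl, rfl⟩, h1, h2, h3, h4, h5, h6⟩
    exact ⟨D, E, D', E', rfl, rfl, h1, h2, h3, h4, h5, h6⟩
  · rintro ⟨D, E, D', E', rfl, rfl, h1, h2, h3, h4, h5, h6⟩
    exact ⟨m, D, E, D', E', ⟨rfl, rfl, rfl⟩, h1, h2, h3, h4, h5, h6⟩

variable (M) in
/-- A universal choice function. -/
noncomputable def CHO : M := (exists_choice M).choose

theorem choice_unique {X Y₁ Y₂ : M} (h₁ : Str.P X Y₁ ε CHO M) (h₂ : Str.P X Y₂ ε CHO M) : Y₁ = Y₂ :=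
  (exists_choice M).choose_spec.1 X Y₁ Y₂ h₁ h₂

theorem choice_exists {X Z : M} (h : Z ε X) :
    ∃ Y, Y ε X ∧ ∃ W, (∀ Z, Z ε W ↔ Z = Y) ∧ Str.P X W ε CHO M :=
  (exists_choice M).choose_spec.2 X Z h

variable (M) in
/-- The class of all `(m, Q, Q')` where `Q'` is the chosen extension of `Q`. -/
noncomputable def NXT : M := cl fun U => ∃ m : S, ∃ Q Q', U = Str.P ↟m (Str.P Q Q') ∧
  ∃ G W, (∀ Q'', Q'' ε G ↔ Str.P ↟m (Str.P Q Q'') ε EXT M) ∧ (∀ Z, Z ε W ↔ Z = Q') ∧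
    Str.P G W ε CHO M ∧ Q' ε G

theorem mem_NXT {m : S} {Q Q' : M} : Str.P ↟m (Str.P Q Q') ε NXT M ↔
    ∃ G W, (∀ Q'', Q'' ε G ↔ Str.P ↟m (Str.P Q Q'') ε EXT M) ∧ (∀ Z, Z ε W ↔ Z = Q') ∧
    Str.P G W ε CHO M ∧ Q' ε G := by
  refine (mem_cl).trans ?_
  simp only [P_inj, emb_inj]
  constructor
  · rintro ⟨m, Q, Q', ⟨rfl, rfl, rfl⟩, h⟩; exact h
  · exact fun h => ⟨m, Q, Q', ⟨rfl, rfl, rfl⟩, h⟩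

theorem NXT_EXT {m : S} {Q Q' : M} (h : Str.P ↟m (Str.P Q Q') ε NXT M) :
    Str.P ↟m (Str.P Q Q') ε EXT M := by
  obtain ⟨G, W, h1, -, -, h4⟩ := mem_NXT.1 h
  exact (h1 _).1 h4

/-- The class `G` of all extensions is determined by `m` and `Q` because it is nonempty;
extensionality would not identify memberless classes. Choice gives the singleton of the selected
member, which keeps the relation stratified. -/
theorem NXT_unique {m : S} {Q Q₁ Q₂ : M} (h₁ : Str.P ↟m (Str.P Q Q₁) ε NXT M)
    (h₂ : Str.P ↟m (Str.P Q Q₂) ε NXT M) : Q₁ = Q₂ := by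
  obtain ⟨G, W, h1, h2, h3, h4⟩ := mem_NXT.1 h₁
  obtain ⟨G', W', h1', h2', h3', h4'⟩ := mem_NXT.1 h₂
  obtain rfl : G = G' := ext_of_nonempty h4 fun Z => by rw [h1, h1']
  obtain rfl := choice_unique h3 h3'
  exact (h2' Q₁).1 ((h2 Q₁).2 rfl)

theorem NXT_exists {m : S} {Q Q' : M} (h : Str.P ↟m (Str.P Q Q') ε EXT M) :
    ∃ Q', Str.P ↟m (Str.P Q Q') ε NXT M := by
  have hG : ∀ Q'', Q'' ε cl (fun Q'' => Str.P ↟m (Str.P Q Q'') ε EXT M) ↔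
    Str.P ↟m (Str.P Q Q'') ε EXT M := fun _ => mem_cl
  obtain ⟨Y, h1, W, h2, h3⟩ := choice_exists ((hG _).2 h)
  exact ⟨Y, mem_NXT.2 ⟨_, W, hG, h2, h3, h1⟩⟩

-- The recursion on natural numbers as a fixed point. It is stratified since old and new stage enter
-- `NXT M` at one type and the numbers are sets.
variable (M) in
theorem exists_stages : ∃ I : M, ∀ X, X ε I ↔ X = Str.P ↟(zero M) (Str.P (baseD M) (baseE M)) ∨
    ∃ m m' : S, ∃ Q Q', Str.P ↟m Q ε I ∧ Str.P ↟m ↟m' ε SUC M ∧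
      Str.P ↟m' (Str.P Q Q') ε NXT M ∧ X = Str.P ↟m' Q' := by
  refine exists_fixpoint (Φ := fun I X => X = Str.P ↟(zero M) (Str.P (baseD M) (baseE M)) ∨
    ∃ m m' : S, ∃ Q Q', Str.P ↟m Q ε I ∧ Str.P ↟m ↟m' ε SUC M ∧
      Str.P ↟m' (Str.P Q Q') ε NXT M ∧ X = Str.P ↟m' Q') ?_ ?_ ?_
  · rintro Z Z' h Y (h1 | ⟨m, m', Q, Q', h1, h2⟩)
    · exact .inl h1
    · exact .inr ⟨m, m', Q, Q', h _ h1, h2⟩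
  · exact fun Z => ⟨cl _, fun Y => mem_cl⟩
  · exact ⟨cl _, fun Y => mem_cl⟩

variable (M) in
/-- The class of all pairs of a natural number and the corresponding stage. -/
noncomputable def STG : M := (exists_stages M).choose

theorem mem_STG {X : M} : X ε STG M ↔ X = Str.P ↟(zero M) (Str.P (baseD M) (baseE M)) ∨
    ∃ m m' : S, ∃ Q Q', Str.P ↟m Q ε STG M ∧ Str.P ↟m ↟m' ε SUC M ∧
      Str.P ↟m' (Str.P Q Q') ε NXT M ∧ X = Str.P ↟m' Q' :=
  (exists_stages M).choose_spec X

theorem mem_STG_zero {Q : M} : Str.P ↟(zero M) Q ε STG M ↔ Q = Str.P (baseD M) (baseE M) := by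
  refine mem_STG.trans ?_
  simp only [P_inj, emb_inj, true_and, mem_SUC]
  constructor
  · rintro (h | ⟨m, m', Q, Q', -, rfl, -, h, -⟩)
    · exact h
    · exact (succ_ne_zero _ h.symm).elim
  · exact .inl

theorem mem_STG_succ {n : S} {Q' : M} : Str.P ↟(succ M n) Q' ε STG M ↔
    ∃ Q, Str.P ↟n Q ε STG M ∧ Str.P ↟(succ M n) (Str.P Q Q') ε NXT M := by
  refine mem_STG.trans ?_
  simp only [P_inj, emb_inj, mem_SUC]
  constructor
  · rintro (⟨h, -⟩ | ⟨m, m', Q, Q', h1, rfl, h2, h, rfl⟩)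
    · exact (succ_ne_zero _ h).elim
    · obtain rfl := succ_inj.1 h
      exact ⟨Q, h1, h2⟩
  · rintro ⟨Q, h1, h2⟩
    exact .inr ⟨n, _, Q, Q', h1, rfl, h2, rfl, rfl⟩

/-- The properties of the stages that are proved by induction.  The last one says that the stage is
strongly Cantorian. -/
structure IsStage (n : S) (D E K : M) : Prop where
  mem : ∀ a b, Str.P a b ε E → a ε D ∧ b ε D
  ext : ∀ b b', b ε D → b' ε D → (∀ a, Str.P a b ε E ↔ Str.P a b' ε E) → b = b'
  empty : ∃ b, b ε D ∧ ∀ a, ¬ Str.P a b ε E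
  mark : ∀ b, b ε D → ∃ (j : S) (Y : M), b = Str.P ↟j Y ∧ j ∈ₘ succ M n
  cantor : ∀ W d, Str.P W d ε K ↔ d ε D ∧ ∀ Z, Z ε W ↔ Z = d

-- In the definition of `K` the set variable `x` occurs at two adjacent types, which is allowed for
-- set variables; this makes the singleton map on the copy of `V` a class.
variable (M) in
theorem isStage_base : ∃ K, IsStage (zero M) (baseD M) (baseE M) K := by
  refine ⟨cl fun U => ∃ x : S, ∃ W Y, U = Str.P W (Str.P ↟(zero M) ↟x) ∧ (∀ Z, Z ε W ↔ Z = Y) ∧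
    Y = Str.P ↟(zero M) ↟x, ?_, ?_, ?_, ?_, ?_⟩
  · intro a b h
    obtain ⟨x, y, -, rfl, rfl⟩ := mem_baseE.1 h
    exact ⟨mem_baseD.2 ⟨x, rfl⟩, mem_baseD.2 ⟨y, rfl⟩⟩
  · intro b b' hb hb' h
    obtain ⟨x, rfl⟩ := mem_baseD.1 hb
    obtain ⟨y, rfl⟩ := mem_baseD.1 hb'
    rw [base_inj]
    refine ext_set (M := M) fun z => ?_
    have := h (base M z)
    simp only [mem_baseE, base_inj] at this
    simpa using this
  · refine ⟨base M (zero M), mem_baseD.2 ⟨_, rfl⟩, fun a h => ?_⟩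
    obtain ⟨x, y, h, -, h'⟩ := mem_baseE.1 h
    rw [base_inj] at h'
    exact not_mem_zero (M := M) x (h' ▸ h)
  · intro b hb
    obtain ⟨x, rfl⟩ := mem_baseD.1 hb
    exact ⟨_, _, rfl, mem_succ.2 (.inr rfl)⟩
  · intro W d
    refine (mem_cl).trans ?_
    simp only [P_inj, mem_baseD]
    constructor
    · rintro ⟨x, W, Y, ⟨rfl, rfl⟩, h, rfl⟩; exact ⟨⟨x, rfl⟩, h⟩
    · rintro ⟨⟨x, rfl⟩, h⟩; exact ⟨x, W, _, ⟨rfl, rfl⟩, h, rfl⟩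

/-- A subclass of `D` that already is the extension of an element of `D` gets no new code. Any other
subclass `X` is coded by the pair of `succ M n` and `X`. -/
theorem IsStage.exists_isExtension {n : S} {D E K : M} (h : IsStage n D E K) :
    ∃ D' E', IsExtension (succ M n) D E D' E' := by
  let New : M → Prop := fun X => (∀ a, a ε X → a ε D) ∧ ∀ x, x ε D → ¬ ∀ a, a ε X ↔ Str.P a x ε E
  let D' : M := cl fun b => b ε D ∨ ∃ X, b = Str.P ↟(succ M n) X ∧
    (∀ a, a ε X → a ε D) ∧ ∀ x, x ε D → ¬ ∀ a, a ε X ↔ Str.P a x ε E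
  -- Here `a` and `X` have the same type, so `a ∈ X` is not stratified. It is expressed by `c ∈ X`
  -- and `({c}, a) ∈ K`, which forces `a = c`.
  let E' : M := cl fun W => W ε E ∨ ∃ a X, W = Str.P a (Str.P ↟(succ M n) X) ∧
    ((∀ a, a ε X → a ε D) ∧ ∀ x, x ε D → ¬ ∀ a, a ε X ↔ Str.P a x ε E) ∧
    ∃ c s, c ε X ∧ (∀ Z, Z ε s ↔ Z = c) ∧ Str.P s a ε K
  have hD' : ∀ b, b ε D' ↔ b ε D ∨ ∃ X, b = Str.P ↟(succ M n) X ∧ New X := fun b => mem_cl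
  have hE' : ∀ a b, Str.P a b ε E' ↔ Str.P a b ε E ∨
      ∃ X, b = Str.P ↟(succ M n) X ∧ New X ∧ a ε X := by
    intro a b
    refine (mem_cl).trans (or_congr_right ?_)
    simp only [P_inj]
    constructor
    · rintro ⟨a, X, ⟨rfl, rfl⟩, hX, c, s, hc, hs, hK⟩
      refine ⟨X, rfl, hX, ?_⟩
      have := ((h.cantor s a).1 hK).2 c
      rw [hs] at this
      exact this.1 rfl ▸ hc
    · rintro ⟨X, rfl, hX, ha⟩
      have hs : ∀ Z, Z ε cl (fun Z => Z = a) ↔ Z = a := fun Z => mem_cl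
      exact ⟨a, X, ⟨rfl, rfl⟩, hX, a, _, ha, hs, (h.cantor _ _).2 ⟨hX.1 a ha, hs⟩⟩
  -- Marks used up to stage `n` are members of `succ M n`, which is not a member of itself.
  have hfresh : ∀ X, ¬ Str.P ↟(succ M n) X ε D := by
    intro X hX
    obtain ⟨j, Y, h1, h2⟩ := h.mark _ hX
    rw [P_inj, emb_inj] at h1
    rw [← h1.1] at h2
    exact not_mem_self _ h2
  have hagree : ∀ a b, b ε D → (Str.P a b ε E' ↔ Str.P a b ε E) := by
    intro a b hb
    rw [hE', or_iff_left]
    rintro ⟨X, rfl, -⟩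
    exact hfresh X hb
  have hnew : ∀ a X, New X → (Str.P a (Str.P ↟(succ M n) X) ε E' ↔ a ε X) := by
    intro a X hX
    rw [hE']
    constructor
    · rintro (h1 | ⟨Y, h1, -, h2⟩)
      · exact (hfresh X (h.mem _ _ h1).2).elim
      · rw [P_inj] at h1; exact h1.2 ▸ h2
    · exact fun ha => .inr ⟨X, rfl, hX, ha⟩
  refine ⟨D', E', fun a ha => (hD' a).2 (.inl ha), hagree, ?_, ?_, ?_, ?_⟩
  · intro a b hab
    rcases (hE' a b).1 hab with h1 | ⟨X, rfl, h1, h2⟩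
    · exact ⟨(h.mem _ _ h1).1, (hD' b).2 (.inl (h.mem _ _ h1).2)⟩
    · exact ⟨h1.1 a h2, (hD' _).2 (.inr ⟨X, rfl, h1⟩)⟩
  · intro X hX
    by_cases hN : New X
    · exact ⟨_, (hD' _).2 (.inr ⟨X, rfl, hN⟩), fun a => (hnew a X hN).symm⟩
    · have : ∃ x, x ε D ∧ ∀ a, a ε X ↔ Str.P a x ε E := by
        by_contra! hx
        exact hN ⟨hX, fun x hxD h1 => (hx x hxD).elim fun a ha => by have := h1 a; tauto⟩
      obtain ⟨x, hx, hx'⟩ := this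
      exact ⟨x, (hD' x).2 (.inl hx), fun a => (hx' a).trans (hagree a x hx).symm⟩
  · have key : ∀ b X, b ε D → New X → ¬ ∀ a, Str.P a b ε E' ↔ Str.P a (Str.P ↟(succ M n) X) ε E' := by
      intro b X hb hX h1
      exact hX.2 b hb fun a => by rw [← hnew a X hX, ← h1, hagree a b hb]
    intro b b' hb hb' h1
    rcases (hD' b).1 hb with h2 | ⟨X, rfl, h2⟩ <;> rcases (hD' b').1 hb' with h3 | ⟨X', rfl, h3⟩
    · exact h.ext b b' h2 h3 fun a => by rw [← hagree a b h2, h1, hagree a b' h3]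
    · exact (key _ _ h2 h3 h1).elim
    · exact (key _ _ h3 h2 fun a => (h1 a).symm).elim
    · have h4 : ∀ a, a ε X ↔ a ε X' := fun a => by rw [← hnew a X h2, h1, hnew a X' h3]
      by_cases h5 : ∃ a, a ε X
      · obtain ⟨a, ha⟩ := h5
        rw [ext_of_nonempty ha h4]
      -- There may be many memberless classes, but none is new: all are coded by the empty element
      -- of `D`.
      · obtain ⟨e, he, he'⟩ := h.empty
        exact (h2.2 e he fun a => iff_of_false (fun ha => h5 ⟨a, ha⟩) (he' a)).elim
  · intro b hb
    exact ((hD' b).1 hb).imp id fun ⟨X, hX, _⟩ => ⟨X, hX⟩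

/-- To pair `{b}` with `b` in a stratified way, compare `b` with a copy `b'` one type higher: they
agree when their members correspond under the old singleton map `K`. Members lie in `D`, where `K`
is total, so extensionality gives `b = b'`. -/
theorem IsStage.of_isExtension {n : S} {D E K D' E' : M} (h : IsStage n D E K)
    (h' : IsExtension (succ M n) D E D' E') : ∃ K', IsStage (succ M n) D' E' K' := by
  refine ⟨cl fun U => ∃ W b b', U = Str.P W b' ∧ (∀ Z, Z ε W ↔ Z = b) ∧ b ε D' ∧ b' ε D' ∧
    ∀ c s d, (∀ Z, Z ε s ↔ Z = c) → Str.P s d ε K → (Str.P c b ε E' ↔ Str.P d b' ε E'),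
    fun a b hab => ⟨h'.subset a (h'.mem a b hab).1, (h'.mem a b hab).2⟩, h'.ext, ?_, ?_, ?_⟩
  · obtain ⟨e, he, he'⟩ := h.empty
    exact ⟨e, h'.subset e he, fun a => by rw [h'.agree a e he]; exact he' a⟩
  · intro b hb
    rcases h'.mark b hb with hb | ⟨Y, rfl⟩
    · obtain ⟨j, Y, rfl, hj⟩ := h.mark b hb
      exact ⟨j, Y, rfl, mem_succ.2 (.inl hj)⟩
    · exact ⟨_, Y, rfl, mem_succ.2 (.inr rfl)⟩
  · intro W d
    refine (mem_cl).trans ?_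
    simp only [P_inj]
    constructor
    · rintro ⟨W, b, b', ⟨rfl, rfl⟩, hW, hb, hb', h1⟩
      have : b = d := h'.ext b d hb hb' fun a => by
        by_cases ha : a ε D
        · have hs : ∀ Z, Z ε cl (fun Z => Z = a) ↔ Z = a := fun Z => mem_cl
          exact h1 a _ a hs ((h.cantor _ _).2 ⟨ha, hs⟩)
        · exact iff_of_false (fun h2 => ha (h'.mem _ _ h2).1) fun h2 => ha (h'.mem _ _ h2).1
      subst this
      exact ⟨hb, hW⟩
    · rintro ⟨hd, hW⟩
      refine ⟨W, d, d, ⟨rfl, rfl⟩, hW, hd, hd, fun c s e hs hK => ?_⟩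
      have := ((h.cantor _ _).1 hK).2 c
      rw [hs] at this
      rw [this.1 rfl]

/-- A minimal number without a unique well-behaved stage is not `0`, by `isStage_base`, and not a
successor: the preceding stage has an extension, and the one selected by `NXT M` is unique and again
well-behaved. -/
theorem exists_stage {n : S} (hn : ↟n ε NAT M) : ∃ D E : M, Str.P ↟n (Str.P D E) ε STG M ∧
    (∀ Q, Str.P ↟n Q ε STG M → Q = Str.P D E) ∧ ∃ K, IsStage n D E K := by
  by_contra hne
  let R : S → Prop := fun n => ↟n ε NAT M ∧ ¬ ∃ D E : M, Str.P ↟n (Str.P D E) ε STG M ∧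
    (∀ Q, Str.P ↟n Q ε STG M → Q = Str.P D E) ∧ ∃ K,
    (∀ a b, Str.P a b ε E → a ε D ∧ b ε D) ∧
    (∀ b b', b ε D → b' ε D → (∀ a, Str.P a b ε E ↔ Str.P a b' ε E) → b = b') ∧
    (∃ b, b ε D ∧ ∀ a, ¬ Str.P a b ε E) ∧
    (∀ b, b ε D → ∃ (j : S) (Y : M), b = Str.P ↟j Y ∧ ∃ k : S, Str.P ↟n ↟k ε SUC M ∧ j ∈ₘ k) ∧
    (∀ W d, Str.P W d ε K ↔ d ε D ∧ ∀ Z, Z ε W ↔ Z = d)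
  have hR : ∀ n, R n ↔ ↟n ε NAT M ∧ ¬ ∃ D E : M, Str.P ↟n (Str.P D E) ε STG M ∧
    (∀ Q, Str.P ↟n Q ε STG M → Q = Str.P D E) ∧ ∃ K, IsStage n D E K := by
    intro n
    refine and_congr_right fun _ => not_congr (exists_congr fun D => exists_congr fun E =>
      and_congr_right fun _ => and_congr_right fun _ => exists_congr fun K => ?_)
    simp only [mem_SUC, exists_eq_left]
    exact ⟨fun ⟨h1, h2, h3, h4, h5⟩ => ⟨h1, h2, h3, h4, h5⟩, fun h => ⟨h.1, h.2, h.3, h.4, h.5⟩⟩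
  -- The clause on singletons uses `d` at two types, so `R` is unstratified and the foundation
  -- scheme is applied to an arbitrary formula; the type annotations `0` below have no significance.
  obtain ⟨k, hk, hmin⟩ := exists_minimal_of_dfn (M := M) (R := R) (x := n) (by
    repeat' first
      | apply Dfn.and | apply Dfn.or | apply Dfn.iff | apply Dfn.not | apply Dfn.allS
      | apply Dfn.exS | apply Dfn.exC 0 | apply Dfn.allC 0 | apply Dfn.mem (n := 0)
      | apply Dfn.eq (n := 0) | apply Dfn.imp | apply Trm.const | apply Trm.var_false
      | apply Trm.set | apply TrmS.const | apply TrmS.var | apply Trm.P) ((hR n).2 ⟨hn, hne⟩)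
  rw [hR] at hk
  refine hk.2 ?_
  rcases nat_cases hk.1 with rfl | ⟨m, hm, rfl⟩
  · exact ⟨_, _, mem_STG_zero.2 rfl, fun Q hQ => mem_STG_zero.1 hQ, isStage_base M⟩
  · have := hmin m (mem_succ.2 (.inr rfl))
    rw [hR, not_and, not_not] at this
    obtain ⟨D, E, h1, h2, K, h3⟩ := this hm
    obtain ⟨D', E', h4⟩ := h3.exists_isExtension
    obtain ⟨Q, hQ⟩ := NXT_exists (mem_EXT.2 ⟨D, E, D', E', rfl, rfl, h4⟩)
    obtain ⟨D₁, E₁, D₂, E₂, h5, rfl, h6⟩ := mem_EXT.1 (NXT_EXT hQ)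
    rw [P_inj] at h5
    obtain ⟨rfl, rfl⟩ := h5
    refine ⟨D₂, E₂, mem_STG_succ.2 ⟨_, h1, hQ⟩, fun Q' hQ' => ?_, h3.of_isExtension h6⟩
    obtain ⟨Q₁, h7, h8⟩ := mem_STG_succ.1 hQ'
    obtain rfl := h2 Q₁ h7
    exact NXT_unique h8 hQ

end SModel

/-! ### The union of the stages -/

namespace SModel

/-- A cumulative hierarchy over the class of all sets: `E` is a membership relation on the class
`N`, and the classes with `Level` are an increasing sequence of subclasses of `N` such that every
subclass of a level is the extension of an element of `N`. -/
structure Hierarchy (M : Type) {S : Type} [SModel M S] where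
  N : M
  E : M
  Level : M → Prop
  mem : ∀ {a b}, Str.P a b ε E → a ε N ∧ b ε N
  ext : ∀ {b b'}, b ε N → b' ε N → (∀ a, Str.P a b ε E ↔ Str.P a b' ε E) → b = b'
  level_base : Level (baseD M)
  mem_base : ∀ {a y}, Str.P a (base M y) ε E ↔ ∃ x : S, (↟x : M) ε ↟y ∧ a = base M x
  cover : ∀ {a}, a ε N → ∃ D, Level D ∧ a ε D
  mem_of_level : ∀ {D a}, Level D → a ε D → a ε N
  directed : ∀ {D D'}, Level D → Level D' → ∃ D'', Level D'' ∧ ∀ a, a ε D ∨ a ε D' → a ε D''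
  trans : ∀ {D a b}, Level D → b ε D → Str.P a b ε E → a ε D
  coded : ∀ {D X}, Level D → (∀ a, a ε X → a ε D) → ∃ b, b ε N ∧ ∀ a, Str.P a b ε E ↔ a ε X
  power : ∀ {D}, Level D → ∃ D', Level D' ∧ ∀ b, b ε N → (∀ a, Str.P a b ε E → a ε D) → b ε D'
  wf : ∀ {X a}, a ε X → a ε N → ∃ b, b ε X ∧ b ε N ∧ ∀ c, Str.P c b ε E → ¬ c ε X

variable {M S : Type} [SModel M S]

local notation:50 x:51 " ∈ₘ " y:51 => Str.mem (Str.emb x : M) (Str.emb y)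

/-- `D` with the relation `E` is the stage with number `n`. -/
def Stage (n : S) (D E : M) : Prop := ↟n ε NAT M ∧ Str.P ↟n (Str.P D E) ε STG M

theorem Stage.unique {n : S} {D E D' E' : M} (h : Stage n D E) (h' : Stage n D' E') :
    D = D' ∧ E = E' := by
  obtain ⟨D₁, E₁, -, h1, -⟩ := exists_stage h.1
  rw [← P_inj, h1 _ h.2, h1 _ h'.2]

theorem Stage.isStage {n : S} {D E : M} (h : Stage n D E) : ∃ K, IsStage n D E K := by
  obtain ⟨D₁, E₁, h0, -, h2⟩ := exists_stage h.1
  obtain ⟨rfl, rfl⟩ := h.unique ⟨h.1, h0⟩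
  exact h2

theorem stage_zero {D E : M} : Stage (zero M) D E ↔ D = baseD M ∧ E = baseE M := by
  rw [Stage, mem_STG_zero, P_inj]
  exact and_iff_right zero_mem_NAT

theorem stage_succ {n : S} {D' E' : M} (h : Stage (succ M n) D' E') :
    ∃ D E, Stage n D E ∧ IsExtension (succ M n) D E D' E' := by
  obtain ⟨Q, h1, h2⟩ := mem_STG_succ.1 h.2
  obtain ⟨D, E, D₁, E₁, rfl, h3, h4⟩ := mem_EXT.1 (NXT_EXT h2)
  obtain ⟨rfl, rfl⟩ := P_inj.1 h3
  exact ⟨D, E, ⟨(nat_ord h.1).2 n (mem_succ.2 (.inr rfl)), h1⟩, h4⟩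

/-- Induction on `n` through a stratified class: `D'` and `E'` share the type of `n`, while `m` is a
set and typed freely. -/
theorem Stage.mono {m n : S} {D E D' E' : M} (h : Stage m D E) (h' : Stage n D' E')
    (hmn : m ∈ₘ n ∨ m = n) : (∀ a, a ε D → a ε D') ∧
      ∀ a b, b ε D → (Str.P a b ε E' ↔ Str.P a b ε E) := by
  rcases hmn with hmn | rfl
  swap
  · obtain ⟨rfl, rfl⟩ := h.unique h'
    exact ⟨fun _ h => h, fun _ _ _ => Iff.rfl⟩
  let Z : M := cl fun X => ∀ m : S, ↟m ε X → ↟m ε NAT M → ∀ D E D' E',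
    Str.P ↟m (Str.P D E) ε STG M → Str.P X (Str.P D' E') ε STG M →
    (∀ a, a ε D → a ε D') ∧ ∀ a b, b ε D → (Str.P a b ε E' ↔ Str.P a b ε E)
  have hZ : ↟n ε Z := by
    refine nat_induction_of_class ((mem_cl).2 fun m hm => (not_mem_zero m hm).elim)
      (fun n hn hnZ => (mem_cl).2 ?_) h'.1
    replace hnZ := (mem_cl).1 hnZ
    intro m hm hmN D E D' E' h1 h2
    obtain ⟨D₁, E₁, h3, h4⟩ := stage_succ ⟨succ_mem_NAT hn, h2⟩
    rcases mem_succ.1 hm with hm | rfl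
    · obtain ⟨h5, h6⟩ := hnZ m hm hmN D E D₁ E₁ h1 h3.2
      exact ⟨fun a ha => h4.subset a (h5 a ha), fun a b hb => by rw [h4.agree a b (h5 b hb), h6 a b hb]⟩
    · obtain ⟨rfl, rfl⟩ := h3.unique ⟨hmN, h1⟩
      exact ⟨h4.subset, h4.agree⟩
  exact (mem_cl).1 hZ m hmn h.1 D E D' E' h.2 h'.2

theorem nat_le_total {m n : S} (hm : ↟m ε NAT M) (hn : ↟n ε NAT M) :
    (m ∈ₘ n ∨ m = n) ∨ (n ∈ₘ m ∨ n = m) := by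
  rcases (nat_ord hm).1.trichotomy (nat_ord hn).1 with h | h | h
  · exact .inl (.inl h)
  · exact .inl (.inr h)
  · exact .inr (.inl h)

variable (M) in
/-- The union of the stages. -/
noncomputable def unionD : M := cl fun a => ∃ n : S, ∃ D E,
  (↟n ε NAT M ∧ Str.P ↟n (Str.P D E) ε STG M) ∧ a ε D

variable (M) in
/-- The membership relation on the union of the stages. -/
noncomputable def unionE : M := cl fun W => ∃ n : S, ∃ D E,
  (↟n ε NAT M ∧ Str.P ↟n (Str.P D E) ε STG M) ∧ W ε E

theorem mem_unionD {a : M} : a ε unionD M ↔ ∃ n D E, Stage n D E ∧ a ε D := mem_cl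

theorem mem_unionE {W : M} : W ε unionE M ↔ ∃ n D E, Stage n D E ∧ W ε E := mem_cl

/-- Larger stages add no members to old elements. If the pair is witnessed at a smaller stage, then
`b` already belongs to that stage. -/
theorem Stage.mem_unionE_iff {n : S} {D E a b : M} (h : Stage n D E) (hb : b ε D) :
    Str.P a b ε unionE M ↔ Str.P a b ε E := by
  refine ⟨fun h1 => ?_, fun h1 => mem_unionE.2 ⟨n, D, E, h, h1⟩⟩
  obtain ⟨m, D', E', h2, h3⟩ := mem_unionE.1 h1
  obtain ⟨K, h4⟩ := h2.isStage
  rcases nat_le_total h.1 h2.1 with h5 | h5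
  · exact ((h.mono h2 h5).2 a b hb).1 h3
  · exact ((h2.mono h h5).2 a b (h4.mem a b h3).2).2 h3

theorem Stage.directed {m n : S} {D E D' E' : M} (h : Stage m D E) (h' : Stage n D' E') :
    ∃ k D'' E'', Stage k D'' E'' ∧ ∀ a, a ε D ∨ a ε D' → a ε D'' := by
  rcases nat_le_total h.1 h'.1 with h1 | h1
  · exact ⟨n, D', E', h', fun a ha => ha.elim ((h.mono h' h1).1 a) id⟩
  · exact ⟨m, D, E, h, fun a ha => ha.elim id ((h'.mono h h1).1 a)⟩

theorem Stage.exists_succ {n : S} {D E : M} (h : Stage n D E) :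
    ∃ D' E', Stage (succ M n) D' E' ∧ IsExtension (succ M n) D E D' E' := by
  obtain ⟨D', E', h1, -⟩ := exists_stage (succ_mem_NAT h.1)
  obtain ⟨D₁, E₁, h2, h3⟩ := stage_succ ⟨succ_mem_NAT h.1, h1⟩
  obtain ⟨rfl, rfl⟩ := h2.unique h
  exact ⟨D', E', ⟨succ_mem_NAT h.1, h1⟩, h3⟩

variable (M) in
/-- The union of the stages is a hierarchy. -/
theorem exists_hierarchy : Nonempty (Hierarchy M) := by
  have hcov : ∀ {a b : M}, a ε unionD M → b ε unionD M → ∃ n D E, Stage n D E ∧ a ε D ∧ b ε D := by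
    intro a b ha hb
    obtain ⟨m, D, E, h1, h2⟩ := mem_unionD.1 ha
    obtain ⟨n, D', E', h3, h4⟩ := mem_unionD.1 hb
    obtain ⟨k, D'', E'', h5, h6⟩ := h1.directed h3
    exact ⟨k, D'', E'', h5, h6 a (.inl h2), h6 b (.inr h4)⟩
  have hbase : Stage (zero M) (baseD M) (baseE M) := stage_zero.2 ⟨rfl, rfl⟩
  refine ⟨unionD M, unionE M, fun D => ∃ n E, Stage n D E, ?_, ?_, ⟨_, _, hbase⟩, ?_, ?_, ?_, ?_, ?_, ?_,
    ?_, ?_⟩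
  · intro a b h
    obtain ⟨n, D, E, h1, h2⟩ := mem_unionE.1 h
    obtain ⟨K, h3⟩ := h1.isStage
    exact (h3.mem a b h2).imp (fun h => mem_unionD.2 ⟨n, D, E, h1, h⟩)
      fun h => mem_unionD.2 ⟨n, D, E, h1, h⟩
  · intro b b' hb hb' h
    obtain ⟨n, D, E, h1, h2, h3⟩ := hcov hb hb'
    obtain ⟨K, h4⟩ := h1.isStage
    exact h4.ext b b' h2 h3 fun a => by rw [← h1.mem_unionE_iff h2, h, h1.mem_unionE_iff h3]
  · intro a y
    rw [hbase.mem_unionE_iff (mem_baseD.2 ⟨y, rfl⟩), mem_baseE]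
    simp [base_inj]
  · intro a ha
    obtain ⟨n, D, E, h1, h2⟩ := mem_unionD.1 ha
    exact ⟨D, ⟨n, E, h1⟩, h2⟩
  · rintro D a ⟨n, E, h⟩ ha
    exact mem_unionD.2 ⟨n, D, E, h, ha⟩
  · rintro D D' ⟨n, E, h⟩ ⟨n', E', h'⟩
    obtain ⟨k, D'', E'', h5, h6⟩ := h.directed h'
    exact ⟨D'', ⟨k, E'', h5⟩, h6⟩
  · rintro D a b ⟨n, E, h⟩ hb hab
    obtain ⟨K, h1⟩ := h.isStage
    exact (h1.mem a b ((h.mem_unionE_iff hb).1 hab)).1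
  · rintro D X ⟨n, E, h⟩ hX
    obtain ⟨D', E', h1, h2⟩ := h.exists_succ
    obtain ⟨b, hb, hb'⟩ := h2.full X hX
    exact ⟨b, mem_unionD.2 ⟨_, _, _, h1, hb⟩, fun a => by rw [h1.mem_unionE_iff hb, hb']⟩
  · rintro D ⟨n, E, h⟩
    obtain ⟨D', E', h1, h2⟩ := h.exists_succ
    refine ⟨D', ⟨_, _, h1⟩, fun b hb hbD => ?_⟩
    -- The next stage contains an element with the same members as `b`; by extensionality in a
    -- common stage it is `b`.
    obtain ⟨b', hb', h3⟩ := h2.full (cl fun a => Str.P a b ε unionE M)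
      fun a ha => hbD a ((mem_cl (R := fun a => Str.P a b ε unionE M)).1 ha)
    obtain ⟨k, D₁, E₁, h4, h5, h6⟩ := hcov hb (mem_unionD.2 ⟨_, _, _, h1, hb'⟩)
    obtain ⟨K, h7⟩ := h4.isStage
    rwa [h7.ext b b' h5 h6 fun a => ?_]
    rw [← h4.mem_unionE_iff h5, ← h4.mem_unionE_iff h6, h1.mem_unionE_iff hb', ← h3]
    exact (mem_cl (R := fun a => Str.P a b ε unionE M)).symm
  · intro X a haX haN
    obtain ⟨n, D, E, h1, h2⟩ := mem_unionD.1 haN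
    -- Take the least stage that meets `X`. At a successor stage the members of its elements lie in
    -- the preceding stage and so avoid `X`; at stage `0` foundation for sets provides the minimal
    -- element.
    obtain ⟨k, ⟨hk, D', E', b, h3, hb, hbX⟩, hmin⟩ := exists_minimal (M := M)
      (R := fun n : S => ↟n ε NAT M ∧ ∃ D E b, Str.P ↟n (Str.P D E) ε STG M ∧ b ε D ∧ b ε X)
      ⟨h1.1, D, E, a, h1.2, h2, haX⟩
    have h4 : Stage k D' E' := ⟨hk, h3⟩
    rcases nat_cases hk with rfl | ⟨m, hm, rfl⟩
    · obtain ⟨rfl, rfl⟩ := stage_zero.1 h4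
      obtain ⟨x, rfl⟩ := mem_baseD.1 hb
      obtain ⟨y, hy, hymin⟩ := exists_minimal (M := M)
        (R := fun x : S => Str.P ↟(zero M) ↟x ε X) hbX
      have hyD : base M y ε baseD M := mem_baseD.2 ⟨y, rfl⟩
      refine ⟨base M y, hy, mem_unionD.2 ⟨_, _, _, hbase, hyD⟩, fun c hc => ?_⟩
      rw [hbase.mem_unionE_iff hyD, mem_baseE] at hc
      obtain ⟨z, y', h5, rfl, h6⟩ := hc
      rw [base_inj] at h6
      subst h6
      exact hymin z h5
    · obtain ⟨D₁, E₁, h5, h6⟩ := stage_succ h4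
      refine ⟨b, hbX, mem_unionD.2 ⟨_, _, _, h4, hb⟩, fun c hc hcX => ?_⟩
      rw [h4.mem_unionE_iff hb] at hc
      exact hmin m (mem_succ.2 (.inr rfl)) ⟨hm, D₁, E₁, c, h5.2, (h6.mem _ _ hc).1, hcX⟩

end SModel

namespace SModel

variable {M S : Type} [SModel M S]

local notation:50 x:51 " ∈ₘ " y:51 => Str.mem (Str.emb x : M) (Str.emb y)

/-! ## Assignments -/

namespace Hierarchy

variable (H : Hierarchy M)

/-- The class of assignments: functions from the class of all sets to the hierarchy. -/
noncomputable def ASG : M := cl fun s => (∀ W, W ε s → ∃ i : S, ∃ a, W = Str.P ↟i a) ∧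
  ∀ i : S, ∃ a, a ε H.N ∧ ∀ b, Str.P ↟i b ε s ↔ b = a

variable {H}

theorem mem_ASG {s : M} : s ε H.ASG ↔ (∀ W, W ε s → ∃ i : S, ∃ a, W = Str.P ↟i a) ∧
    ∀ i : S, ∃ a, a ε H.N ∧ ∀ b, Str.P ↟i b ε s ↔ b = a := mem_cl

open Classical in
/-- The value of an assignment. -/
noncomputable def _root_.FefermanS.SModel.ap (s : M) (i : S) : M :=
  if h : ∃ a, ∀ b, Str.P ↟i b ε s ↔ b = a then h.choose else Str.V

theorem mem_iff_ap {s : M} (hs : s ε H.ASG) {i : S} {b : M} : Str.P ↟i b ε s ↔ b = ap s i := by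
  obtain ⟨a, -, ha⟩ := (mem_ASG.1 hs).2 i
  have h : ∃ a, ∀ b, Str.P ↟i b ε s ↔ b = a := ⟨a, ha⟩
  rw [ap, dif_pos h]
  exact h.choose_spec b

theorem ap_mem {s : M} (hs : s ε H.ASG) (i : S) : ap s i ε H.N := by
  obtain ⟨a, ha, ha'⟩ := (mem_ASG.1 hs).2 i
  rwa [(ha' (ap s i)).1 ((mem_iff_ap hs).2 rfl)]

/-- Assignments consist of pairs only and are nonempty, so agreement of values suffices for
extensionality of classes. -/
theorem asg_ext {s s' : M} (hs : s ε H.ASG) (hs' : s' ε H.ASG) (h : ∀ i, ap s i = ap s' i) :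
    s = s' := by
  obtain ⟨i⟩ := nonempty_sets M
  refine ext_of_nonempty ((mem_iff_ap hs (i := i)).2 rfl) fun W => ?_
  constructor
  · intro hW
    obtain ⟨i, a, rfl⟩ := (mem_ASG.1 hs).1 W hW
    rw [mem_iff_ap hs] at hW
    rw [mem_iff_ap hs', hW, h]
  · intro hW
    obtain ⟨i, a, rfl⟩ := (mem_ASG.1 hs').1 W hW
    rw [mem_iff_ap hs'] at hW
    rw [mem_iff_ap hs, hW, h]

/-- The modification of an assignment at one place. -/
noncomputable def _root_.FefermanS.SModel.up (s : M) (i : S) (a : M) : M :=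
  cl fun W => ∃ j : S, ∃ b, W = Str.P ↟j b ∧ ((j = i ∧ b = a) ∨ (¬ j = i ∧ Str.P ↟j b ε s))

theorem _root_.FefermanS.SModel.mem_up {s a b : M} {i j : S} :
    Str.P ↟j b ε up s i a ↔ (j = i ∧ b = a) ∨ (¬ j = i ∧ Str.P ↟j b ε s) := by
  refine (mem_cl).trans ?_
  simp only [P_inj, emb_inj]
  constructor
  · rintro ⟨j, b, ⟨rfl, rfl⟩, h⟩; exact h
  · exact fun h => ⟨j, b, ⟨rfl, rfl⟩, h⟩

theorem up_mem {s a : M} (hs : s ε H.ASG) (i : S) (ha : a ε H.N) : up s i a ε H.ASG := by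
  refine mem_ASG.2 ⟨fun W hW => ?_, fun j => ?_⟩
  · obtain ⟨j, b, h, -⟩ := (mem_cl).1 hW
    exact ⟨j, b, h⟩
  · by_cases h : j = i
    · exact ⟨a, ha, fun b => by simp [mem_up, h]⟩
    · exact ⟨ap s j, ap_mem hs j, fun b => by simp [mem_up, h, mem_iff_ap hs]⟩

open Classical in
theorem ap_up {s a : M} (hs : s ε H.ASG) {i : S} (ha : a ε H.N) (j : S) :
    ap (up s i a) j = if j = i then a else ap s j := by
  symm
  rw [← mem_iff_ap (up_mem hs i ha), mem_up]
  split_ifs with h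
  · exact .inl ⟨h, rfl⟩
  · exact .inr ⟨h, (mem_iff_ap hs).2 rfl⟩

theorem up_comm {s a b : M} (hs : s ε H.ASG) {i j : S} (ha : a ε H.N) (hb : b ε H.N) (h : i ≠ j) :
    up (up s i a) j b = up (up s j b) i a := by
  refine asg_ext (up_mem (up_mem hs i ha) j hb) (up_mem (up_mem hs j hb) i ha) fun k => ?_
  rw [ap_up (up_mem hs i ha) hb, ap_up (up_mem hs j hb) ha, ap_up hs ha, ap_up hs hb]
  split_ifs with h1 h2 <;> first | rfl | exact (h (h2.symm.trans h1)).elim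

/-- An assignment that agrees with `s` except at `i`. -/
theorem eq_up {s s' : M} (hs : s ε H.ASG) (hs' : s' ε H.ASG) {i : S}
    (h : ∀ (j : S) (a : M), ¬ j = i → Str.P ↟j a ε s → Str.P ↟j a ε s') : s' = up s i (ap s' i) := by
  refine asg_ext hs' (up_mem hs i (ap_mem hs' i)) fun j => ?_
  rw [ap_up hs (ap_mem hs' i)]
  split_ifs with h1
  · rw [h1]
  · exact ((mem_iff_ap hs').1 (h j _ h1 ((mem_iff_ap hs).2 rfl))).symm

theorem up_agree {s a : M} {i : S} (j : S) (b : M) (hj : ¬ j = i) (h : Str.P ↟j b ε s) :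
    Str.P ↟j b ε up s i a := mem_up.2 (.inr ⟨hj, h⟩)

variable (H) in
theorem exists_mem_ASG : ∃ s, s ε H.ASG := by
  have h0 : base M (zero M) ε H.N := H.mem_of_level H.level_base (mem_baseD.2 ⟨_, rfl⟩)
  have key : ∀ W, W ε (cl fun W => ∃ i : S, W = Str.P ↟i (base M (zero M))) ↔
    ∃ i : S, W = Str.P ↟i (base M (zero M)) := fun W => mem_cl
  refine ⟨cl fun W => ∃ i : S, W = Str.P ↟i (base M (zero M)),
    mem_ASG.2 ⟨fun W hW => ?_, fun i => ⟨base M (zero M), h0, fun b => ?_⟩⟩⟩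
  · obtain ⟨i, h⟩ := (key W).1 hW
    exact ⟨i, _, h⟩
  · rw [key]
    simp [P_inj, emb_inj]

end Hierarchy

/-! ## Truth -/

variable (M) in
/-- The triples that are used as codes. -/
noncomputable def triple (k : ℕ) (p q : S) : S := kpair M (num M k) (kpair M p q)

theorem eq_triple {k : ℕ} {p q u : S} :
    (↟u : M) = Str.P ↟(num M k) (Str.P ↟p ↟q) ↔ u = triple M k p q := by
  rw [← emb_kpair M p q, ← emb_kpair, emb_inj]; rfl

theorem triple_inj {k l : ℕ} {p q p' q' : S} :
    triple M k p q = triple M l p' q' ↔ k = l ∧ p = p' ∧ q = q' := by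
  simp [triple, kpair_inj]

/-- Induction on the structure of codes. -/
theorem triple_induction {R : S → Prop} {Z : M} (hZ : ∀ x : S, ↟x ε Z ↔ R x)
    (h : ∀ u, (∀ k p q, u = triple M k p q → R p ∧ R q) → R u) (u : S) : R u := by
  by_contra hu
  -- The components of a triple lie four membership steps below it. Minimizing the property of
  -- failing at depth at most three excludes failures at depths one to four below `m`, so `m` itself
  -- fails while its components do not.
  obtain ⟨m, hm, hmin⟩ := exists_minimal (M := M) (x := u)
    (R := fun x => ¬ ↟x ε Z ∨ (∃ y : S, y ∈ₘ x ∧ ¬ ↟y ε Z) ∨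
      (∃ y z : S, y ∈ₘ x ∧ z ∈ₘ y ∧ ¬ ↟z ε Z) ∨
      ∃ y z w : S, y ∈ₘ x ∧ z ∈ₘ y ∧ w ∈ₘ z ∧ ¬ ↟w ε Z) (.inl (by rwa [hZ]))
  rcases hm with hm | ⟨y, hy, h1⟩ | ⟨y, z, hy, h1⟩ | ⟨y, z, w, hy, h1⟩
  · rw [hZ] at hm
    refine hm (h m fun k p q hmt => ?_)
    have key : ∀ r, r = p ∨ r = q → R r := by
      intro r hr
      by_contra hrR
      rw [← hZ] at hrR
      have h1 : r ∈ₘ upair M p q := by rw [mem_upair, emb_inj, emb_inj]; exact hr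
      have h2 : upair M p q ∈ₘ kpair M p q := mem_upair.2 (.inr rfl)
      have h3 : kpair M p q ∈ₘ upair M (num M k) (kpair M p q) := mem_upair.2 (.inr rfl)
      have h4 : upair M (num M k) (kpair M p q) ∈ₘ m := hmt ▸ mem_upair.2 (.inr rfl)
      exact hmin _ h4 (.inr (.inr (.inr ⟨_, _, _, h3, h2, h1, hrR⟩)))
    exact ⟨key p (.inl rfl), key q (.inr rfl)⟩
  · exact hmin y hy (.inl h1)
  · exact hmin y hy (.inr (.inl ⟨z, h1⟩))
  · exact hmin y hy (.inr (.inr (.inl ⟨z, w, h1⟩)))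

namespace Hierarchy

variable (H : Hierarchy M)

/-- The conditions for the truth of `u` under the assignment `s`, in terms of a class `Z` of
judgements of truth (marked by `1`) and falsity (marked by `0`). -/
@[reducible] def TrueCase (Z : M) (u : S) (s : M) : Prop :=
  (∃ p q : S, (↟u : M) = Str.P ↟(num M 2) (Str.P ↟p ↟q) ∧
    (Str.P ↟p (Str.P ↟(num M 0) s) ε Z ∨ Str.P ↟q (Str.P ↟(num M 1) s) ε Z)) ∨
  (∃ i p : S, (↟u : M) = Str.P ↟(num M 3) (Str.P ↟i ↟p) ∧ ∀ s', s' ε H.ASG →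
    (∀ (j : S) (a : M), ¬ j = i → Str.P ↟j a ε s → Str.P ↟j a ε s') →
      Str.P ↟p (Str.P ↟(num M 1) s') ε Z) ∨
  (∃ i j : S, (↟u : M) = Str.P ↟(num M 0) (Str.P ↟i ↟j) ∧
    ∃ a b, Str.P ↟i a ε s ∧ Str.P ↟j b ε s ∧ Str.P a b ε H.E) ∨
  (∃ i j : S, (↟u : M) = Str.P ↟(num M 1) (Str.P ↟i ↟j) ∧ ∃ a, Str.P ↟i a ε s ∧ Str.P ↟j a ε s)

/-- The conditions for the falsity of `u` under the assignment `s`. -/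
@[reducible] def FalseCase (Z : M) (u : S) (s : M) : Prop :=
  (∀ p q : S, (↟u : M) = Str.P ↟(num M 2) (Str.P ↟p ↟q) →
    (Str.P ↟p (Str.P ↟(num M 1) s) ε Z ∧ Str.P ↟q (Str.P ↟(num M 0) s) ε Z)) ∧
  (∀ i p : S, (↟u : M) = Str.P ↟(num M 3) (Str.P ↟i ↟p) → ∃ s', s' ε H.ASG ∧
    (∀ (j : S) (a : M), ¬ j = i → Str.P ↟j a ε s → Str.P ↟j a ε s') ∧
      Str.P ↟p (Str.P ↟(num M 0) s') ε Z) ∧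
  (∀ i j : S, (↟u : M) = Str.P ↟(num M 0) (Str.P ↟i ↟j) →
    ¬ ∃ a b, Str.P ↟i a ε s ∧ Str.P ↟j b ε s ∧ Str.P a b ε H.E) ∧
  (∀ i j : S, (↟u : M) = Str.P ↟(num M 1) (Str.P ↟i ↟j) → ¬ ∃ a, Str.P ↟i a ε s ∧ Str.P ↟j a ε s)

/-- Falsity is judged separately, so an implication needs no negative occurrence of `Z` and the
operator is monotone. Modified assignments are described by agreement away from `i`, which is
stratified. -/
theorem exists_truth : ∃ I : M, ∀ W, W ε I ↔ ∃ u : S, ∃ s, s ε H.ASG ∧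
    ((W = Str.P ↟u (Str.P ↟(num M 1) s) ∧ H.TrueCase I u s) ∨
      (W = Str.P ↟u (Str.P ↟(num M 0) s) ∧ H.FalseCase I u s)) := by
  refine exists_fixpoint (Φ := fun I W => ∃ u : S, ∃ s, s ε H.ASG ∧
    ((W = Str.P ↟u (Str.P ↟(num M 1) s) ∧ H.TrueCase I u s) ∨
      (W = Str.P ↟u (Str.P ↟(num M 0) s) ∧ H.FalseCase I u s))) ?_ ?_ ?_
  · rintro Z Z' h W ⟨u, s, hs, h1⟩
    refine ⟨u, s, hs, h1.imp (And.imp_right ?_) (And.imp_right ?_)⟩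
    · rintro (⟨p, q, hu, h2⟩ | ⟨i, p, hu, h2⟩ | h2)
      · exact .inl ⟨p, q, hu, h2.imp (h _) (h _)⟩
      · exact .inr (.inl ⟨i, p, hu, fun s' hs' h3 => h _ (h2 s' hs' h3)⟩)
      · exact .inr (.inr h2)
    · rintro ⟨h2, h3, h4⟩
      exact ⟨fun p q hu => (h2 p q hu).imp (h _) (h _),
        fun i p hu => (h3 i p hu).imp fun s' => And.imp_right (And.imp_right (h _)), h4⟩
  · exact fun Z => ⟨cl _, fun Y => mem_cl⟩
  · exact ⟨cl _, fun Y => mem_cl⟩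

/-- The class of judgements of truth and falsity. -/
noncomputable def TR : M := H.exists_truth.choose

theorem mem_TR {W : M} : W ε H.TR ↔ ∃ u : S, ∃ s, s ε H.ASG ∧
    ((W = Str.P ↟u (Str.P ↟(num M 1) s) ∧ H.TrueCase H.TR u s) ∨
      (W = Str.P ↟u (Str.P ↟(num M 0) s) ∧ H.FalseCase H.TR u s)) :=
  H.exists_truth.choose_spec W

/-- The formula with code `u` is true under the assignment `s`. -/
def Holds (u : S) (s : M) : Prop := Str.P ↟u (Str.P ↟(num M 1) s) ε H.TR

variable {H}

theorem true_iff {u : S} {s : M} (hs : s ε H.ASG) : H.Holds u s ↔ H.TrueCase H.TR u s := by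
  rw [Holds, mem_TR]
  constructor
  · rintro ⟨u', s', -, ⟨h, h'⟩ | ⟨h, h'⟩⟩
    · simp only [P_inj, emb_inj] at h
      obtain ⟨rfl, -, rfl⟩ := h
      exact h'
    · simp [P_inj, emb_inj] at h
  · exact fun h => ⟨u, s, hs, .inl ⟨rfl, h⟩⟩

theorem false_iff {u : S} {s : M} (hs : s ε H.ASG) :
    Str.P ↟u (Str.P ↟(num M 0) s) ε H.TR ↔ H.FalseCase H.TR u s := by
  rw [mem_TR]
  constructor
  · rintro ⟨u', s', -, ⟨h, h'⟩ | ⟨h, h'⟩⟩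
    · simp [P_inj, emb_inj] at h
    · simp only [P_inj, emb_inj] at h
      obtain ⟨rfl, -, rfl⟩ := h
      exact h'
  · exact fun h => ⟨u, s, hs, .inr ⟨rfl, h⟩⟩

/-- The clauses for falsity are dual to those for truth, so induction on triples applies to every
set `u`: one that matches no truth clause is false vacuously. -/
theorem false_iff_not_true (u : S) : ∀ s, s ε H.ASG →
    (Str.P ↟u (Str.P ↟(num M 0) s) ε H.TR ↔ ¬ H.Holds u s) := by
  refine triple_induction (M := M) (Z := cl fun X => ∀ s, s ε H.ASG →
    (Str.P X (Str.P ↟(num M 0) s) ε H.TR ↔ ¬ Str.P X (Str.P ↟(num M 1) s) ε H.TR))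
    (fun x => mem_cl) ?_ u
  intro u ih s hs
  rw [false_iff hs]
  change _ ↔ ¬ H.Holds u s
  rw [true_iff hs]
  simp only [TrueCase, FalseCase, not_or, not_exists, not_and]
  refine and_congr (forall₂_congr fun p q => forall_congr' fun hu => ?_) <|
    and_congr (forall₂_congr fun i p => forall_congr' fun hu => ?_) Iff.rfl
  · obtain ⟨hp, hq⟩ := ih _ _ _ (eq_triple.1 hu)
    rw [hp s hs, hq s hs, not_not]
  · obtain ⟨-, hp⟩ := ih _ _ _ (eq_triple.1 hu)
    simp only [not_forall, exists_prop]
    refine exists_congr fun s' => and_congr_right fun hs' => and_congr_right fun _ => ?_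
    rw [hp s' hs']

theorem true_imp {p q : S} {s : M} (hs : s ε H.ASG) :
    H.Holds (triple M 2 p q) s ↔ (H.Holds p s → H.Holds q s) := by
  rw [true_iff hs]
  simp only [TrueCase, eq_triple, triple_inj, false_iff_not_true _ s hs]
  simp [imp_iff_not_or, Holds]

theorem true_all {i p : S} {s : M} (hs : s ε H.ASG) :
    H.Holds (triple M 3 i p) s ↔ ∀ a, a ε H.N → H.Holds p (up s i a) := by
  rw [true_iff hs]
  simp only [TrueCase, eq_triple, triple_inj]
  simp only [show ¬ (3 : ℕ) = 2 by decide, show ¬ (3 : ℕ) = 0 by decide,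
    show ¬ (3 : ℕ) = 1 by decide, false_and, exists_false, false_or, or_false, true_and]
  constructor
  · rintro ⟨i, p, ⟨rfl, rfl⟩, h⟩ a ha
    exact h _ (up_mem hs i ha) fun j b hj hb => up_agree j b hj hb
  · refine fun h => ⟨i, p, ⟨rfl, rfl⟩, fun s' hs' h' => ?_⟩
    rw [eq_up hs hs' h']
    exact h _ (ap_mem hs' i)

theorem true_mem {i j : S} {s : M} (hs : s ε H.ASG) :
    H.Holds (triple M 0 i j) s ↔ Str.P (ap s i) (ap s j) ε H.E := by
  rw [true_iff hs]
  simp only [TrueCase, eq_triple, triple_inj, mem_iff_ap hs]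
  simp

theorem true_eq {i j : S} {s : M} (hs : s ε H.ASG) :
    H.Holds (triple M 1 i j) s ↔ ap s i = ap s j := by
  rw [true_iff hs]
  simp only [TrueCase, eq_triple, triple_inj, mem_iff_ap hs]
  simp

/-- No truth clause mentions the tag `4`. -/
theorem not_true_bot {p q : S} {s : M} (hs : s ε H.ASG) : ¬ H.Holds (triple M 4 p q) s := by
  rw [true_iff hs]
  simp only [TrueCase, eq_triple, triple_inj]
  simp

end Hierarchy
end SModel

/-! ## Codes of formulas -/

/-- The value of the set variable with level `k` below `s` set quantifiers. -/
def lv {S : Type} (υ : ℕ → S) (s k : ℕ) : S := υ (s - 1 - k)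

theorem lv_lift {S : Type} {υ : ℕ → S} {s k : ℕ} {x : S} (h : k < s) :
    lv (scons x υ) (s + 1) k = lv υ s k := by
  rw [lv, lv, show s + 1 - 1 - k = (s - 1 - k) + 1 by omega, scons_succ]

theorem lv_new {S : Type} {υ : ℕ → S} {s : ℕ} {x : S} : lv (scons x υ) (s + 1) s = x := by
  rw [lv, show s + 1 - 1 - s = 0 by omega, scons_zero]

@[simp] theorem val_svar {M S : Type} [Str M S] {ρ : ℕ → M} {υ : ℕ → S} {c s k : ℕ} :
    ((LTerm.svar k).toIndex c s).val ρ υ = ↟(lv υ s k) := rfl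

@[simp] theorem val_P {M S : Type} [Str M S] {ρ : ℕ → M} {υ : ℕ → S} {c s : ℕ} {t u : LTerm} :
    ((LTerm.P t u).toIndex c s).val ρ υ =
      Str.P ((t.toIndex c s).val ρ υ) ((u.toIndex c s).val ρ υ) := rfl

/-- The term is a set variable in the scope of `s` set quantifiers. -/
def LTerm.Scoped (s : ℕ) : LTerm → Prop
  | .svar k => k < s
  | _ => False

/-- All terms of the index are in the scope of `s` set quantifiers. -/
def Ix.Scoped (s : ℕ) : Ix → Prop
  | .num _ => True
  | .ref t => t.Scoped s

/-- All terms of the scheme are in the scope of `s` set quantifiers. -/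
def Scheme.Scoped (s : ℕ) : Scheme → Prop
  | .mem x y => x.Scoped s ∧ y.Scoped s
  | .eq x y => x.Scoped s ∧ y.Scoped s
  | .bot => True
  | .imp p q => p.Scoped s ∧ q.Scoped s
  | .all x p => x.Scoped s ∧ p.Scoped s
  | .form t => t.Scoped s

theorem LTerm.Scoped.succ {s : ℕ} {t : LTerm} (h : t.Scoped s) : t.Scoped (s + 1) := by
  cases t with
  | svar k => exact Nat.lt_succ_of_lt h
  | _ => exact h

theorem Ix.Scoped.succ {s : ℕ} {x : Ix} (h : x.Scoped s) : x.Scoped (s + 1) := by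
  cases x with
  | num => trivial
  | ref t => exact LTerm.Scoped.succ h

theorem Scheme.Scoped.succ {s : ℕ} {p : Scheme} (h : p.Scoped s) : p.Scoped (s + 1) := by
  induction p with
  | mem | eq => exact ⟨h.1.succ, h.2.succ⟩
  | bot => trivial
  | imp p q hp hq => exact ⟨hp h.1, hq h.2⟩
  | all x p hp => exact ⟨h.1.succ, hp h.2⟩
  | form t => exact LTerm.Scoped.succ h

/-- The value of a term that is a set variable. -/
def LTerm.sval {S : Type} (υ : ℕ → S) (s : ℕ) : LTerm → S
  | .svar k => lv υ s k
  -- A default value that is never reached for terms in scope.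
  | _ => υ 0

theorem LTerm.sval_lift {S : Type} {υ : ℕ → S} {s : ℕ} {x : S} {t : LTerm} (h : t.Scoped s) :
    t.sval (scons x υ) (s + 1) = t.sval υ s := by
  cases t with
  | svar k => exact lv_lift h
  | _ => exact h.elim

namespace SModel

variable {M S : Type} [SModel M S]

local notation:50 x:51 " ∈ₘ " y:51 => Str.mem (Str.emb x : M) (Str.emb y)

variable (M) in
/-- The set coding an index. -/
noncomputable def ixCode (υ : ℕ → S) (s : ℕ) : Ix → S
  | .num k => num M k
  | .ref t => t.sval υ s

variable (M) in
/-- The set coding a scheme. -/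
noncomputable def code (υ : ℕ → S) (s : ℕ) : Scheme → S
  | .mem x y => triple M 0 (ixCode M υ s x) (ixCode M υ s y)
  | .eq x y => triple M 1 (ixCode M υ s x) (ixCode M υ s y)
  | .imp p q => triple M 2 (code υ s p) (code υ s q)
  | .all x p => triple M 3 (ixCode M υ s x) (code υ s p)
  | .bot => triple M 4 (zero M) (zero M)
  | .form t => t.sval υ s

theorem ixCode_lift {υ : ℕ → S} {s : ℕ} {y : S} {x : Ix} (h : x.Scoped s) :
    ixCode M (scons y υ) (s + 1) x = ixCode M υ s x := by
  cases x with
  | num => rfl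
  | ref t => exact LTerm.sval_lift h

theorem code_lift {υ : ℕ → S} {s : ℕ} {y : S} {p : Scheme} (h : p.Scoped s) :
    code M (scons y υ) (s + 1) p = code M υ s p := by
  induction p with
  | mem | eq => rw [code, code, ixCode_lift h.1, ixCode_lift h.2]
  | bot => rfl
  | imp p q hp hq => rw [code, code, hp h.1, hq h.2]
  | all x p hp => rw [code, code, hp h.2, ixCode_lift h.1]
  | form t => exact LTerm.sval_lift h

/-! ### Meaning of the coding formulas in a model -/

section SatCode

variable {ρ : ℕ → M}

theorem sat_isEmpty {υ : ℕ → S} {s k : ℕ} (h : k < s) :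
    ((FefermanS.isEmpty (.svar k)) 0 s).Sat ρ υ ↔ lv υ s k = zero M := by
  simp [FefermanS.isEmpty, lv_lift h, lv_new, eq_zero_iff]

theorem sat_isSucc {υ : ℕ → S} {s k l : ℕ} (hk : k < s) (hl : l < s) :
    ((FefermanS.isSucc (.svar k) (.svar l)) 0 s).Sat ρ υ ↔ lv υ s k = succ M (lv υ s l) := by
  simp [FefermanS.isSucc, lv_lift hk, lv_lift hl, lv_new, eq_succ_iff, emb_inj]

theorem sat_isNum {m : ℕ} : ∀ {υ : ℕ → S} {s k : ℕ}, k < s →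
    (((isNum m (.svar k)) 0 s).Sat ρ υ ↔ lv υ s k = num M m) := by
  induction m with
  | zero => intro υ s k hk; exact sat_isEmpty hk
  | succ m ih =>
    intro υ s k hk
    simp [isNum, ih (Nat.lt_succ_self s), sat_isSucc (Nat.lt_succ_of_lt hk) (Nat.lt_succ_self s),
      lv_new, lv_lift hk, num]

theorem sat_isTriple {υ : ℕ → S} {m s k p q : ℕ} (hk : k < s) (hp : p < s) (hq : q < s) :
    ((isTriple m (.svar p) (.svar q) (.svar k)) 0 s).Sat ρ υ ↔
      lv υ s k = triple M m (lv υ s p) (lv υ s q) := by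
  simp [isTriple, sat_isNum (Nat.lt_succ_self s), lv_new, lv_lift hk, lv_lift hp, lv_lift hq,
    eq_triple]

theorem sat_isIndex {υ : ℕ → S} {s k : ℕ} {x : Ix} (hx : x.Scoped s) (hk : k < s) :
    ((isIndex x (.svar k)) 0 s).Sat ρ υ ↔ lv υ s k = ixCode M υ s x := by
  cases x with
  | num m => exact sat_isNum hk
  | ref t =>
    cases t with
    | svar l => simp [isIndex, emb_inj, ixCode, LTerm.sval]
    | _ => exact hx.elim

theorem sat_isCode {p : Scheme} : ∀ {υ : ℕ → S} {s k : ℕ}, p.Scoped s → k < s →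
    (((isCode p (.svar k)) 0 s).Sat ρ υ ↔ lv υ s k = code M υ s p) := by
  induction p with
  | mem x y =>
    intro υ s k hp hk
    simp [isCode, sat_isIndex hp.1.succ.succ (show s < s + 1 + 1 by omega),
      sat_isIndex hp.2.succ.succ (show s + 1 < s + 1 + 1 by omega),
      sat_isTriple (show k < s + 1 + 1 by omega) (show s < s + 1 + 1 by omega)
        (show s + 1 < s + 1 + 1 by omega), lv_new, lv_lift hk, lv_lift (show s < s + 1 by omega),
      lv_lift (show k < s + 1 by omega), ixCode_lift hp.1.succ, ixCode_lift hp.1,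
      ixCode_lift hp.2.succ, ixCode_lift hp.2, code]
  | eq x y =>
    intro υ s k hp hk
    simp [isCode, sat_isIndex hp.1.succ.succ (show s < s + 1 + 1 by omega),
      sat_isIndex hp.2.succ.succ (show s + 1 < s + 1 + 1 by omega),
      sat_isTriple (show k < s + 1 + 1 by omega) (show s < s + 1 + 1 by omega)
        (show s + 1 < s + 1 + 1 by omega), lv_new, lv_lift hk, lv_lift (show s < s + 1 by omega),
      lv_lift (show k < s + 1 by omega), ixCode_lift hp.1.succ, ixCode_lift hp.1,
      ixCode_lift hp.2.succ, ixCode_lift hp.2, code]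
  | bot =>
    intro υ s k hp hk
    simp [isCode, sat_isNum (Nat.lt_succ_self s), sat_isTriple (show k < s + 1 by omega)
      (Nat.lt_succ_self s) (Nat.lt_succ_self s), lv_new, lv_lift hk, code, num]
  | imp p q ihp ihq =>
    intro υ s k hp hk
    simp [isCode, ihp hp.1.succ.succ (show s < s + 1 + 1 by omega),
      ihq hp.2.succ.succ (show s + 1 < s + 1 + 1 by omega),
      sat_isTriple (show k < s + 1 + 1 by omega) (show s < s + 1 + 1 by omega)
        (show s + 1 < s + 1 + 1 by omega), lv_new, lv_lift hk, lv_lift (show s < s + 1 by omega),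
      lv_lift (show k < s + 1 by omega), code_lift hp.1.succ, code_lift hp.1,
      code_lift hp.2.succ, code_lift hp.2, code]
  | all x p ihp =>
    intro υ s k hp hk
    simp [isCode, sat_isIndex hp.1.succ.succ (show s < s + 1 + 1 by omega),
      ihp hp.2.succ.succ (show s + 1 < s + 1 + 1 by omega),
      sat_isTriple (show k < s + 1 + 1 by omega) (show s < s + 1 + 1 by omega)
        (show s + 1 < s + 1 + 1 by omega), lv_new, lv_lift hk, lv_lift (show s < s + 1 by omega),
      lv_lift (show k < s + 1 by omega), ixCode_lift hp.1.succ, ixCode_lift hp.1,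
      code_lift hp.2.succ, code_lift hp.2, code]
  | form t =>
    intro υ s k hp hk
    cases t with
    | svar l => simp [isCode, emb_inj, code, LTerm.sval]
    | _ => exact hp.elim

/-- Induction along a sequence of justified entries. -/
theorem inSequence_induction {J : (LTerm → Bld) → LTerm → Bld} {υ : ℕ → S} {s k : ℕ} (hk : k < s)
    (h : ((inSequence J (.svar k)) 0 s).Sat ρ υ) {Q : S → Prop} {Z : M} (hZ : ∀ x : S, ↟x ε Z ↔ Q x)
    -- The levels `s`, `s + 1`, `s + 2`, `s + 3` name the length, the sequence, the position and the
    -- entry.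
    (hJ : ∀ (υ' : ℕ → S),
      (∀ l < s, lv υ' (s + 4) l = lv υ s l) →
      (J (fun b => Bld.exS fun j => Bld.and (Bld.mem j (.svar (s + 2)))
        (Bld.mem (.P j b) (.svar (s + 1)))) (.svar (s + 3)) 0 (s + 4)).Sat ρ υ' →
      (∀ b, (∃ j : S, j ∈ₘ lv υ' (s + 4) (s + 2) ∧
        Str.P ↟j ↟b ε (↟(lv υ' (s + 4) (s + 1)) : M)) → Q b) →
      Q (lv υ' (s + 4) (s + 3))) : Q (lv υ s k) := by
  simp only [inSequence, Bld.sat_exS, Bld.sat_and, Bld.sat_allS, Bld.sat_imp, Bld.sat_mem, isFunOn,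
    Bld.sat_eq, Bld.sat_iff, val_svar, val_P] at h
  obtain ⟨n, f, -, ⟨hf, -⟩, hseq, i₀, hi₀, hu⟩ := h
  simp (disch := omega) only [lv_new, lv_lift] at hf hi₀ hu hseq
  have key : ∀ i : S, i ∈ₘ n → ∀ a : S, Str.P ↟i ↟a ε (↟f : M) → Q a := by
    by_contra! hcon
    obtain ⟨i₁, h1⟩ := hcon
    obtain ⟨i, ⟨hi, a, ha, haQ⟩, hmin⟩ := exists_minimal (M := M) (x := i₁)
      (R := fun i : S => i ∈ₘ n ∧ ∃ a : S, Str.P ↟i ↟a ε (↟f : M) ∧ ¬ ↟a ε Z) (by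
        obtain ⟨h2, a, h3, h4⟩ := h1
        exact ⟨h2, a, h3, by rwa [hZ]⟩)
    rw [hZ] at haQ
    refine haQ ?_
    have := hJ (scons a (scons i (scons f (scons n υ)))) ?_ (hseq i a ⟨hi, ha⟩) ?_
    · rwa [show s + 4 = s + 3 + 1 from rfl, lv_new] at this
    · intro l hl
      simp (disch := omega) only [show s + 4 = s + 1 + 1 + 1 + 1 from rfl, lv_lift]
    · simp (disch := omega) only [show s + 4 = s + 1 + 1 + 1 + 1 from rfl,
        show s + 2 = s + 1 + 1 from rfl, lv_lift, lv_new]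
      rintro b ⟨j, hj, hjb⟩
      -- The pair has to be turned into a set before the clause on members of the function applies
      -- to it.
      have hjn : j ∈ₘ n := by
        rw [← emb_kpair M j b] at hjb
        obtain ⟨j', b', hj', h5⟩ := hf _ hjb
        rw [emb_kpair, P_inj, emb_inj] at h5
        exact h5.1 ▸ hj'
      by_contra hb
      exact hmin j hj ⟨hjn, b, hjb, by rwa [hZ]⟩
  exact key i₀ hi₀ _ hu

end SatCode

end SModel

namespace SModel

variable {M S : Type} [SModel M S]

local notation:50 x:51 " ∈ₘ " y:51 => Str.mem (Str.emb x : M) (Str.emb y)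

namespace Hierarchy

variable (H : Hierarchy M)

/-! ## The hierarchy as a structure for the language of set theory -/

/-- The elements of the hierarchy. -/
abbrev El : Type := {a : M // a ε H.N}

/-- The assignments of elements of the hierarchy to variables. -/
abbrev Asg : Type := {s : M // s ε H.ASG}

variable {H}

/-- The membership relation of the hierarchy. -/
def El.lt (a b : H.El) : Prop := Str.P a.1 b.1 ε H.E

local infix:50 " ≺ " => El.lt

/-- The value of an assignment. -/
noncomputable def Asg.get (σ : H.Asg) (i : S) : H.El := ⟨ap σ.1 i, ap_mem σ.2 i⟩

/-- The modification of an assignment. -/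
noncomputable def Asg.set (σ : H.Asg) (i : S) (a : H.El) : H.Asg := ⟨up σ.1 i a.1, up_mem σ.2 i a.2⟩

open Classical in
theorem Asg.get_set (σ : H.Asg) (i j : S) (a : H.El) :
    (σ.set i a).get j = if j = i then a else σ.get j := by
  exact Subtype.ext ((ap_up σ.2 a.2 j).trans (by split_ifs <;> rfl))

theorem Asg.set_comm (σ : H.Asg) {i j : S} (a b : H.El) (h : i ≠ j) :
    (σ.set i a).set j b = (σ.set j b).set i a :=
  Subtype.ext (up_comm σ.2 a.2 b.2 h)

/-- The value of the variable with a given numeral. -/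
noncomputable def Asg.var (σ : H.Asg) (i : ℕ) : H.El := σ.get (num M i)

@[simp] theorem Asg.var_set (σ : H.Asg) (d i : ℕ) (a : H.El) :
    (σ.set (num M d) a).var i = if i = d then a else σ.var i := by
  simp only [Asg.var, Asg.get_set, num_inj]

/-- Truth of the formula with a given code. -/
def Tr (u : S) (σ : H.Asg) : Prop := H.Holds u σ.1

theorem tr_imp {p q : S} {σ : H.Asg} : Tr (triple M 2 p q) σ ↔ (Tr p σ → Tr q σ) := true_imp σ.2

theorem tr_all {i p : S} {σ : H.Asg} : Tr (triple M 3 i p) σ ↔ ∀ a, Tr p (σ.set i a) :=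
  (true_all σ.2).trans ⟨fun h a => h a.1 a.2, fun h a ha => h ⟨a, ha⟩⟩

theorem tr_mem {i j : S} {σ : H.Asg} : Tr (triple M 0 i j) σ ↔ σ.get i ≺ σ.get j := true_mem σ.2

theorem tr_eq {i j : S} {σ : H.Asg} : Tr (triple M 1 i j) σ ↔ σ.get i = σ.get j :=
  (true_eq σ.2).trans ⟨fun h => Subtype.ext h, fun h => congrArg Subtype.val h⟩

theorem not_tr_bot {p q : S} {σ : H.Asg} : ¬ Tr (triple M 4 p q) σ := not_true_bot σ.2

section Schemes

variable {υ : ℕ → S} {s d : ℕ} {σ : H.Asg}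

theorem tr_code_imp {p q : Scheme} : Tr (code M υ s (.imp p q)) σ ↔
    (Tr (code M υ s p) σ → Tr (code M υ s q) σ) := tr_imp

theorem tr_code_neg {p : Scheme} : Tr (code M υ s (.neg p)) σ ↔ ¬ Tr (code M υ s p) σ :=
  tr_imp.trans (imp_congr_right fun _ => iff_false_intro not_tr_bot)

theorem tr_code_and {p q : Scheme} : Tr (code M υ s (.and p q)) σ ↔
    Tr (code M υ s p) σ ∧ Tr (code M υ s q) σ := by
  rw [Scheme.and, tr_code_neg, tr_code_imp, tr_code_neg]; tauto

theorem tr_code_or {p q : Scheme} : Tr (code M υ s (.or p q)) σ ↔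
    Tr (code M υ s p) σ ∨ Tr (code M υ s q) σ := by
  rw [Scheme.or, tr_code_imp, tr_code_neg]; tauto

theorem tr_code_iff {p q : Scheme} : Tr (code M υ s (.iff p q)) σ ↔
    (Tr (code M υ s p) σ ↔ Tr (code M υ s q) σ) := by
  rw [Scheme.iff, tr_code_and, tr_code_imp, tr_code_imp]; tauto

theorem tr_code_all {x : Ix} {p : Scheme} : Tr (code M υ s (.all x p)) σ ↔
    ∀ a, Tr (code M υ s p) (σ.set (ixCode M υ s x) a) := tr_all

theorem tr_code_ex {x : Ix} {p : Scheme} : Tr (code M υ s (.ex x p)) σ ↔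
    ∃ a, Tr (code M υ s p) (σ.set (ixCode M υ s x) a) := by
  simp only [Scheme.ex, tr_code_neg, tr_code_all, not_forall, not_not]

@[simp] theorem tr_sent_mem {i j : ℕ} : Tr (code M υ s (Sent.mem (.num i) (.num j) d)) σ ↔
    σ.var i ≺ σ.var j := tr_mem
@[simp] theorem tr_sent_eq {i j : ℕ} : Tr (code M υ s (Sent.eq (.num i) (.num j) d)) σ ↔
    σ.var i = σ.var j := tr_eq
@[simp] theorem tr_sent_neg {A : Sent.SBld} : Tr (code M υ s (Sent.neg A d)) σ ↔
    ¬ Tr (code M υ s (A d)) σ := tr_code_neg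
@[simp] theorem tr_sent_imp {A B : Sent.SBld} : Tr (code M υ s (Sent.imp A B d)) σ ↔
    (Tr (code M υ s (A d)) σ → Tr (code M υ s (B d)) σ) := tr_code_imp
@[simp] theorem tr_sent_and {A B : Sent.SBld} : Tr (code M υ s (Sent.and A B d)) σ ↔
    Tr (code M υ s (A d)) σ ∧ Tr (code M υ s (B d)) σ := tr_code_and
@[simp] theorem tr_sent_or {A B : Sent.SBld} : Tr (code M υ s (Sent.or A B d)) σ ↔
    Tr (code M υ s (A d)) σ ∨ Tr (code M υ s (B d)) σ := tr_code_or
@[simp] theorem tr_sent_iff {A B : Sent.SBld} : Tr (code M υ s (Sent.iff A B d)) σ ↔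
    (Tr (code M υ s (A d)) σ ↔ Tr (code M υ s (B d)) σ) := tr_code_iff
@[simp] theorem tr_sent_all {A : Ix → Sent.SBld} : Tr (code M υ s (Sent.all A d)) σ ↔
    ∀ a, Tr (code M υ s (A (.num d) (d + 1))) (σ.set (num M d) a) := tr_code_all
@[simp] theorem tr_sent_ex {A : Ix → Sent.SBld} : Tr (code M υ s (Sent.ex A d)) σ ↔
    ∃ a, Tr (code M υ s (A (.num d) (d + 1))) (σ.set (num M d) a) := tr_code_ex

end Schemes

/-! ### Set-theoretic notions in the hierarchy -/

/-- `x ⊆ y`. -/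
def Sub (x y : H.El) : Prop := ∀ z, z ≺ x → z ≺ y
/-- `x` is empty. -/
def Empty (x : H.El) : Prop := ∀ y, ¬ y ≺ x
/-- `w = {x, y}`. -/
def IsPair (w x y : H.El) : Prop := ∀ z, z ≺ w ↔ z = x ∨ z = y
/-- `w = x ∪ {x}`. -/
def IsSucc (w x : H.El) : Prop := ∀ z, z ≺ w ↔ z ≺ x ∨ z = x
/-- `⟨x, y⟩ ∈ f`. -/
def PairMem (x y f : H.El) : Prop := ∃ p, p ≺ f ∧ ∀ w, w ≺ p ↔ IsPair w x x ∨ IsPair w x y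
/-- `x` is an ordinal. -/
def IsOrdinal (x : H.El) : Prop := (∀ y, y ≺ x → Sub y x) ∧
  ∀ y z, y ≺ x ∧ z ≺ x → y ≺ z ∨ y = z ∨ z ≺ y
/-- `x` is a limit ordinal. -/
def IsLimit (x : H.El) : Prop := IsOrdinal x ∧ ¬ Empty x ∧ ∀ y, y ≺ x → ∃ z, IsSucc z y ∧ z ≺ x
/-- `f` is single-valued. -/
def SingleValued (f : H.El) : Prop := ∀ x y z, PairMem x y f ∧ PairMem x z f → y = z

section Notions

variable {υ : ℕ → S} {s d i j k : ℕ} {σ : H.Asg}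

theorem tr_subset (hi : i < d) (hj : j < d) :
    Tr (code M υ s (Sent.subset (.num i) (.num j) d)) σ ↔ Sub (σ.var i) (σ.var j) := by
  simp [Sent.subset, Sub, hi.ne, hj.ne]

theorem tr_isEmpty (hi : i < d) :
    Tr (code M υ s (Sent.isEmpty (.num i) d)) σ ↔ Empty (σ.var i) := by
  simp [Sent.isEmpty, Empty, hi.ne]

theorem tr_isPair (hi : i < d) (hj : j < d) (hk : k < d) :
    Tr (code M υ s (Sent.isPair (.num i) (.num j) (.num k) d)) σ ↔
      IsPair (σ.var i) (σ.var j) (σ.var k) := by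
  simp [Sent.isPair, IsPair, hi.ne, hj.ne, hk.ne]

theorem tr_isSucc (hi : i < d) (hj : j < d) :
    Tr (code M υ s (Sent.isSucc (.num i) (.num j) d)) σ ↔ IsSucc (σ.var i) (σ.var j) := by
  simp [Sent.isSucc, IsSucc, hi.ne, hj.ne]

theorem tr_pairMem (hi : i < d) (hj : j < d) (hk : k < d) :
    Tr (code M υ s (Sent.pairMem (.num i) (.num j) (.num k) d)) σ ↔
      PairMem (σ.var i) (σ.var j) (σ.var k) := by
  simp [Sent.pairMem, PairMem, tr_isPair (show d + 1 < d + 1 + 1 by omega)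
    (show i < d + 1 + 1 by omega) (show i < d + 1 + 1 by omega),
    tr_isPair (show d + 1 < d + 1 + 1 by omega)
    (show i < d + 1 + 1 by omega) (show j < d + 1 + 1 by omega), hi.ne, hj.ne, hk.ne,
    show i ≠ d + 1 by omega, show j ≠ d + 1 by omega]

theorem tr_isOrdinal (hi : i < d) :
    Tr (code M υ s (Sent.isOrdinal (.num i) d)) σ ↔ IsOrdinal (σ.var i) := by
  simp [Sent.isOrdinal, Sent.isTransitive, IsOrdinal, tr_subset (show d < d + 1 by omega)
    (show i < d + 1 by omega), hi.ne, show i ≠ d + 1 by omega]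

theorem tr_isLimit (hi : i < d) :
    Tr (code M υ s (Sent.isLimit (.num i) d)) σ ↔ IsLimit (σ.var i) := by
  simp [Sent.isLimit, IsLimit, tr_isOrdinal hi, tr_isEmpty hi,
    tr_isSucc (show d + 1 < d + 1 + 1 by omega) (show d < d + 1 + 1 by omega), hi.ne,
    show i ≠ d + 1 by omega]

theorem tr_isSingleValued (hi : i < d) :
    Tr (code M υ s (Sent.isSingleValued (.num i) d)) σ ↔ SingleValued (σ.var i) := by
  simp [-Subtype.forall, Sent.isSingleValued, SingleValued, show d ≠ d + 1 + 1 by omega,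
    tr_pairMem (show d < d + 1 + 1 + 1 by omega) (show d + 1 < d + 1 + 1 + 1 by omega)
      (show i < d + 1 + 1 + 1 by omega),
    tr_pairMem (show d < d + 1 + 1 + 1 by omega) (show d + 1 + 1 < d + 1 + 1 + 1 by omega)
      (show i < d + 1 + 1 + 1 by omega), hi.ne, show i ≠ d + 1 by omega,
    show i ≠ d + 1 + 1 by omega]

end Notions

/-! ### Existence of elements -/

theorem El.ext {x y : H.El} (h : ∀ z, z ≺ x ↔ z ≺ y) : x = y :=
  Subtype.ext (H.ext x.2 y.2 fun a =>
    ⟨fun ha => (h ⟨a, (H.mem ha).1⟩).1 ha, fun ha => (h ⟨a, (H.mem ha).1⟩).2 ha⟩)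

theorem exists_el {D X : M} (hD : H.Level D) (hX : ∀ a, a ε X → a ε D) :
    ∃ b : H.El, ∀ a : H.El, a ≺ b ↔ a.1 ε X := by
  obtain ⟨b, hb, h⟩ := H.coded hD hX
  exact ⟨⟨b, hb⟩, fun a => h a.1⟩

theorem exists_level (x : H.El) : ∃ D, H.Level D ∧ x.1 ε D ∧ ∀ a, Str.P a x.1 ε H.E → a ε D := by
  obtain ⟨D, hD, hx⟩ := H.cover x.2
  exact ⟨D, hD, hx, fun a ha => H.trans hD hx ha⟩

theorem exists_sub (x : H.El) (Z : M) : ∃ y : H.El, ∀ z, z ≺ y ↔ z ≺ x ∧ z.1 ε Z := by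
  obtain ⟨D, hD, -, h⟩ := exists_level x
  obtain ⟨y, hy⟩ := exists_el (X := cl fun a => Str.P a x.1 ε H.E ∧ a ε Z) hD
    fun a ha => h a ((mem_cl).1 ha).1
  exact ⟨y, fun z => (hy z).trans mem_cl⟩

theorem exists_isPair (x y : H.El) : ∃ w, IsPair w x y := by
  obtain ⟨D, hD, hx, -⟩ := exists_level x
  obtain ⟨D', hD', hy, -⟩ := exists_level y
  obtain ⟨D'', hD'', h⟩ := H.directed hD hD'
  obtain ⟨w, hw⟩ := exists_el (X := cl fun a => a = x.1 ∨ a = y.1) hD'' fun a ha => by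
    rcases (mem_cl).1 ha with rfl | rfl
    · exact h _ (.inl hx)
    · exact h _ (.inr hy)
  refine ⟨w, fun z => (hw z).trans ((mem_cl).trans ?_)⟩
  rw [Subtype.ext_iff, Subtype.ext_iff]

theorem exists_sUnion (x : H.El) : ∃ w : H.El, ∀ z, z ≺ w ↔ ∃ y, y ≺ x ∧ z ≺ y := by
  obtain ⟨D, hD, -, h⟩ := exists_level x
  obtain ⟨w, hw⟩ := exists_el (X := cl fun a => ∃ b, Str.P b x.1 ε H.E ∧ Str.P a b ε H.E) hD
    fun a ha => by
      obtain ⟨b, hb, hab⟩ := (mem_cl).1 ha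
      exact H.trans hD (h b hb) hab
  exact ⟨w, fun z => (hw z).trans ((mem_cl).trans
    ⟨fun ⟨b, hb, hz⟩ => ⟨⟨b, (H.mem hb).1⟩, hb, hz⟩, fun ⟨b, hb, hz⟩ => ⟨b.1, hb, hz⟩⟩)⟩

/-- All members of `x` lie in one level, so all subsets of `x` lie in a further one, whose
subclasses are coded. -/
theorem exists_powerset (x : H.El) : ∃ w : H.El, ∀ z, z ≺ w ↔ Sub z x := by
  obtain ⟨D, hD, -, h⟩ := exists_level x
  obtain ⟨D', hD', h'⟩ := H.power hD
  obtain ⟨w, hw⟩ := exists_el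
    (X := cl fun b => b ε H.N ∧ ∀ a, Str.P a b ε H.E → Str.P a x.1 ε H.E) hD' fun b hb => by
      obtain ⟨h1, h2⟩ := (mem_cl).1 hb
      exact h' b h1 fun a ha => h a (h2 a ha)
  refine ⟨w, fun z => (hw z).trans ((mem_cl).trans ⟨fun h1 a ha => h1.2 a.1 ha, fun h1 =>
    ⟨z.2, fun a ha => h1 ⟨a, (H.mem ha).1⟩ ha⟩⟩)⟩

theorem exists_lt_minimal {x y : H.El} (h : y ≺ x) : ∃ y, y ≺ x ∧ ¬ ∃ z, z ≺ x ∧ z ≺ y := by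
  have key : ∀ a, a ε (cl fun a => Str.P a x.1 ε H.E) ↔ Str.P a x.1 ε H.E := fun a =>
    mem_cl (R := fun a => Str.P a x.1 ε H.E)
  obtain ⟨b, hb, hbN, hmin⟩ := H.wf ((key _).2 h) y.2
  exact ⟨⟨b, hbN⟩, (key b).1 hb, fun ⟨z, hz, hzb⟩ => hmin z.1 hzb ((key _).2 hz)⟩

/-- Universal choice is applied to the class of members of each `y`. Disjointness ensures that a
chosen element found in `y` was chosen for `y` and for no other member of `x`. -/
theorem exists_transversal (x : H.El) (hne : ∀ y, y ≺ x → ∃ z, z ≺ y)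
    (hdis : ∀ y y', y ≺ x ∧ y' ≺ x ∧ (∃ z, z ≺ y ∧ z ≺ y') → y = y') :
    ∃ c : H.El, ∀ y, y ≺ x → ∃ z, ∀ u, u ≺ y ∧ u ≺ c ↔ u = z := by
  obtain ⟨D, hD, -, h⟩ := exists_level x
  obtain ⟨c, hc⟩ := exists_el (X := cl fun z => ∃ y, Str.P y x.1 ε H.E ∧ ∃ G W,
    (∀ a, a ε G ↔ Str.P a y ε H.E) ∧ (∀ Z, Z ε W ↔ Z = z) ∧ Str.P G W ε CHO M ∧ z ε G) hD
    fun z hz => by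
      obtain ⟨y, hy, G, W, hG, -, -, hzG⟩ := (mem_cl).1 hz
      exact H.trans hD (h y hy) ((hG z).1 hzG)
  refine ⟨c, fun y hy => ?_⟩
  have hG : ∀ a, a ε (cl fun a => Str.P a y.1 ε H.E) ↔ Str.P a y.1 ε H.E := fun a =>
    mem_cl (R := fun a => Str.P a y.1 ε H.E)
  obtain ⟨z₀, hz₀⟩ := hne y hy
  obtain ⟨z, hz, W, hW, hC⟩ := choice_exists ((hG _).2 hz₀)
  have hzy := (hG z).1 hz
  refine ⟨⟨z, (H.mem hzy).1⟩, fun u => ⟨fun ⟨huy, huc⟩ => ?_, ?_⟩⟩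
  · obtain ⟨y', hy', G, W', hG', hW', hC', huG⟩ := (mem_cl).1 ((hc u).1 huc)
    have : y = ⟨y', (H.mem hy').1⟩ := hdis _ _ ⟨hy, hy', u, huy, (hG' _).1 huG⟩
    subst this
    have hGG := ext_of_nonempty huG fun a => (hG' a).trans (hG a).symm
    rw [hGG] at hC'
    obtain rfl := choice_unique hC hC'
    exact Subtype.ext ((hW u.1).1 ((hW' u.1).2 rfl))
  · rintro rfl
    exact ⟨hzy, (hc _).2 ((mem_cl).2 ⟨y.1, hy, _, W, hG, hW, hC, hz⟩)⟩

/-! ### The copies of sets -/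

variable (H) in
/-- The copy of a set. -/
noncomputable def copy (x : S) : H.El :=
  ⟨base M x, H.mem_of_level H.level_base (mem_baseD.2 ⟨x, rfl⟩)⟩

theorem copy_inj {x y : S} : H.copy x = H.copy y ↔ x = y := Subtype.ext_iff.trans base_inj

theorem lt_copy {a : H.El} {y : S} : a ≺ H.copy y ↔ ∃ x, x ∈ₘ y ∧ a = H.copy x := by
  refine H.mem_base.trans ?_
  simp only [Subtype.ext_iff]; rfl

theorem copy_lt_copy {x y : S} : H.copy x ≺ H.copy y ↔ x ∈ₘ y := by
  simp [lt_copy, copy_inj]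

theorem empty_copy_zero : Empty (H.copy (zero M)) := fun a ha => by
  obtain ⟨x, hx, -⟩ := lt_copy.1 ha
  exact not_mem_zero x hx

theorem isSucc_copy (x : S) : IsSucc (H.copy (succ M x)) (H.copy x) := fun z => by
  simp only [lt_copy, mem_succ]
  constructor
  · rintro ⟨y, hy | rfl, rfl⟩
    · exact .inl ⟨y, hy, rfl⟩
    · exact .inr rfl
  · rintro (⟨y, hy, rfl⟩ | rfl)
    · exact ⟨y, .inl hy, rfl⟩
    · exact ⟨x, .inr rfl, rfl⟩

/-- By separation a subclass of a set is a set, so the hierarchy adds no new subsets to copies of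
sets. -/
theorem sub_copy {x : H.El} {y : S} (h : Sub x (H.copy y)) :
    ∃ z, x = H.copy z ∧ ∀ u, u ∈ₘ z → u ∈ₘ y := by
  obtain ⟨z, hz⟩ := exists_sep (M := M)
    (cl fun X => Str.P (Str.P ↟(zero M) X) x.1 ε H.E) y
  have key : ∀ u, u ∈ₘ z ↔ u ∈ₘ y ∧ H.copy u ≺ x := fun u => (hz u).trans
    (and_congr_right fun _ => mem_cl (R := fun X => Str.P (Str.P ↟(zero M) X) x.1 ε H.E))
  refine ⟨z, El.ext fun a => ?_, fun u hu => ((key u).1 hu).1⟩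
  rw [lt_copy]
  constructor
  · intro ha
    obtain ⟨u, hu, rfl⟩ := lt_copy.1 (h a ha)
    exact ⟨u, (key u).2 ⟨hu, ha⟩, rfl⟩
  · rintro ⟨u, hu, rfl⟩
    exact ((key u).1 hu).2

theorem isOrdinal_copy {x : S} (hx : Ord M x) : IsOrdinal (H.copy x) := by
  constructor
  · rintro y hy z hz
    obtain ⟨y, hy', rfl⟩ := lt_copy.1 hy
    obtain ⟨z, hz', rfl⟩ := lt_copy.1 hz
    exact copy_lt_copy.2 (hx.1 y hy' z hz')
  · rintro y z ⟨hy, hz⟩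
    obtain ⟨y, hy', rfl⟩ := lt_copy.1 hy
    obtain ⟨z, hz', rfl⟩ := lt_copy.1 hz
    rw [copy_lt_copy, copy_lt_copy, copy_inj]
    exact hx.2 y z hy' hz'

/-- Copies are written out as pairs with first component `zero M`, which makes the relation induced
by `f` on sets definable by a stratified formula. -/
theorem exists_function (f : H.El) :
    ∃ Z : M, ∀ x y : S, Str.P ↟x ↟y ε Z ↔ PairMem (H.copy x) (H.copy y) f := by
  refine ⟨cl fun W => ∃ x y : S, W = Str.P ↟x ↟y ∧ ∃ p, p ε H.N ∧ Str.P p f.1 ε H.E ∧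
    ∀ w, w ε H.N → (Str.P w p ε H.E ↔
      (∀ z, z ε H.N → (Str.P z w ε H.E ↔ z = Str.P ↟(zero M) ↟x ∨ z = Str.P ↟(zero M) ↟x)) ∨
      (∀ z, z ε H.N → (Str.P z w ε H.E ↔ z = Str.P ↟(zero M) ↟x ∨ z = Str.P ↟(zero M) ↟y))),
    fun x y => (mem_cl).trans ?_⟩
  simp only [PairMem, IsPair, Subtype.exists, Subtype.forall, Subtype.mk.injEq, El.lt, copy, base,
    P_inj, emb_inj]
  constructor
  · rintro ⟨x, y, ⟨rfl, rfl⟩, p, hp, h⟩; exact ⟨p, hp, h⟩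
  · rintro ⟨p, hp, h⟩; exact ⟨x, y, ⟨rfl, rfl⟩, p, hp, h⟩

/-- Replacement in `V` applies to every function of the hierarchy; both regularity and the strong
limit property come from here. -/
theorem exists_image_copy {f : H.El} (hf : SingleValued f) (a : S) : ∃ b : S, ∀ y : S, y ∈ₘ b ↔
    ∃ x : S, x ∈ₘ a ∧ PairMem (H.copy x) (H.copy y) f :=
  exists_image (R := fun x y => PairMem (H.copy x) (H.copy y) f)
    (fun _ _ _ h₁ h₂ => copy_inj.1 (hf _ _ _ ⟨h₁, h₂⟩)) (exists_function f) a

variable (H) in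
/-- The element whose members are the copies of the ordinals is an inaccessible cardinal. -/
theorem exists_inaccessible : ∃ k : H.El, IsOrdinal k ∧ (∃ w, w ≺ k ∧ IsLimit w) ∧
    (∀ l, l ≺ k → ∀ f, SingleValued f → ∃ b, b ≺ k ∧
      ∀ x y, x ≺ l ∧ y ≺ k ∧ PairMem x y f → y ≺ b) ∧
    ∀ l, l ≺ k → ¬ ∃ f, SingleValued f ∧ ∀ y, y ≺ k → ∃ x, Sub x l ∧ PairMem x y f := by
  obtain ⟨k, hk⟩ := exists_el (X := cl fun a => ∃ x : S, ↟x ε ORD M ∧ a = Str.P ↟(zero M) ↟x)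
    H.level_base fun a ha => by
      obtain ⟨x, -, rfl⟩ := (mem_cl).1 ha
      exact mem_baseD.2 ⟨x, rfl⟩
  replace hk : ∀ a, a ≺ k ↔ ∃ x, Ord M x ∧ a = H.copy x := fun a => (hk a).trans ((mem_cl).trans
    (exists_congr fun x => and_congr mem_ORD
      ⟨fun h => Subtype.ext h, fun h => congrArg Subtype.val h⟩))
  refine ⟨k, ⟨fun y hy z hz => ?_, fun y z h => ?_⟩, ?_, fun l hl f hf => ?_, fun l hl => ?_⟩
  · obtain ⟨y, hy', rfl⟩ := (hk y).1 hy
    obtain ⟨z, hz', rfl⟩ := lt_copy.1 hz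
    exact (hk _).2 ⟨z, hy'.mem hz', rfl⟩
  · obtain ⟨y, hy, rfl⟩ := (hk y).1 h.1
    obtain ⟨z, hz, rfl⟩ := (hk z).1 h.2
    rw [copy_lt_copy, copy_lt_copy, copy_inj]
    exact hy.trichotomy hz
  · obtain ⟨w, hw, ⟨x, hx⟩, hs⟩ := exists_limit M
    refine ⟨H.copy w, (hk _).2 ⟨w, hw, rfl⟩, isOrdinal_copy hw,
      fun h => h _ (copy_lt_copy.2 hx), fun y hy => ?_⟩
    obtain ⟨y, hy', rfl⟩ := lt_copy.1 hy
    exact ⟨_, isSucc_copy y, copy_lt_copy.2 (hs y hy')⟩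
  · obtain ⟨l, -, rfl⟩ := (hk l).1 hl
    -- The image of `l` is a set, and sets of ordinals are bounded.
    obtain ⟨b, hb⟩ := exists_image_copy hf l
    obtain ⟨c, hc, hbc⟩ := exists_ord_bound (M := M) b
    refine ⟨H.copy c, (hk _).2 ⟨c, hc, rfl⟩, ?_⟩
    rintro x y ⟨hx, hy, hxy⟩
    obtain ⟨x, hx', rfl⟩ := lt_copy.1 hx
    obtain ⟨y, hy', rfl⟩ := (hk y).1 hy
    exact copy_lt_copy.2 (hbc y ((hb y).2 ⟨x, hx', hxy⟩) hy')
  · obtain ⟨l, -, rfl⟩ := (hk l).1 hl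
    rintro ⟨f, hf, hfk⟩
    obtain ⟨p, hp⟩ := exists_power (M := M) l
    -- The image of the power set of `l` is a set, and some ordinal is missing from it.
    obtain ⟨b, hb⟩ := exists_image_copy hf p
    obtain ⟨y, hy, hyb⟩ := exists_ord_not_mem (M := M) b
    obtain ⟨x, hx, hxy⟩ := hfk _ ((hk _).2 ⟨y, hy, rfl⟩)
    obtain ⟨x, rfl, hx'⟩ := sub_copy hx
    exact hyb ((hb y).2 ⟨x, (hp x).2 hx', hxy⟩)

/-! ### The axioms hold in the hierarchy -/

section Axioms

variable {υ : ℕ → S} {s : ℕ} (σ : H.Asg)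

theorem tr_extensionality : Tr (code M υ s Sent.extensionality) σ := by
  simp only [Sent.extensionality, Sent.close, tr_sent_all, tr_sent_imp, tr_sent_iff, tr_sent_mem,
    tr_sent_eq, Asg.var_set]
  intro x y h
  exact El.ext (by simpa using h)

theorem tr_pair : Tr (code M υ s Sent.pair) σ := by
  simp only [Sent.pair, Sent.close, tr_sent_all, tr_sent_ex]
  intro x y
  obtain ⟨w, hw⟩ := exists_isPair x y
  exact ⟨w, by rw [tr_isPair (by omega) (by omega) (by omega)]; simpa using hw⟩

theorem tr_union : Tr (code M υ s Sent.union) σ := by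
  simp [-Subtype.forall, -Subtype.exists, Sent.union, Sent.close]
  exact fun x => exists_sUnion x

theorem tr_power : Tr (code M υ s Sent.power) σ := by
  simp [-Subtype.forall, -Subtype.exists, Sent.power, Sent.close, tr_subset]
  exact fun x => exists_powerset x

theorem tr_infinity : Tr (code M υ s Sent.infinity) σ := by
  simp [-Subtype.forall, -Subtype.exists, Sent.infinity, Sent.close, tr_isEmpty, tr_isSucc]
  obtain ⟨w, hw⟩ := exists_omega M
  refine ⟨H.copy w, ⟨_, copy_lt_copy.2 ((hw _).2 zero_mem_NAT), empty_copy_zero⟩, fun x hx => ?_⟩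
  obtain ⟨x, hx', rfl⟩ := lt_copy.1 hx
  exact ⟨_, isSucc_copy x, copy_lt_copy.2 ((hw _).2 (succ_mem_NAT ((hw x).1 hx')))⟩

theorem tr_foundation : Tr (code M υ s Sent.foundation) σ := by
  simp only [Sent.foundation, Sent.close, tr_sent_all, tr_sent_ex, tr_sent_imp, tr_sent_and,
    tr_sent_neg, tr_sent_mem, Asg.var_set]
  rintro x ⟨y, hy⟩
  simpa using exists_lt_minimal (x := x) (y := y) (by simpa using hy)

theorem tr_choice : Tr (code M υ s Sent.choice) σ := by
  simp only [Sent.choice, Sent.close, tr_sent_all, tr_sent_ex, tr_sent_imp, tr_sent_and,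
    tr_sent_iff, tr_sent_eq, tr_sent_mem, Asg.var_set]
  intro x h
  simpa using exists_transversal x (by simpa using h.1) (by simpa using h.2)

theorem tr_inaccessible : Tr (code M υ s Sent.inaccessible) σ := by
  simp [-Subtype.forall, -Subtype.exists, Sent.inaccessible, Sent.close, Sent.isInaccessible, Sent.isRegular, Sent.isStrongLimit,
    tr_isOrdinal, tr_isLimit, tr_isSingleValued, tr_pairMem, tr_subset]
  simpa using exists_inaccessible H

end Axioms

end Hierarchy
end SModel

namespace SModel

variable {M S : Type} [SModel M S]

local notation:50 x:51 " ∈ₘ " y:51 => Str.mem (Str.emb x : M) (Str.emb y)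

namespace Hierarchy

variable {H : Hierarchy M}

local infix:50 " ≺ " => El.lt

/-! ## Soundness of the coded calculus -/

/-- The class that an instance of separation asks for; the modified assignment is replaced by any
assignment agreeing with `τ` away from `i`. -/
theorem exists_extension (p i : S) (τ : H.Asg) : ∃ Z : M, ∀ c : H.El,
    c.1 ε Z ↔ Tr p (τ.set i c) := by
  refine ⟨cl fun c => ∃ s, s ε H.ASG ∧ (∀ (j : S) (b : M), ¬ j = i → Str.P ↟j b ε τ.1 →
    Str.P ↟j b ε s) ∧ Str.P ↟i c ε s ∧ Str.P ↟p (Str.P ↟(num M 1) s) ε H.TR,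
    fun c => (mem_cl).trans ⟨?_, fun h => ?_⟩⟩
  · rintro ⟨s, hs, h, hc, hp⟩
    have := eq_up τ.2 hs h
    rw [← (mem_iff_ap hs).1 hc] at this
    rw [this] at hp
    exact hp
  · exact ⟨_, (τ.set i c).2, fun j b hj hb => up_agree j b hj hb, mem_up.2 (.inl ⟨rfl, rfl⟩), h⟩

/-- The truth of `u` does not depend on the value of the variable `x`. -/
def Indep (H : Hierarchy M) (x u : S) : Prop := ∀ (σ : H.Asg) (b : H.El), Tr u (σ.set x b) ↔ Tr u σ

theorem exists_indep (H : Hierarchy M) (x : S) : ∃ Z : M, ∀ u : S, ↟u ε Z ↔ H.Indep x u := by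
  refine ⟨cl fun u => ∀ s t, s ε H.ASG → t ε H.ASG → (∀ (j : S) (b : M), ¬ j = x →
    Str.P ↟j b ε s → Str.P ↟j b ε t) → (Str.P u (Str.P ↟(num M 1) t) ε H.TR ↔
    Str.P u (Str.P ↟(num M 1) s) ε H.TR), fun u => (mem_cl).trans ⟨fun h σ b => ?_, ?_⟩⟩
  · exact h _ _ σ.2 (σ.set x b).2 fun j b hj hb => up_agree j b hj hb
  · intro h s t hs ht hst
    rw [eq_up hs ht hst]
    exact h ⟨s, hs⟩ ⟨_, ap_mem ht x⟩

theorem exists_true (H : Hierarchy M) : ∃ Z : M, ∀ u : S, ↟u ε Z ↔ ∀ σ : H.Asg, Tr u σ :=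
  ⟨cl fun u => ∀ s, s ε H.ASG → Str.P u (Str.P ↟(num M 1) s) ε H.TR, fun _ => (mem_cl).trans
    ⟨fun h σ => h σ.1 σ.2, fun h s hs => h ⟨s, hs⟩⟩⟩

theorem Asg.get_set_ne (σ : H.Asg) {i j : S} (a : H.El) (h : j ≠ i) :
    (σ.set i a).get j = σ.get j := by
  rw [Asg.get_set, if_neg h]

variable {ρ : ℕ → M}

/-- Induction along the formation sequence. Atomic formulas do not look at `x`, and at a quantifier
the modifications at `x` and at the bound variable commute. The condition on `ok` covers all larger
scopes because it is evaluated under further quantifiers. -/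
theorem indep_of_isFormWith {ok : LTerm → Bld} {υ : ℕ → S} {s k : ℕ} {x : S} (hk : k < s)
    (hok : ∀ (υ' : ℕ → S) (s' i : ℕ), s ≤ s' → i < s' → (∀ l < s, lv υ' s' l = lv υ s l) →
      (ok (.svar i) 0 s').Sat ρ υ' → lv υ' s' i ≠ x)
    (h : ((isFormWith ok (.svar k)) 0 s).Sat ρ υ) : H.Indep x (lv υ s k) := by
  obtain ⟨Z, hZ⟩ := exists_indep H x
  refine inSequence_induction hk h hZ fun υ' hυ' hJ hQ => ?_
  simp only [Bld.sat_or, Bld.sat_exS, Bld.sat_and, Bld.sat_mem, val_svar, val_P] at hJ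
  rcases hJ with ⟨i, j, -, hi, -, hj, hc | hc⟩ | hc | ⟨b, c, ⟨j, hb⟩, ⟨j', hc⟩, h⟩ |
    ⟨i, b, -, hi, ⟨j, hb⟩, h⟩
  · have hi' := hok _ _ _ (by omega) (by omega)
      (fun l hl => by simp (disch := omega) only [lv_lift, hυ' l hl]) hi
    have hj' := hok _ _ _ (by omega) (by omega)
      (fun l hl => by simp (disch := omega) only [lv_lift, hυ' l hl]) hj
    have hc' := (sat_isCode (by simp only [Scheme.Scoped, Ix.Scoped, LTerm.Scoped]; omega)
      (by omega)).1 hc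
    simp (disch := omega) only [lv_lift, lv_new, code, ixCode, LTerm.sval] at hi' hj' hc'
    rw [hc']
    intro σ a
    rw [tr_mem, tr_mem, Asg.get_set_ne _ _ hi', Asg.get_set_ne _ _ hj']
  · have hi' := hok _ _ _ (by omega) (by omega)
      (fun l hl => by simp (disch := omega) only [lv_lift, hυ' l hl]) hi
    have hj' := hok _ _ _ (by omega) (by omega)
      (fun l hl => by simp (disch := omega) only [lv_lift, hυ' l hl]) hj
    have hc' := (sat_isCode (by simp only [Scheme.Scoped, Ix.Scoped, LTerm.Scoped]; omega)
      (by omega)).1 hc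
    simp (disch := omega) only [lv_lift, lv_new, code, ixCode, LTerm.sval] at hi' hj' hc'
    rw [hc']
    intro σ a
    rw [tr_eq, tr_eq, Asg.get_set_ne _ _ hi', Asg.get_set_ne _ _ hj']
  · rw [(sat_isCode (p := .bot) trivial (by omega)).1 hc]
    exact fun σ a => iff_of_false not_tr_bot not_tr_bot
  · have h' := (sat_isCode (by simp only [Scheme.Scoped, LTerm.Scoped]; omega) (by omega)).1 h
    simp (disch := omega) only [lv_lift, lv_new, code, LTerm.sval] at h' hb hc
    rw [h']
    intro σ a
    rw [tr_imp, tr_imp, hQ b ⟨j, hb⟩ σ a, hQ c ⟨j', hc⟩ σ a]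
  · have hi' := hok _ _ _ (by omega) (by omega)
      (fun l hl => by simp (disch := omega) only [lv_lift, hυ' l hl]) hi
    have h' := (sat_isCode (by simp only [Scheme.Scoped, Ix.Scoped, LTerm.Scoped]; omega)
      (by omega)).1 h
    simp (disch := omega) only [lv_lift, lv_new, code, ixCode, LTerm.sval] at h' hb hi'
    rw [h']
    intro σ a
    rw [tr_all, tr_all]
    refine forall_congr' fun e => ?_
    rw [Asg.set_comm _ _ _ hi'.symm, hQ b ⟨j, hb⟩]

theorem indep_of_isFormWithout {υ : ℕ → S} {s x p : ℕ} (hx : x < s) (hp : p < s)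
    (h : ((isFormWithout (.svar x) (.svar p)) 0 s).Sat ρ υ) :
    H.Indep (lv υ s x) (lv υ s p) := by
  refine indep_of_isFormWith hp (fun υ' s' i _ _ hl hi => ?_) h
  simp only [Bld.sat_neg, Bld.sat_eq, val_svar, emb_inj] at hi
  rwa [hl x hx] at hi

theorem tr_separation {υ : ℕ → S} {s p : ℕ} (hp : H.Indep (num M 1) (lv υ s p)) (σ : H.Asg) :
    Tr (code M υ s (Sent.separation (.svar p))) σ := by
  simp only [Sent.separation, tr_code_all, tr_code_ex, tr_code_iff, tr_code_and]
  intro a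
  change ∃ b, ∀ c, (Tr (triple M 0 _ _) _ ↔ Tr (triple M 0 _ _) _ ∧ Tr (lv υ s p) _)
  simp only [ixCode, tr_mem]
  obtain ⟨Z, hZ⟩ := exists_extension (lv υ s p) (num M 2) (σ.set (num M 0) a)
  obtain ⟨b, hb⟩ := exists_sub a Z
  refine ⟨b, fun c => ?_⟩
  have h0 := Asg.var_set (H := H)
  simp only [Asg.var] at h0
  simp only [h0]
  -- Moving the modification at `v₁` outermost lets independence remove it from the truth of `p`.
  rw [Asg.set_comm _ b c (by simp [num_inj]), hp, ← hZ]
  simpa using hb c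

/-- All instances of a scheme that is true under all assignments are true. -/
theorem tr_of_isCode {p : Scheme} {υ : ℕ → S} {s k : ℕ} (hk : k < s)
    (h : ((isCode p (.svar k)) 0 s).Sat ρ υ) (hp : p.Scoped s)
    (ht : ∀ σ : H.Asg, Tr (code M υ s p) σ) (σ : H.Asg) : Tr (lv υ s k) σ :=
  (sat_isCode hp hk).1 h ▸ ht σ

theorem tr_of_isLogicalAxiom {υ : ℕ → S} {s k : ℕ} (hk : k < s)
    (h : ((isLogicalAxiom (.svar k)) 0 s).Sat ρ υ) (σ : H.Asg) : Tr (lv υ s k) σ := by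
  simp only [isLogicalAxiom, Bld.sat_or, Bld.sat_exS, Bld.sat_and] at h
  rcases h with ⟨p, q, -, -, h⟩ | ⟨p, q, r, -, -, -, h⟩ | ⟨p, -, h⟩ | ⟨x, p, q, -, -, -, h⟩ |
    ⟨x, p, -, hp, h⟩ | ⟨x, y, -, -, h⟩ | ⟨x, y, z, -, -, -, h | h | h⟩
  · have := tr_of_isCode (H := H) (by omega) h
      (by simp only [Scheme.Scoped, LTerm.Scoped]; omega)
      (fun σ => by simp only [tr_code_imp]; tauto) σ
    simpa (disch := omega) only [lv_lift] using this
  · have := tr_of_isCode (H := H) (by omega) h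
      (by simp only [Scheme.Scoped, LTerm.Scoped]; omega)
      (fun σ => by simp only [tr_code_imp]; tauto) σ
    simpa (disch := omega) only [lv_lift] using this
  · have := tr_of_isCode (H := H) (by omega) h
      (by simp only [Scheme.neg, Scheme.Scoped, and_true, LTerm.Scoped]; omega)
      (fun σ => by simp only [tr_code_imp, tr_code_neg]; tauto) σ
    simpa (disch := omega) only [lv_lift] using this
  · have := tr_of_isCode (H := H) (by omega) h
      (by simp only [Scheme.Scoped, Ix.Scoped, LTerm.Scoped]; omega)
      (fun σ => by simp only [tr_code_imp, tr_code_all]; exact fun h1 h2 a => h1 a (h2 a)) σ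
    simpa (disch := omega) only [lv_lift] using this
  · have hi := indep_of_isFormWithout (H := H) (by omega) (by omega) hp
    have := tr_of_isCode (H := H) (by omega) h
      (by simp only [Scheme.Scoped, Ix.Scoped, LTerm.Scoped]; omega)
      (fun σ => by
        simp only [tr_code_imp, tr_code_all]
        exact fun h a => (hi σ a).2 h) σ
    simpa (disch := omega) only [lv_lift] using this
  · have := tr_of_isCode (H := H) (by omega) h
      (by simp only [Scheme.neg, Scheme.Scoped, and_true, Ix.Scoped, LTerm.Scoped]; omega)
      (fun σ => by
        simp only [tr_code_neg, tr_code_all, not_forall, not_not]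
        simp (disch := omega) only [code, ixCode, LTerm.sval, lv_lift, lv_new, tr_eq]
        refine ⟨σ.get y, ?_⟩
        rw [Asg.get_set, if_pos rfl, Asg.get_set]
        split_ifs <;> rfl) σ
    simpa (disch := omega) only [lv_lift] using this
  all_goals
    have := tr_of_isCode (H := H) (by omega) h
      (by simp only [Scheme.Scoped, Ix.Scoped, LTerm.Scoped]; omega)
      (fun σ => by
        simp only [tr_code_imp]
        simp only [code, tr_eq, tr_mem]
        intro h1 h2
        first | exact h1.symm.trans h2 | exact h1 ▸ h2) σ
    simpa (disch := omega) only [lv_lift] using this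

theorem tr_of_isZCAxiom {υ : ℕ → S} {s k : ℕ} (hk : k < s)
    (h : ((isZCAxiom (.svar k)) 0 s).Sat ρ υ) : ∀ σ : H.Asg, Tr (lv υ s k) σ := by
  simp only [isZCAxiom, Bld.sat_or, Bld.sat_exS, Bld.sat_and] at h
  rcases h with h | h | h | h | h | h | h | ⟨p, hp, h⟩
  · exact tr_of_isCode hk h (by repeat' constructor) tr_extensionality
  · exact tr_of_isCode hk h (by repeat' constructor) tr_pair
  · exact tr_of_isCode hk h (by repeat' constructor) tr_union
  · exact tr_of_isCode hk h (by repeat' constructor) tr_power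
  · exact tr_of_isCode hk h (by repeat' constructor) tr_infinity
  · exact tr_of_isCode hk h (by repeat' constructor) tr_foundation
  · exact tr_of_isCode hk h (by repeat' constructor) tr_choice
  · have hi : H.Indep (num M 1) (lv (scons p υ) (s + 1) s) := by
      refine indep_of_isFormWith (by omega) (fun υ' s' i _ h1 _ hi => ?_) hp
      rwa [Bld.sat_neg, sat_isNum h1] at hi
    have := tr_of_isCode (H := H) (by omega) h
      (by refine ⟨trivial, ⟨⟨trivial, ⟨trivial, ?_⟩, trivial⟩, trivial⟩⟩; repeat' constructor)
      (tr_separation hi)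
    simpa (disch := omega) only [lv_lift] using this

/-- The entries of a proof are true under all assignments; quantifying over assignments makes the
generalization rule sound. -/
theorem tr_of_isTheorem {T : LTerm → Bld}
    (hT : ∀ (υ : ℕ → S) (s k : ℕ), k < s → ((T (.svar k)) 0 s).Sat ρ υ →
      ∀ σ : H.Asg, Tr (lv υ s k) σ)
    {υ : ℕ → S} {s k : ℕ} (hk : k < s) (h : ((isTheorem T (.svar k)) 0 s).Sat ρ υ) :
    ∀ σ : H.Asg, Tr (lv υ s k) σ := by
  obtain ⟨Z, hZ⟩ := exists_true H
  refine inSequence_induction hk h hZ fun υ' hυ' hJ hQ => ?_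
  simp only [Bld.sat_or, Bld.sat_exS, Bld.sat_and, Bld.sat_mem, val_svar, val_P] at hJ
  rcases hJ with h | h | ⟨b, c, ⟨j, hb⟩, ⟨j', hc⟩, h⟩ | ⟨x, b, -, ⟨j, hb⟩, h⟩
  · exact tr_of_isLogicalAxiom (by omega) h
  · exact hT _ _ _ (by omega) h
  · have h' := (sat_isCode (by simp only [Scheme.Scoped, LTerm.Scoped]; omega) (by omega)).1 h
    simp (disch := omega) only [lv_lift, lv_new, code, LTerm.sval] at h' hb hc
    intro σ
    have hcσ := hQ c ⟨j', hc⟩ σ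
    rw [h', tr_imp] at hcσ
    exact hcσ (hQ b ⟨j, hb⟩ σ)
  · have h' := (sat_isCode (by simp only [Scheme.Scoped, Ix.Scoped, LTerm.Scoped]; omega)
      (by omega)).1 h
    simp (disch := omega) only [lv_lift, lv_new, code, ixCode, LTerm.sval] at h' hb
    rw [h']
    exact fun σ => tr_all.2 fun a => hQ b ⟨j, hb⟩ _

end Hierarchy

/-- A coded proof of falsity would make falsity true under some assignment, and assignments exist.
-/
theorem sat_conZCInaccessible (ρ : ℕ → M) (υ : ℕ → S) : conZCInaccessible.Sat ρ υ := by
  obtain ⟨H⟩ := exists_hierarchy M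
  obtain ⟨s, hs⟩ := H.exists_mem_ASG
  simp only [conZCInaccessible, con, Bld.close, Bld.sat_neg, Bld.sat_exS, Bld.sat_and]
  rintro ⟨u, hu, ht⟩
  have h := Hierarchy.tr_of_isTheorem (H := H) (fun υ' s' k hk hT => by
    rw [Bld.sat_or] at hT
    rcases hT with hT | hT
    · exact Hierarchy.tr_of_isZCAxiom hk hT
    · exact Hierarchy.tr_of_isCode hk hT (by repeat' constructor)
        Hierarchy.tr_inaccessible) (by omega) ht ⟨s, hs⟩
  rw [(sat_isCode (p := .bot) trivial (by omega)).1 hu] at h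
  exact Hierarchy.not_tr_bot h

end SModel

end FefermanS

theorem mainTheorem9 : FefermanS.Provable FefermanS.SStar FefermanS.conZCInaccessible :=
  FefermanS.Provable.of_models fun M S _ hinj hT ρ υ =>
    letI : FefermanS.SModel M S :=
      { nonempty_sets := ⟨υ 0⟩
        emb_injective := hinj
        sat_of_sstar := hT }
    FefermanS.SModel.sat_conZCInaccessible ρ υ
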